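/- Let $w\ge 0$, let $Q$ be a non-degenerate real bilinear form on $\mathbb R^m$ with $Q(x,y)=(-1)^wQ(y,x)$, extended bilinearly to $\mathbb C^m$, and let $D$ be the period domain of strongly polarized Hodge filtrations $F$ of weight $w$ on $\mathbb C^m$ with fixed Hodge numbers $h^{w-i,i}$, $0\le i\le w$. That is, $\mathbb C^m=F^0\supseteq\dots\supseteq F^{w+1}=0$, $\mathbb C^m=F^p\oplus\overline{F^{w+1-p}}$, $Q(F^p,F^{w+1-p})=0$, $\dim H^{p,w-p}=h^{p,w-p}$ for $H^{p,q}=F^p\cap\overline{F^q}$, and $h_C(x,y)=(-1)^{w(w-1)/2}\,i^{\,p-q}\,Q(x,\bar y)$ is positive definite on $H^{p,q}$, $p+q=w$. $D$ carries its complex structure as an open subset of a homogeneous space of the complex orthogonal group of $Q$. The *horizontal system* on $D$ is the differential system defined by the distribution $\partial F^{p}\subseteq F^{p-1}$. Fix $H\in D$ and a Hodge frame of $H$, i.e. $h_C$-unitary bases of the spaces $H^{w-i,i}$, those of $H^{p,q}$ and $H^{q,p}$ being conjugate to each other. Write matrices in this frame in blocks $Y_{i,j}$ of size $h^{w-i,i}\times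 h^{w-j,j}$, $0\le i,j\le w$. Let $G^-$ be the group of all $Y$ with $Y_{i,i}=I$, $Y_{i,j}=0$ for $i<j$, and $Y^tQY=Q$ (where $Q$ also denotes its matrix in the frame). The map $\Psi:Y\mapsto Y\cdot H$ gives local coordinates on $D$ ("Lie group coordinates"). Let $W$ be the complex manifold of all $Y$ with $Y_{i,i}=I$, $Y_{i,j}=0$ for $i<j$ and for $i>j+2$, whose blocks $Y_{i,j}$ with $i\le j+2$ satisfy the relations that hold between these blocks on $G^-$, namely the blocks $(l,j)$ with $l+j\ge w-2$ of $Y^tQY=Q$. Let $pr_W$ be the map replacing the blocks $Y_{i,j}$ with $i>j+2$ by $0$. The *coupled contact system* on $W$ is generated by the entries of the matrices of 1-forms $$dY_{i,j}-Y_{i,j+1}\,dY_{j+1,j},\qquad i=j+2 .$$ A germ at a point of an integral manifold is given by a holomorphic immersion of a neighbourhood of $0\in\mathbb C^k$ sending $0$ to the point and annihilating the system, two immersions defining the same germ if their images agree near the point; $k$ is its dimension. An integral element at a point is a linear subspace of the holomorphic tangent space on which all forms of the differential ideal of the system vanish. **Theorem.** $pr_W(G^-)=W$. Let $Y_0\in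 G^-$ with $\Psi(Y_0)\in D$ (for instance $Y_0=I$, $\Psi(Y_0)=H$). Then: 1. Every germ at $\Psi(Y_0)$ of an integral manifold of the horizontal system on $D$ is the image under $\Psi$ of a germ in $G^-$, and applying $pr_W$ to the latter defines a bijection between the germs at $\Psi(Y_0)$ of integral manifolds of the horizontal system on $D$ and the germs at $pr_W(Y_0)$ of integral manifolds of the coupled contact system on $W$. A germ has dimension $k$ if and only if the corresponding germ has dimension $k$. 2. In the coordinates $\Psi$, the map $E\mapsto pr_W(E)$ is a dimension-preserving bijection between the integral elements at $Y_0$ of the horizontal system and the integral elements at $pr_W(Y_0)$ of the coupled contact system. -/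

import Mathlib

open Matrix Filter Topology Module

noncomputable section

namespace HodgeContact

/-! ### Hodge filtrations and the period domain

The real vector space is `ℝ^m`, its complexification is `ℂ^m = Fin m → ℂ`, with complex conjugation
`star` (coordinatewise), and the bilinear form is given by its real Gram matrix `Q`. -/

/-- The conjugate of a complex subspace of `ℂ^m`. -/
def conjSubmodule {m : ℕ} (S : Submodule ℂ (Fin m → ℂ)) : Submodule ℂ (Fin m → ℂ) where
  carrier := {x | star x ∈ S}
  add_mem' := by
    intro x y hx hy
    simpa [star_add] using S.add_mem hx hy
  zero_mem' := by simp
  smul_mem' := by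
    intro c x hx
    simpa [star_smul] using S.smul_mem (star c) hx

/-- The complex bilinear extension of `Q` to `ℂ^m`. -/
def pairing {m : ℕ} (Q : Matrix (Fin m) (Fin m) ℝ) (x y : Fin m → ℂ) : ℂ :=
  x ⬝ᵥ (Q.map ((↑) : ℝ → ℂ) *ᵥ y)

/-- A family of subspaces `F^0, F^1, F^2, …` of `ℂ^m`. -/
abbrev Filtration (m : ℕ) : Type := ℕ → Submodule ℂ (Fin m → ℂ)

/-- The Hodge space `H^{p,w-p} = F^p ∩ conj F^{w-p}`, for `p ≤ w`. -/
def hodgePiece {m : ℕ} (w : ℕ) (F : Filtration m) (p : ℕ) : Submodule ℂ (Fin m → ℂ) :=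
  F p ⊓ conjSubmodule (F (w - p))

/-- The hermitian form `h_C(x,y) = (-1)^{w(w-1)/2} Q(Cx, conj y)` for `x` in `H^{p,q}`, `q = w - p`,
where the Weil operator `C` is multiplication by `i^{p-q}`. -/
def hodgeForm {m : ℕ} (w : ℕ) (Q : Matrix (Fin m) (Fin m) ℝ) (p : ℕ) (x y : Fin m → ℂ) : ℂ :=
  (-1) ^ (w * (w - 1) / 2) * Complex.I ^ ((p : ℤ) - ((w : ℤ) - (p : ℤ))) * pairing Q x (star y)

/-- Strongly polarized Hodge filtrations of weight `w`, with Hodge numbers `h^{w-i,i} = h i`.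
(The number `h_C(x,x)` is automatically real, and the Hodge spaces are automatically orthogonal
for `h_C`.) -/
structure IsPolarizedHodgeFiltration {m : ℕ} (w : ℕ) (h : Fin (w + 1) → ℕ)
    (Q : Matrix (Fin m) (Fin m) ℝ) (F : Filtration m) : Prop where
  anti : Antitone F
  zero : F 0 = ⊤
  last : F (w + 1) = ⊥
  compl : ∀ p ≤ w + 1, IsCompl (F p) (conjSubmodule (F (w + 1 - p)))
  dim : ∀ i : Fin (w + 1), finrank ℂ (hodgePiece w F (w - (i : ℕ))) = h i
  isotropic : ∀ p ≤ w + 1, ∀ x ∈ F p, ∀ y ∈ F (w + 1 - p), pairing Q x y = 0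
  pos : ∀ p ≤ w, ∀ x ∈ hodgePiece w F p, x ≠ 0 → 0 < (hodgeForm w Q p x x).re

/-- The period domain `D`. -/
def periodDomain {m : ℕ} (w : ℕ) (h : Fin (w + 1) → ℕ) (Q : Matrix (Fin m) (Fin m) ℝ) :
    Set (Filtration m) :=
  {F | IsPolarizedHodgeFiltration w h Q F}

/-! ### Horizontal immersions into the period domain

The complex structure of `D` is that of an open subset of the homogeneous space of the complex
orthogonal group of `Q`: a map to `D` is holomorphic if it lifts locally to a holomorphic map to
this group. The tangent space at `F` is the Lie algebra modulo the endomorphisms that preserve `F`.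
-/

/-- The complex orthogonal group of `Q`. -/
def orthogonalSet {m : ℕ} (Q : Matrix (Fin m) (Fin m) ℝ) : Set (Matrix (Fin m) (Fin m) ℂ) :=
  {g | gᵀ * Q.map ((↑) : ℝ → ℂ) * g = Q.map ((↑) : ℝ → ℂ)}

/-- `g` is a holomorphic lift of `f` near `z₀`: `f z = g z • f z₀`, with `g z₀ = 1`. -/
def IsLiftAt {m k : ℕ} (Q : Matrix (Fin m) (Fin m) ℝ) (f : (Fin k → ℂ) → Filtration m)
    (z₀ : Fin k → ℂ) (g : (Fin k → ℂ) → Matrix (Fin m) (Fin m) ℂ) : Prop :=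
  g z₀ = 1 ∧ ∀ᶠ z in 𝓝 z₀, DifferentiableAt ℂ g z ∧ g z ∈ orthogonalSet Q ∧
    ∀ p, f z p = (f z₀ p).map (g z).mulVecLin

/-- `f` is holomorphic near `z₀`, its differential at `z₀` takes values in the horizontal
distribution (`∂F^{p+1} ⊆ F^p`), and this differential is injective. Neither condition depends on
the lift, since the derivatives of two lifts differ by endomorphisms preserving `f z₀`. -/
def IsHorizontalImmersionAt {m k : ℕ} (Q : Matrix (Fin m) (Fin m) ℝ)
    (f : (Fin k → ℂ) → Filtration m) (z₀ : Fin k → ℂ) : Prop :=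
  ∃ g, IsLiftAt Q f z₀ g ∧
    (∀ v p, ∀ x ∈ f z₀ (p + 1), (fderiv ℂ g z₀ v) *ᵥ x ∈ f z₀ p) ∧
    (∀ v, (∀ p, ∀ x ∈ f z₀ p, (fderiv ℂ g z₀ v) *ᵥ x ∈ f z₀ p) → v = 0)

/-- Germs at `F₀` of `k`-dimensional integral manifolds of the horizontal system on `D`.
Such a germ is given by a holomorphic immersion `f` of a neighbourhood of `0` in `ℂ^k`, and is
recorded as the filter generated by the images `f(U)` of the neighbourhoods `U` of `0`: two
immersions give the same filter if and only if their images agree near `F₀` (every `f(U)` contains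
some `f'(U')`, and conversely). -/
def IsHorizontalGerm {m : ℕ} (w : ℕ) (h : Fin (w + 1) → ℕ) (Q : Matrix (Fin m) (Fin m) ℝ)
    (F₀ : Filtration m) (k : ℕ) (𝓖 : Filter (Filtration m)) : Prop :=
  ∃ f : (Fin k → ℂ) → Filtration m, f 0 = F₀ ∧
    (∀ᶠ z in 𝓝 0, f z ∈ periodDomain w h Q ∧ IsHorizontalImmersionAt Q f z) ∧
    𝓖 = map f (𝓝 0)

/-! ### Hodge frames and Lie group coordinates -/

/-- Indices of a Hodge frame: the block `i` belongs to `H^{w-i,i}` and has size `h i`. -/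
abbrev BlockIndex {w : ℕ} (h : Fin (w + 1) → ℕ) : Type := (i : Fin (w + 1)) × Fin (h i)

/-- Square matrices with their block decomposition. -/
abbrev BlockMatrix {w : ℕ} (h : Fin (w + 1) → ℕ) : Type :=
  Matrix (BlockIndex h) (BlockIndex h) ℂ

/-- The block `Y_{i,j}`. -/
def blk {w : ℕ} {h : Fin (w + 1) → ℕ} (i j : Fin (w + 1)) (Y : BlockMatrix h) :
    Matrix (Fin (h i)) (Fin (h j)) ℂ :=
  fun a c => Y ⟨i, a⟩ ⟨j, c⟩

/-- `b` is a Hodge frame of the polarized Hodge filtration `H`: an `h_C`-unitary basis of each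
`H^{w-i,i}`, the bases of `H^{w-i,i}` and `H^{i,w-i}` being conjugate to each other. -/
structure IsHodgeFrame {m w : ℕ} {h : Fin (w + 1) → ℕ} (Q : Matrix (Fin m) (Fin m) ℝ)
    (H : Filtration m) (b : Basis (BlockIndex h) ℂ (Fin m → ℂ)) : Prop where
  mem : ∀ (i : Fin (w + 1)) (a : Fin (h i)), b ⟨i, a⟩ ∈ hodgePiece w H (w - (i : ℕ))
  unitary : ∀ (i : Fin (w + 1)) (a c : Fin (h i)),
    hodgeForm w Q (w - (i : ℕ)) (b ⟨i, a⟩) (b ⟨i, c⟩) = if a = c then 1 else 0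
  conj : ∀ (i : Fin (w + 1)) (a : Fin (h i)) (c : Fin (h i.rev)), (a : ℕ) = (c : ℕ) →
    star (b ⟨i, a⟩) = b ⟨i.rev, c⟩

/-- The matrix of `Q` in the frame `b`. -/
def gram {m w : ℕ} {h : Fin (w + 1) → ℕ} (Q : Matrix (Fin m) (Fin m) ℝ)
    (b : Basis (BlockIndex h) ℂ (Fin m → ℂ)) : BlockMatrix h :=
  fun s t => pairing Q (b s) (b t)

/-- Block lower triangular matrices with identity diagonal blocks. -/
def IsBlockUnipotent {w : ℕ} {h : Fin (w + 1) → ℕ} (Y : BlockMatrix h) : Prop :=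
  (∀ i, blk i i Y = 1) ∧ ∀ i j, i < j → blk i j Y = 0

/-- The unipotent group `G⁻`, in the frame `b`: the block unipotent matrices which preserve `Q`
(equivalently, the exponentials of the elements of the Lie algebra `𝔤⁻`). -/
def unipotentGroup {m w : ℕ} {h : Fin (w + 1) → ℕ} (Q : Matrix (Fin m) (Fin m) ℝ)
    (b : Basis (BlockIndex h) ℂ (Fin m → ℂ)) : Set (BlockMatrix h) :=
  {Y | IsBlockUnipotent Y ∧ Yᵀ * gram Q b * Y = gram Q b}

/-- The Lie group coordinates `Ψ : Y ↦ Y • H` around the reference Hodge filtration `H`. -/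
def groupCoord {m w : ℕ} {h : Fin (w + 1) → ℕ} (H : Filtration m)
    (b : Basis (BlockIndex h) ℂ (Fin m → ℂ)) (Y : BlockMatrix h) : Filtration m :=
  fun p => (H p).map (Matrix.toLin b b Y)

/-! ### The manifold `W` and the projection to it -/

/-- The manifold `W`: block unipotent matrices with `Y_{i,j} = 0` for `i > j + 2`, the remaining
blocks being subject to the relations between the blocks `Y_{i,j}`, `i ≤ j + 2`, of an element
of `G⁻`. These are the blocks `(l,j)` with `l + j ≥ w - 2` of `Yᵀ Q Y = Q`, as the block `(l,j)`
of `Yᵀ Q Y` only involves the `Y_{i,j'}` with `i ≤ j' + (w - l - j)`. -/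
def contactManifold {m w : ℕ} {h : Fin (w + 1) → ℕ} (Q : Matrix (Fin m) (Fin m) ℝ)
    (b : Basis (BlockIndex h) ℂ (Fin m → ℂ)) : Set (BlockMatrix h) :=
  {Y | IsBlockUnipotent Y ∧
    (∀ i j : Fin (w + 1), (j : ℕ) + 2 < (i : ℕ) → blk i j Y = 0) ∧
    ∀ l j : Fin (w + 1), w ≤ (l : ℕ) + (j : ℕ) + 2 →
      blk l j (Yᵀ * gram Q b * Y) = blk l j (gram Q b)}

/-- The projection `pr_W`: replace by zero the blocks `Y_{i,j}` with `i > j + 2`. -/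
def prW {w : ℕ} (h : Fin (w + 1) → ℕ) : BlockMatrix h →ₗ[ℂ] BlockMatrix h where
  toFun Y := Matrix.of fun s t => if (s.1 : ℕ) ≤ (t.1 : ℕ) + 2 then Y s t else 0
  map_add' := by
    intro X Y
    ext s t
    by_cases hst : (s.1 : ℕ) ≤ (t.1 : ℕ) + 2 <;> simp [hst]
  map_smul' := by
    intro c Y
    ext s t
    by_cases hst : (s.1 : ℕ) ≤ (t.1 : ℕ) + 2 <;> simp [hst]

/-! ### Differential systems on submanifolds of the space of block matrices -/

/-- Differential 1-forms on the space of block matrices. -/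
abbrev OneForm {w : ℕ} (h : Fin (w + 1) → ℕ) : Type := BlockMatrix h → BlockMatrix h →ₗ[ℂ] ℂ

/-- The exterior derivative of a 1-form: `dθ(A,B) = A(θ(B)) - B(θ(A))` for constant `A`, `B`. -/
def extD {w : ℕ} {h : Fin (w + 1) → ℕ} (θ : OneForm h) (Y A B : BlockMatrix h) : ℂ :=
  fderiv ℂ (fun Z => θ Z B) Y A - fderiv ℂ (fun Z => θ Z A) Y B

/-- The holomorphic tangent vectors at `Y` of a complex submanifold `X` of the space of block
matrices: the velocities at `0` of the holomorphic curves in `X` through `Y`. -/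
def tangentVectors {w : ℕ} {h : Fin (w + 1) → ℕ} (X : Set (BlockMatrix h)) (Y : BlockMatrix h) :
    Set (BlockMatrix h) :=
  {A | ∃ γ : ℂ → BlockMatrix h, γ 0 = Y ∧ (∀ᶠ t in 𝓝 0, DifferentiableAt ℂ γ t ∧ γ t ∈ X) ∧
    deriv γ 0 = A}

/-- Integral elements at `Y ∈ X` of the differential ideal on `X` generated by the 1-forms in `I`
and their exterior derivatives: the subspaces `E` of the tangent space on which all these forms,
hence all forms of the ideal, vanish. -/
def IsIntegralElement {w : ℕ} {h : Fin (w + 1) → ℕ} (X : Set (BlockMatrix h))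
    (I : Set (OneForm h)) (Y : BlockMatrix h) (E : Submodule ℂ (BlockMatrix h)) : Prop :=
  (∀ A ∈ E, A ∈ tangentVectors X Y) ∧
    ∀ θ ∈ I, (∀ A ∈ E, θ Y A = 0) ∧ ∀ A ∈ E, ∀ B ∈ E, extD θ Y A B = 0

/-- The tangent vector `A` at `Y ∈ G⁻` is mapped by the differential of the coordinates
`Y ↦ Y • H` to a horizontal tangent vector of `D` (`∂F^{p+1} ⊆ F^p`, where `F^p = Y H^p`). -/
def IsHorizontalVector {m w : ℕ} {h : Fin (w + 1) → ℕ} (H : Filtration m)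
    (b : Basis (BlockIndex h) ℂ (Fin m → ℂ)) (Y A : BlockMatrix h) : Prop :=
  ∀ p, ∀ x ∈ H (p + 1), Matrix.toLin b b A x ∈ groupCoord H b Y p

/-- The horizontal system near `Y₀`, in Lie group coordinates: all holomorphic 1-forms defined
near `Y₀` whose restriction to `G⁻` annihilates the horizontal distribution. -/
def horizontalForms {m w : ℕ} {h : Fin (w + 1) → ℕ} (Q : Matrix (Fin m) (Fin m) ℝ)
    (H : Filtration m) (b : Basis (BlockIndex h) ℂ (Fin m → ℂ)) (Y₀ : BlockMatrix h) :
    Set (OneForm h) :=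
  {θ | (∀ᶠ Y in 𝓝 Y₀, ∀ A, DifferentiableAt ℂ (fun Z => θ Z A) Y) ∧
    ∀ᶠ Y in 𝓝[unipotentGroup Q b] Y₀, ∀ A ∈ tangentVectors (unipotentGroup Q b) Y,
      IsHorizontalVector H b Y A → θ Y A = 0}

/-- The entry `(a,c)` of the matrix of 1-forms `dY_{i,j} - Y_{i,l} dY_{l,j}`. -/
def contactForm {w : ℕ} {h : Fin (w + 1) → ℕ} (i l j : Fin (w + 1)) (a : Fin (h i))
    (c : Fin (h j)) : OneForm h := fun Y =>
  { toFun := fun A => (blk i j A - blk i l Y * blk l j A) a c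
    map_add' := by
      intro A B
      simp only [blk, Matrix.sub_apply, Matrix.mul_apply, Matrix.add_apply, mul_add,
        Finset.sum_add_distrib]
      ring
    map_smul' := by
      intro r A
      simp only [blk, Matrix.sub_apply, Matrix.mul_apply, Matrix.smul_apply, smul_eq_mul,
        RingHom.id_apply, mul_sub, Finset.mul_sum]
      congr 1
      exact Finset.sum_congr rfl fun x _ => by ring }

/-- The generators of the coupled contact system: the entries of
`dY_{i,j} - Y_{i,j+1} dY_{j+1,j}` for `i = j + 2`. -/
def contactForms {w : ℕ} (h : Fin (w + 1) → ℕ) : Set (OneForm h) :=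
  {θ | ∃ (i l j : Fin (w + 1)) (a : Fin (h i)) (c : Fin (h j)),
    (l : ℕ) = (j : ℕ) + 1 ∧ (i : ℕ) = (j : ℕ) + 2 ∧ θ = contactForm i l j a c}

/-- Germs at `q` of `k`-dimensional integral manifolds of the coupled contact system on `W`,
given by holomorphic immersions `T` of a neighbourhood of `0` in `ℂ^k` into `W`, and recorded by
the germ of the image as for the horizontal system. -/
def IsContactGerm {m w : ℕ} {h : Fin (w + 1) → ℕ} (Q : Matrix (Fin m) (Fin m) ℝ)
    (b : Basis (BlockIndex h) ℂ (Fin m → ℂ)) (q : BlockMatrix h) (k : ℕ)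
    (𝓖 : Filter (BlockMatrix h)) : Prop :=
  ∃ T : (Fin k → ℂ) → BlockMatrix h, T 0 = q ∧
    (∀ᶠ z in 𝓝 0, DifferentiableAt ℂ T z ∧ T z ∈ contactManifold Q b ∧
      (∀ θ ∈ contactForms h, ∀ v, θ (T z) (fderiv ℂ T z v) = 0) ∧
      Function.Injective (fderiv ℂ T z)) ∧
    𝓖 = map T (𝓝 0)

end HodgeContact

end

/-! Grade block matrices by `i - j`. With respect to the form with Gram matrix `S = gram Q b`, `adj
S` is an anti-involution that preserves this degree, and `G⁻` consists of the unipotent `Y` with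
`adj S Y * Y = 1`. In Lie group coordinates a map `Y` is horizontal exactly when `Y⁻¹ dY` has degree
one. As `Y` is unipotent, this reads `dY = Y ω`, where `ω` is the degree one part of `dY` itself.

Read by degree, `dY = Y ω` is a tautology in degree one and is the coupled contact system in degree
two. In degree `d ≥ 3` it prescribes the differential of the blocks of degree `d` through blocks of
degree `d - 1`. So a solution `T` in `W` determines `ω`, and the discarded blocks are recovered by
successive integration. The obstruction is `d(Y ω) = Y ω ∧ ω`, because `dω = 0`, and differentiating
the degree two equation gives precisely `ω ∧ ω = 0` (`gradedPart_fderiv_comm`, `exists_lift_succ`).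
The lift stays in the group: `N = adj S Y * Y - 1` satisfies `dN = N ω - ω N` and starts at zero, so
it vanishes degree by degree (`exists_lift`). It is unique because the difference `M` of two lifts
satisfies `dM = M ω` (`eventuallyEq_of_fderiv_eq`). Without differential equations, the equality
`pr_W(G⁻) = W` follows from a Newton iteration (`exists_mem_gradedGroup`).

Germs on `D` and on `W` are both compared with germs in the group. For `D` this uses the holomorphic
factorization of matrices near `1` into a unipotent and a block triangular factor
(`exists_factorization`, `exists_group_lift`) and the openness of `D` in these coordinates
(`eventually_groupCoord_mem`). For `W`, two immersions with the same image germ differ by a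
reparametrization, which passes to the lifts (`map_le_map_of_map_prW_le`).

Integral elements of both systems are described by the same data: commuting spaces `𝔞` of matrices
`X` of degree one with `adj S X = -X`. The elements are `Y₀ 𝔞` in the group and `prW (Y₀ 𝔞)` in `W`.
-/

noncomputable section

namespace HodgeContact

/-! ### Holomorphic functions of several variables -/

section Holomorphic

variable {E F : Type*} [NormedAddCommGroup E] [NormedSpace ℂ E] [NormedAddCommGroup F]
  [NormedSpace ℂ F]

/-- Cauchy's formula on the complex line through `z` in direction `v`. It is the source of the
regularity of holomorphic maps of several variables: `C¹` for the inverse function theorem, and a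
second derivative for closedness arguments. -/
theorem fderiv_apply_eq_cderiv [CompleteSpace F] {f : E → F} {s : Set E}
    (hs : IsOpen s) (hf : DifferentiableOn ℂ f s) {z v : E} {r : ℝ} (hr : 0 < r)
    (hz : Metric.closedBall z (r * ‖v‖) ⊆ s) :
    fderiv ℂ f z v = Complex.cderiv r (fun ζ : ℂ => f (z + ζ • v)) 0 := by
  have hz0 : z ∈ s := hz (Metric.mem_closedBall_self (by positivity))
  have hcont : Continuous fun ζ : ℂ => z + ζ • v := by fun_prop
  rw [Complex.cderiv_eq_deriv (U := (fun ζ : ℂ => z + ζ • v) ⁻¹' s) (hs.preimage hcont) _ hr]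
  · have h1 : HasDerivAt (fun ζ : ℂ => z + ζ • v) v 0 := by
      simpa using ((hasDerivAt_id (0 : ℂ)).smul_const v).const_add z
    have h2 : HasFDerivAt f (fderiv ℂ f z) (z + (0 : ℂ) • v) := by
      simpa using (hf.differentiableAt (hs.mem_nhds hz0)).hasFDerivAt
    exact (h2.comp_hasDerivAt 0 h1).deriv.symm
  · intro ζ hζ
    exact hz (by
      simp only [Metric.mem_closedBall, dist_zero_right, dist_self_add_left, norm_smul] at hζ ⊢
      gcongr)
  · intro ζ hζ
    have h1 : DifferentiableAt ℂ (fun ζ : ℂ => z + ζ • v) ζ := by fun_prop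
    exact ((hf.differentiableAt (hs.mem_nhds hζ)).comp ζ h1).differentiableWithinAt

theorem continuousOn_fderiv_of_differentiableOn [FiniteDimensional ℂ E] [CompleteSpace F]
    {f : E → F} {s : Set E} (hs : IsOpen s) (hf : DifferentiableOn ℂ f s) :
    ContinuousOn (fderiv ℂ f) s := by
  refine continuousOn_clm_apply.2 fun v z₀ hz₀ => ContinuousAt.continuousWithinAt ?_
  obtain ⟨ε, hε, hball⟩ := Metric.isOpen_iff.1 hs z₀ hz₀
  -- The added `1` keeps the radius meaningful when `v = 0`.
  set r : ℝ := ε / 2 / (‖v‖ + 1) with hr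
  have hr0 : 0 < r := by positivity
  have hrv : r * ‖v‖ ≤ ε / 2 := by
    rw [hr, div_mul_eq_mul_div, div_le_iff₀ (by positivity)]
    nlinarith [norm_nonneg v]
  have hmem : ∀ z ∈ Metric.ball z₀ (ε / 2), ∀ ζ ∈ Metric.ball (0 : ℂ) r, z + ζ • v ∈ s := by
    intro z hz ζ hζ
    refine hball ?_
    rw [Metric.mem_ball, dist_eq_norm] at *
    have : ‖z + ζ • v - z₀‖ ≤ ‖z - z₀‖ + ‖ζ‖ * ‖v‖ := by
      rw [← norm_smul, add_sub_right_comm]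
      exact norm_add_le _ _
    have h3 : ‖ζ‖ * ‖v‖ ≤ r * ‖v‖ := by
      gcongr
      simpa using hζ.le
    linarith
  have hdiff : ∀ z ∈ Metric.ball z₀ (ε / 2),
      DifferentiableOn ℂ (fun ζ : ℂ => f (z + ζ • v)) (Metric.ball 0 r) := by
    intro z hz ζ hζ
    have h1 : DifferentiableAt ℂ (fun ζ : ℂ => z + ζ • v) ζ := by fun_prop
    exact ((hf.differentiableAt (hs.mem_nhds (hmem z hz ζ hζ))).comp ζ h1).differentiableWithinAt
  have hz₀' : z₀ ∈ Metric.ball z₀ (ε / 2) := Metric.mem_ball_self (by positivity)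
  have hder : ∀ z ∈ Metric.ball z₀ (ε / 2),
      fderiv ℂ f z v = deriv (fun ζ : ℂ => f (z + ζ • v)) 0 := by
    intro z hz
    have h1 : HasDerivAt (fun ζ : ℂ => z + ζ • v) v 0 := by
      simpa using ((hasDerivAt_id (0 : ℂ)).smul_const v).const_add z
    have hzs : z ∈ s := by simpa using hmem z hz 0 (Metric.mem_ball_self hr0)
    have h2 : HasFDerivAt f (fderiv ℂ f z) (z + (0 : ℂ) • v) := by
      simpa using (hf.differentiableAt (hs.mem_nhds hzs)).hasFDerivAt
    exact (h2.comp_hasDerivAt 0 h1).deriv.symm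
  -- Locally uniform limits of holomorphic functions of one variable can be differentiated, so
  -- continuity of `f` along nearby parallel lines gives continuity of the directional derivative.
  have hunif : TendstoLocallyUniformlyOn (fun (z : E) (ζ : ℂ) => f (z + ζ • v))
      (fun ζ : ℂ => f (z₀ + ζ • v)) (𝓝 z₀) (Metric.ball 0 r) := by
    rw [tendstoLocallyUniformlyOn_iff_forall_tendsto]
    intro ζ hζ
    have hfc : ContinuousAt f (z₀ + ζ • v) :=
      (hf.differentiableAt (hs.mem_nhds (hmem z₀ hz₀' ζ hζ))).continuousAt
    have h1 : Tendsto (fun y : E × ℂ => f (z₀ + y.2 • v)) (𝓝 z₀ ×ˢ 𝓝 ζ) (𝓝 (f (z₀ + ζ • v))) := by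
      refine hfc.tendsto.comp ?_
      rw [← nhds_prod_eq]
      have : Continuous fun y : E × ℂ => z₀ + y.2 • v := by fun_prop
      exact this.tendsto (z₀, ζ)
    have h2 : Tendsto (fun y : E × ℂ => f (y.1 + y.2 • v)) (𝓝 z₀ ×ˢ 𝓝 ζ)
        (𝓝 (f (z₀ + ζ • v))) := by
      refine hfc.tendsto.comp ?_
      rw [← nhds_prod_eq]
      have : Continuous fun y : E × ℂ => y.1 + y.2 • v := by fun_prop
      exact this.tendsto (z₀, ζ)
    have h3 := (h1.prodMk_nhds h2).mono_right (nhds_le_uniformity _)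
    exact h3.mono_left (Filter.prod_mono le_rfl nhdsWithin_le_nhds)
  have hd := hunif.deriv (Filter.eventually_of_mem
    (Metric.ball_mem_nhds z₀ (half_pos hε)) hdiff) Metric.isOpen_ball
  have := hd.tendsto_at (Metric.mem_ball_self hr0)
  rw [ContinuousAt, hder z₀ hz₀']
  refine this.congr' ?_
  filter_upwards [Metric.ball_mem_nhds z₀ (half_pos hε)] with z hz
  exact (hder z hz).symm

/-- A linear map is a finite sum of coordinate forms times its values on a basis. -/
theorem differentiableAt_of_forall_apply [FiniteDimensional ℂ E] {G : Type*}
    [NormedAddCommGroup G] [NormedSpace ℂ G] {f : G → E →L[ℂ] F} {z : G}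
    (hf : ∀ v, DifferentiableAt ℂ (fun x => f x v) z) : DifferentiableAt ℂ f z := by
  let b := Module.finBasis ℂ E
  have key : f = fun x => ∑ i,
      ContinuousLinearMap.smulRightL ℂ E F (LinearMap.toContinuousLinearMap (b.coord i))
        (f x (b i)) := by
    funext x
    ext v
    suffices f x v = ∑ i, b.repr v i • f x (b i) by simpa
    conv_lhs => rw [← b.sum_repr v, map_sum]
    simp only [map_smul]
  rw [key]
  refine DifferentiableAt.fun_sum fun i _ => ?_
  exact (ContinuousLinearMap.differentiableAt _).comp z (hf (b i))

theorem differentiableOn_fderiv [FiniteDimensional ℂ E] [CompleteSpace F]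
    {f : E → F} {s : Set E} (hs : IsOpen s) (hf : DifferentiableOn ℂ f s) :
    DifferentiableOn ℂ (fderiv ℂ f) s := by
  intro z₀ hz₀
  refine DifferentiableAt.differentiableWithinAt (differentiableAt_of_forall_apply fun v => ?_)
  have : ProperSpace E := FiniteDimensional.proper ℂ E
  obtain ⟨ε, hε, hball⟩ := Metric.isOpen_iff.1 hs z₀ hz₀
  have hball' : Metric.closedBall z₀ (ε / 2) ⊆ s :=
    (Metric.closedBall_subset_ball (by linarith)).trans hball
  set r : ℝ := ε / 4 / (‖v‖ + 1) with hr
  have hr0 : 0 < r := by positivity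
  have hrv : r * ‖v‖ ≤ ε / 4 := by
    rw [hr, div_mul_eq_mul_div, div_le_iff₀ (by positivity)]
    nlinarith [norm_nonneg v]
  have hc := continuousOn_fderiv_of_differentiableOn hs hf
  -- Continuity of the derivative bounds it on a compact ball; this bound dominates the derivative
  -- of the Cauchy integrand, so that one may differentiate under the integral sign.
  obtain ⟨C, hC⟩ := (isCompact_closedBall z₀ (ε / 2)).exists_bound_of_continuousOn (hc.mono hball')
  have hmem : ∀ z ∈ Metric.ball z₀ (ε / 4), ∀ θ : ℝ,
      z + circleMap 0 r θ • v ∈ Metric.closedBall z₀ (ε / 2) := by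
    intro z hz θ
    rw [Metric.mem_ball, dist_eq_norm] at hz
    rw [Metric.mem_closedBall, dist_eq_norm]
    have : ‖z + circleMap 0 r θ • v - z₀‖ ≤ ‖z - z₀‖ + r * ‖v‖ := by
      have h1 : ‖circleMap 0 r θ • v‖ = r * ‖v‖ := by
        rw [norm_smul, norm_circleMap_zero, abs_of_pos hr0]
      rw [← h1, add_sub_right_comm]
      exact norm_add_le _ _
    linarith
  let c : ℝ → ℂ := fun θ => deriv (circleMap 0 r) θ * ((circleMap 0 r θ - 0) ^ 2)⁻¹
  have hcc : Continuous c := by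
    have h1 : Continuous fun θ => deriv (circleMap 0 r) θ := by
      simp only [deriv_circleMap]; fun_prop
    have h2 : Continuous fun θ => (circleMap 0 r θ - 0) ^ 2 := by fun_prop
    refine h1.mul (h2.inv₀ fun θ => ?_)
    simpa using hr0.ne'
  have heq : (fun z => fderiv ℂ f z v) =ᶠ[𝓝 z₀] fun z =>
      (2 * Real.pi * Complex.I : ℂ)⁻¹ •
        ∫ θ in (0 : ℝ)..2 * Real.pi, c θ • f (z + circleMap 0 r θ • v) := by
    filter_upwards [Metric.ball_mem_nhds z₀ (show 0 < ε / 4 by positivity)] with z hz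
    rw [fderiv_apply_eq_cderiv hs hf hr0 (v := v) (z := z)]
    · simp only [Complex.cderiv, circleIntegral, c, mul_smul]
    · intro y hy
      apply hball
      rw [Metric.mem_ball] at *
      rw [Metric.mem_closedBall] at hy
      linarith [dist_triangle y z z₀]
  refine (DifferentiableAt.const_smul ?_ _).congr_of_eventuallyEq heq
  have hline : ∀ z : E, Continuous fun θ : ℝ => z + circleMap 0 r θ • v := fun z => by fun_prop
  have hFc : ∀ z ∈ Metric.ball z₀ (ε / 4),
      Continuous fun θ => c θ • f (z + circleMap 0 r θ • v) := by
    intro z hz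
    refine hcc.smul (continuous_iff_continuousAt.2 fun θ => ?_)
    exact ContinuousAt.comp (f := fun θ : ℝ => z + circleMap 0 r θ • v)
      (hf.differentiableAt (hs.mem_nhds (hball' (hmem z hz θ)))).continuousAt (hline z).continuousAt
  have hF'c : ∀ z ∈ Metric.ball z₀ (ε / 4),
      Continuous fun θ => c θ • fderiv ℂ f (z + circleMap 0 r θ • v) := by
    intro z hz
    refine hcc.smul (continuous_iff_continuousAt.2 fun θ => ?_)
    exact ContinuousAt.comp (f := fun θ : ℝ => z + circleMap 0 r θ • v)
      (hc.continuousAt (hs.mem_nhds (hball' (hmem z hz θ)))) (hline z).continuousAt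
  have hz₀' : z₀ ∈ Metric.ball z₀ (ε / 4) := Metric.mem_ball_self (by positivity)
  refine (intervalIntegral.hasFDerivAt_integral_of_dominated_of_fderiv_le
    (F' := fun z θ => c θ • fderiv ℂ f (z + circleMap 0 r θ • v))
    (bound := fun θ => ‖c θ‖ * C) (Metric.ball_mem_nhds z₀ (show 0 < ε / 4 by positivity))
    ?_ ?_ ?_ ?_ ?_ ?_).differentiableAt
  · filter_upwards [Metric.ball_mem_nhds z₀ (show 0 < ε / 4 by positivity)] with z hz
    exact (hFc z hz).aestronglyMeasurable
  · exact (hFc z₀ hz₀').intervalIntegrable _ _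
  · exact (hF'c z₀ hz₀').aestronglyMeasurable
  · refine Filter.Eventually.of_forall fun θ _ z hz => ?_
    rw [norm_smul]
    exact mul_le_mul_of_nonneg_left (hC _ (hmem z hz θ)) (norm_nonneg _)
  · exact (hcc.norm.mul continuous_const).intervalIntegrable _ _
  · refine Filter.Eventually.of_forall fun θ _ z hz => ?_
    have h1 := (hf.differentiableAt (hs.mem_nhds (hball' (hmem z hz θ)))).hasFDerivAt
    exact ((hasFDerivAt_comp_add_right _).2 h1).const_smul (c θ)

theorem contDiffAt_one_of_eventually_differentiableAt [FiniteDimensional ℂ E] [CompleteSpace F]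
    {f : E → F} {z : E} (hf : ∀ᶠ x in 𝓝 z, DifferentiableAt ℂ f x) : ContDiffAt ℂ 1 f z := by
  obtain ⟨s, hsub, hs, hz⟩ := eventually_nhds_iff.1 hf
  have hd : DifferentiableOn ℂ f s := fun x hx => (hsub x hx).differentiableWithinAt
  have h1 : ContDiffOn ℂ 1 f s := by
    rw [show (1 : WithTop ℕ∞) = 0 + 1 from rfl, contDiffOn_succ_iff_fderiv_of_isOpen hs]
    refine ⟨hd, by simp, ?_⟩
    exact contDiffOn_zero.2 (continuousOn_fderiv_of_differentiableOn hs hd)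
  exact h1.contDiffAt (hs.mem_nhds hz)

end Holomorphic

/-! ### Graded matrices -/

section Graded

variable {ι : Type*} (deg : ι → ℕ)

/-- The matrices whose components of degree less than `d` vanish. -/
def lowerSub (d : ℕ) : Submodule ℂ (Matrix ι ι ℂ) where
  carrier := {X | ∀ s t, deg s < deg t + d → X s t = 0}
  add_mem' := fun hX hY s t hst => by simp [hX s t hst, hY s t hst]
  zero_mem' := fun s t _ => rfl
  smul_mem' := fun c X hX s t hst => by simp [hX s t hst]

/-- The component of degree `d` of a matrix. -/
def gradedPart (d : ℕ) : Matrix ι ι ℂ →ₗ[ℂ] Matrix ι ι ℂ where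
  toFun X := Matrix.of fun s t => if deg s = deg t + d then X s t else 0
  map_add' X Y := by ext s t; by_cases h : deg s = deg t + d <;> simp [h]
  map_smul' c X := by ext s t; by_cases h : deg s = deg t + d <;> simp [h]

variable {deg} {d e : ℕ} {X Y : Matrix ι ι ℂ}

theorem gradedPart_apply (X : Matrix ι ι ℂ) (s t : ι) :
    gradedPart deg d X s t = if deg s = deg t + d then X s t else 0 := rfl

theorem lowerSub_anti : Antitone (lowerSub deg) :=
  fun _ _ hde _ hX s t hst => hX s t (by omega)

theorem gradedPart_mem (X : Matrix ι ι ℂ) : gradedPart deg d X ∈ lowerSub deg d := by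
  intro s t hst
  rw [gradedPart_apply, if_neg (by omega)]

theorem gradedPart_gradedPart (X : Matrix ι ι ℂ) :
    gradedPart deg d (gradedPart deg d X) = gradedPart deg d X := by
  ext s t
  by_cases h : deg s = deg t + d <;> simp [gradedPart_apply, h]

theorem gradedPart_eq_zero (hX : X ∈ lowerSub deg d) (h : e < d) : gradedPart deg e X = 0 := by
  ext s t
  rw [gradedPart_apply]
  split_ifs with h'
  · exact hX s t (by omega)
  · rfl

theorem sub_gradedPart_mem (hX : X ∈ lowerSub deg d) :
    X - gradedPart deg d X ∈ lowerSub deg (d + 1) := by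
  intro s t hst
  rw [Matrix.sub_apply, gradedPart_apply]
  split_ifs with h
  · exact sub_self _
  · rw [hX s t (by omega), sub_zero]

theorem mem_lowerSub_succ (hX : X ∈ lowerSub deg d) (h0 : gradedPart deg d X = 0) :
    X ∈ lowerSub deg (d + 1) := by
  simpa [h0] using sub_gradedPart_mem hX

theorem eq_zero_of_mem_lowerSub {w : ℕ} (hdeg : ∀ s, deg s ≤ w) (hX : X ∈ lowerSub deg (w + 1)) :
    X = 0 := by
  ext s t
  exact hX s t (by have := hdeg s; omega)

theorem one_mem_lowerSub [DecidableEq ι] : (1 : Matrix ι ι ℂ) ∈ lowerSub deg 0 := by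
  intro s t hst
  exact Matrix.one_apply_ne fun h => by subst h; omega

theorem mem_lowerSub_zero [DecidableEq ι] (hX : X - 1 ∈ lowerSub deg 1) : X ∈ lowerSub deg 0 := by
  simpa using add_mem (lowerSub_anti (Nat.zero_le 1) hX) (one_mem_lowerSub (deg := deg))

variable [Fintype ι]

theorem mul_mem_lowerSub (hX : X ∈ lowerSub deg d) (hY : Y ∈ lowerSub deg e) :
    X * Y ∈ lowerSub deg (d + e) := by
  intro s t hst
  rw [Matrix.mul_apply]
  refine Finset.sum_eq_zero fun r _ => ?_
  by_cases h : deg s < deg r + d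
  · rw [hX s r h, zero_mul]
  · rw [hY r t (by omega), mul_zero]

theorem gradedPart_mul_gradedPart (X Y : Matrix ι ι ℂ) :
    gradedPart deg (d + e) (gradedPart deg d X * gradedPart deg e Y) =
      gradedPart deg d X * gradedPart deg e Y := by
  ext s t
  rw [gradedPart_apply]
  split_ifs with h
  · rfl
  · rw [Matrix.mul_apply]
    refine (Finset.sum_eq_zero fun r _ => ?_).symm
    by_cases h1 : deg s = deg r + d
    · rw [gradedPart_apply (X := Y), if_neg (by omega), mul_zero]
    · rw [gradedPart_apply, if_neg h1, zero_mul]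

variable [DecidableEq ι]

theorem mul_sub_one_mem (hX : X - 1 ∈ lowerSub deg 1) (hY : Y - 1 ∈ lowerSub deg 1) :
    X * Y - 1 ∈ lowerSub deg 1 := by
  have : X * Y - 1 = (X - 1) * Y + (Y - 1) := by noncomm_ring
  rw [this]
  exact add_mem (mul_mem_lowerSub hX (mem_lowerSub_zero hY)) hY

/-- The product `(X - 1) * Y` starts in degree `d + 1`. Hence `dY` and `Y⁻¹ dY` have the same degree
one part. -/
theorem gradedPart_mul_left (hX : X - 1 ∈ lowerSub deg 1) (hY : Y ∈ lowerSub deg d) :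
    gradedPart deg d (X * Y) = gradedPart deg d Y := by
  have h : X * Y = (X - 1) * Y + Y := by noncomm_ring
  rw [h, map_add, gradedPart_eq_zero (mul_mem_lowerSub hX hY) (by omega), zero_add]

/-! ### The adjoint with respect to a graded form -/

/-- `S` is the Gram matrix of a non-degenerate symmetric or antisymmetric form which pairs the
component of degree `i` with the component of degree `w - i`. -/
structure IsGradedForm (deg : ι → ℕ) (w : ℕ) (S : Matrix ι ι ℂ) : Prop where
  le : ∀ s, deg s ≤ w
  isUnit : IsUnit S.det
  apply_eq_zero : ∀ s t, deg s + deg t ≠ w → S s t = 0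
  symm : Sᵀ = (-1 : ℂ) ^ w • S

/-- The adjoint of `X` with respect to the form with Gram matrix `S`. -/
def adj (S : Matrix ι ι ℂ) : Matrix ι ι ℂ →ₗ[ℂ] Matrix ι ι ℂ where
  toFun X := S⁻¹ * Xᵀ * S
  map_add' X Y := by simp [mul_add, add_mul]
  map_smul' c X := by simp

/-- The group of matrices `Y` with `adj Y * Y = 1` which are unipotent for the grading. -/
def gradedGroup (deg : ι → ℕ) (S : Matrix ι ι ℂ) : Set (Matrix ι ι ℂ) :=
  {Y | Y - 1 ∈ lowerSub deg 1 ∧ adj S Y * Y = 1}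

variable {w : ℕ} {S : Matrix ι ι ℂ}

theorem adj_apply (S X : Matrix ι ι ℂ) : adj S X = S⁻¹ * Xᵀ * S := rfl

namespace IsGradedForm

variable (hS : IsGradedForm deg w S)

include hS

/-- Deleting from `S⁻¹` the entries off the antidiagonal degrees leaves a right inverse `T` of `S`,
which must then be `S⁻¹`. -/
theorem inv_apply_eq_zero (s t : ι) (hst : deg s + deg t ≠ w) : S⁻¹ s t = 0 := by
  let T : Matrix ι ι ℂ := Matrix.of fun a c => if deg a + deg c = w then S⁻¹ a c else 0
  have hT : S * T = 1 := by
    ext a c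
    have h1 : (S * T) a c = if deg a = deg c then (S * S⁻¹) a c else 0 := by
      rw [Matrix.mul_apply, Matrix.mul_apply]
      split_ifs with h
      · refine Finset.sum_congr rfl fun r _ => ?_
        by_cases hr : deg a + deg r = w
        · simp only [T, Matrix.of_apply, if_pos (show deg r + deg c = w by omega)]
        · rw [hS.apply_eq_zero a r hr, zero_mul, zero_mul]
      · refine Finset.sum_eq_zero fun r _ => ?_
        by_cases hr : deg a + deg r = w
        · simp only [T, Matrix.of_apply, if_neg (show ¬ deg r + deg c = w by omega), mul_zero]
        · rw [hS.apply_eq_zero a r hr, zero_mul]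
    rw [h1, Matrix.mul_nonsing_inv _ hS.isUnit]
    split_ifs with h
    · rfl
    · exact (Matrix.one_apply_ne fun hac => h (by rw [hac])).symm
  rw [Matrix.inv_eq_right_inv hT]
  simp [T, hst]

theorem mul_inv : S * S⁻¹ = 1 := Matrix.mul_nonsing_inv _ hS.isUnit

theorem inv_mul : S⁻¹ * S = 1 := Matrix.nonsing_inv_mul _ hS.isUnit

theorem adj_mul (X Y : Matrix ι ι ℂ) : adj S (X * Y) = adj S Y * adj S X := by
  simp only [adj_apply, Matrix.transpose_mul, mul_assoc]
  rw [← mul_assoc S S⁻¹, hS.mul_inv, one_mul]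

theorem adj_one : adj S 1 = 1 := by simp [adj_apply, hS.inv_mul]

/-- The sign `(-1) ^ w` enters once through `S` and once through `S⁻¹`, and cancels. -/
theorem adj_adj (X : Matrix ι ι ℂ) : adj S (adj S X) = X := by
  simp only [adj_apply, Matrix.transpose_mul, Matrix.transpose_transpose,
    Matrix.transpose_nonsing_inv, hS.symm]
  have h1 : ((-1 : ℂ) ^ w • S)⁻¹ = (-1 : ℂ) ^ w • S⁻¹ := by
    refine Matrix.inv_eq_right_inv ?_
    rw [smul_mul_smul_comm, ← mul_pow, neg_mul_neg, one_mul, one_pow, hS.mul_inv, one_smul]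
  rw [h1]
  simp only [Matrix.smul_mul, Matrix.mul_smul, smul_smul, ← mul_pow, neg_mul_neg, one_mul, one_pow,
    one_smul]
  calc S⁻¹ * (S * (X * S⁻¹)) * S = (S⁻¹ * S) * X * (S⁻¹ * S) := by simp only [mul_assoc]
    _ = X := by rw [hS.inv_mul, one_mul, mul_one]

/-- The entry `(s,t)` of the adjoint involves only the `X c a` with `deg c = w - deg t` and `deg a =
w - deg s`: transposition and the reflection `i ↦ w - i` each reverse the degree. -/
theorem adj_mem_lowerSub (hX : X ∈ lowerSub deg d) : adj S X ∈ lowerSub deg d := by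
  intro s t hst
  rw [adj_apply, Matrix.mul_apply]
  refine Finset.sum_eq_zero fun c _ => ?_
  by_cases hc : deg c + deg t = w
  · rw [Matrix.mul_apply, Finset.sum_eq_zero, zero_mul]
    intro a _
    by_cases ha : deg s + deg a = w
    · rw [Matrix.transpose_apply, hX c a (by omega), mul_zero]
    · rw [hS.inv_apply_eq_zero s a ha, zero_mul]
  · rw [hS.apply_eq_zero c t hc, mul_zero]

theorem adj_gradedPart (X : Matrix ι ι ℂ) :
    adj S (gradedPart deg d X) = gradedPart deg d (adj S X) := by
  ext s t
  rw [gradedPart_apply, adj_apply, adj_apply, Matrix.mul_apply, Matrix.mul_apply]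
  split_ifs with h
  · refine Finset.sum_congr rfl fun c _ => ?_
    by_cases hc : deg c + deg t = w
    · congr 1
      rw [Matrix.mul_apply, Matrix.mul_apply]
      refine Finset.sum_congr rfl fun a _ => ?_
      by_cases ha : deg s + deg a = w
      · rw [Matrix.transpose_apply, gradedPart_apply, if_pos (by omega), Matrix.transpose_apply]
      · rw [hS.inv_apply_eq_zero s a ha, zero_mul, zero_mul]
    · rw [hS.apply_eq_zero c t hc, mul_zero, mul_zero]
  · refine Finset.sum_eq_zero fun c _ => ?_
    by_cases hc : deg c + deg t = w
    · rw [Matrix.mul_apply, Finset.sum_eq_zero, zero_mul]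
      intro a _
      by_cases ha : deg s + deg a = w
      · rw [Matrix.transpose_apply, gradedPart_apply, if_neg, mul_zero]
        have := hS.le c; have := hS.le t
        omega
      · rw [hS.inv_apply_eq_zero s a ha, zero_mul]
    · rw [hS.apply_eq_zero c t hc, mul_zero]

theorem adj_sub_one_mem (hY : Y - 1 ∈ lowerSub deg 1) : adj S Y - 1 ∈ lowerSub deg 1 := by
  have := hS.adj_mem_lowerSub hY
  rwa [map_sub, hS.adj_one] at this

theorem adj_mul_eq_one_iff : adj S Y * Y = 1 ↔ Yᵀ * S * Y = S := by
  rw [adj_apply]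
  constructor
  · intro h
    have : S * (S⁻¹ * Yᵀ * S * Y) = S := by rw [h, mul_one]
    rwa [← mul_assoc, ← mul_assoc, ← mul_assoc, hS.mul_inv, one_mul] at this
  · intro h
    rw [mul_assoc, mul_assoc, ← mul_assoc Yᵀ, h, hS.inv_mul]

theorem one_mem : (1 : Matrix ι ι ℂ) ∈ gradedGroup deg S :=
  ⟨by rw [sub_self]; exact zero_mem _, by rw [hS.adj_one, one_mul]⟩

theorem mul_mem (hX : X ∈ gradedGroup deg S) (hY : Y ∈ gradedGroup deg S) :
    X * Y ∈ gradedGroup deg S := by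
  refine ⟨mul_sub_one_mem hX.1 hY.1, ?_⟩
  rw [hS.adj_mul, mul_assoc, ← mul_assoc (adj S X), hX.2, one_mul, hY.2]

/-- On the group the adjoint is the inverse, so this is closure under inverses. -/
theorem adj_mem (hY : Y ∈ gradedGroup deg S) : adj S Y ∈ gradedGroup deg S :=
  ⟨hS.adj_sub_one_mem hY.1, by rw [hS.adj_adj, mul_eq_one_comm.1 hY.2]⟩

/-- One step of the Newton iteration for `adj Y * Y = 1`. -/
theorem exists_adj_mul_sub_one_mem_succ (hd : 3 ≤ d) (hY : Y - 1 ∈ lowerSub deg 1)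
    (hN : adj S Y * Y - 1 ∈ lowerSub deg d) :
    ∃ Z, Z - Y ∈ lowerSub deg d ∧ adj S Z * Z - 1 ∈ lowerSub deg (d + 1) := by
  set N := adj S Y * Y - 1 with hNdef
  have hNadj : adj S N = N := by rw [hNdef, map_sub, hS.adj_mul, hS.adj_adj, hS.adj_one]
  have hYY : adj S Y * Y = 1 + N := by rw [hNdef]; abel
  -- `N` is self-adjoint, so the factor `1 - N / 2` acts on both sides of `1 + N` and removes the
  -- linear term. The remaining error `-3/4 N² + 1/4 N³` has degree at least `2 d`.
  refine ⟨Y * (1 - (1 / 2 : ℂ) • N), ?_, ?_⟩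
  · have : Y * (1 - (1 / 2 : ℂ) • N) - Y = -((1 / 2 : ℂ) • (Y * N)) := by
      rw [mul_sub, mul_one, Matrix.mul_smul]; abel
    rw [this]
    refine neg_mem (Submodule.smul_mem _ _ ?_)
    simpa using mul_mem_lowerSub (mem_lowerSub_zero hY) hN
  · have h1 : adj S (Y * (1 - (1 / 2 : ℂ) • N)) = (1 - (1 / 2 : ℂ) • N) * adj S Y := by
      rw [hS.adj_mul, map_sub, map_smul, hNadj, hS.adj_one]
    have h2 : adj S (Y * (1 - (1 / 2 : ℂ) • N)) * (Y * (1 - (1 / 2 : ℂ) • N)) - 1 =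
        (-3 / 4 : ℂ) • (N * N) + (1 / 4 : ℂ) • (N * N * N) := by
      rw [h1, mul_assoc, ← mul_assoc (adj S Y), hYY]
      simp only [mul_sub, sub_mul, mul_add, add_mul, mul_one, one_mul, Matrix.mul_smul,
        Matrix.smul_mul, smul_smul, mul_assoc]
      module
    rw [h2]
    have hNN := mul_mem_lowerSub hN hN
    exact add_mem (Submodule.smul_mem _ _ (lowerSub_anti (by omega) hNN))
      (Submodule.smul_mem _ _ (lowerSub_anti (by omega) (mul_mem_lowerSub hNN hN)))

/-- A unipotent matrix which preserves the form up to degree `2` agrees up to degree `2` with an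
element of the group. -/
theorem exists_mem_gradedGroup (hY : Y - 1 ∈ lowerSub deg 1)
    (hN : adj S Y * Y - 1 ∈ lowerSub deg 3) :
    ∃ Z ∈ gradedGroup deg S, Z - Y ∈ lowerSub deg 3 := by
  have key : ∀ n, ∃ Z, Z - Y ∈ lowerSub deg 3 ∧ adj S Z * Z - 1 ∈ lowerSub deg (n + 3) := by
    intro n
    induction n with
    | zero => exact ⟨Y, by rw [sub_self]; exact zero_mem _, hN⟩
    | succ n ih =>
      obtain ⟨Z, hZY, hZ⟩ := ih
      have hZ1 : Z - 1 ∈ lowerSub deg 1 := by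
        simpa using add_mem (lowerSub_anti (by omega : 1 ≤ 3) hZY) hY
      obtain ⟨Z', h1, h2⟩ := hS.exists_adj_mul_sub_one_mem_succ (by omega) hZ1 hZ
      refine ⟨Z', ?_, by simpa [add_right_comm] using h2⟩
      simpa using add_mem (lowerSub_anti (by omega : 3 ≤ n + 3) h1) hZY
  -- After `w` steps the error has degree at least `w + 3` and is zero, since degrees do not exceed
  -- `w`.
  obtain ⟨Z, hZY, hZ⟩ := key w
  refine ⟨Z, ⟨?_, ?_⟩, hZY⟩
  · simpa using add_mem (lowerSub_anti (by omega : 1 ≤ 3) hZY) hY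
  · exact sub_eq_zero.1 (eq_zero_of_mem_lowerSub hS.le (lowerSub_anti (by omega) hZ))

/-- With `d = 3`, the relations that cut out `W` do not see the blocks discarded by `prW`. -/
theorem adj_mul_sub_mem (hX : X ∈ lowerSub deg 0) (hY : Y ∈ lowerSub deg 0)
    (hXY : X - Y ∈ lowerSub deg d) : adj S X * X - adj S Y * Y ∈ lowerSub deg d := by
  have h : adj S X * X - adj S Y * Y = adj S X * (X - Y) + adj S (X - Y) * Y := by
    rw [map_sub]; noncomm_ring
  rw [h]
  refine add_mem ?_ ?_
  · simpa using mul_mem_lowerSub (hS.adj_mem_lowerSub hX) hXY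
  · simpa using mul_mem_lowerSub (hS.adj_mem_lowerSub hXY) hY

end IsGradedForm

end Graded

/-! ### Calculus of matrix-valued functions -/

section MatrixCalculus

variable {ι : Type*} [Fintype ι] {E : Type*} [NormedAddCommGroup E] [NormedSpace ℂ E]
  {Y Z : E → Matrix ι ι ℂ} {z : E}

theorem differentiableAt_matrix :
    DifferentiableAt ℂ Y z ↔ ∀ s t, DifferentiableAt ℂ (fun x => Y x s t) z := by
  have h : DifferentiableAt ℂ Y z ↔ DifferentiableAt ℂ (fun x s t => Y x s t) z := Iff.rfl
  rw [h, differentiableAt_pi]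
  simp only [differentiableAt_pi]

theorem hasFDerivAt_matrix_apply (hY : DifferentiableAt ℂ Y z) (s t : ι) :
    HasFDerivAt (fun x => Y x s t)
      ((ContinuousLinearMap.proj (R := ℂ) (φ := fun _ : ι => ℂ) t).comp
        ((ContinuousLinearMap.proj (R := ℂ) (φ := fun _ : ι => ι → ℂ) s).comp (fderiv ℂ Y z))) z := by
  have h : HasFDerivAt (fun x (s t : ι) => Y x s t) (fderiv ℂ Y z) z := hY.hasFDerivAt
  exact hasFDerivAt_pi'.1 (hasFDerivAt_pi'.1 h s) t

theorem fderiv_matrix_apply (hY : DifferentiableAt ℂ Y z) (v : E) (s t : ι) :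
    fderiv ℂ (fun x => Y x s t) z v = fderiv ℂ Y z v s t := by
  rw [(hasFDerivAt_matrix_apply hY s t).fderiv]
  rfl

theorem differentiableAt_matrix_mul (hY : DifferentiableAt ℂ Y z) (hZ : DifferentiableAt ℂ Z z) :
    DifferentiableAt ℂ (fun x => Y x * Z x) z := by
  rw [differentiableAt_matrix] at *
  intro s t
  simp only [Matrix.mul_apply]
  exact DifferentiableAt.fun_sum fun r _ => (hY s r).mul (hZ r t)

theorem fderiv_matrix_mul (hY : DifferentiableAt ℂ Y z) (hZ : DifferentiableAt ℂ Z z) (v : E) :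
    fderiv ℂ (fun x => Y x * Z x) z v = Y z * fderiv ℂ Z z v + fderiv ℂ Y z v * Z z := by
  ext s t
  rw [← fderiv_matrix_apply (differentiableAt_matrix_mul hY hZ)]
  have h1 := fun s t => hasFDerivAt_matrix_apply hY s t
  have h2 := fun s t => hasFDerivAt_matrix_apply hZ s t
  have h3 : HasFDerivAt (fun x => (Y x * Z x) s t) _ z :=
    HasFDerivAt.fun_sum fun r (_ : r ∈ Finset.univ) => (h1 s r).mul (h2 r t)
  rw [h3.fderiv, Matrix.add_apply, Matrix.mul_apply, Matrix.mul_apply, ← Finset.sum_add_distrib]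
  simp only [FunLike.coe_sum, Finset.sum_apply]
  refine Finset.sum_congr rfl fun r _ => ?_
  simp only [_root_.add_apply, _root_.smul_apply, smul_eq_mul,
    mul_comm _ (Z z r t)]
  rfl

theorem hasFDerivAt_linearMap_comp {F : Type*} [NormedAddCommGroup F] [NormedSpace ℂ F]
    (L : Matrix ι ι ℂ →ₗ[ℂ] F) (hY : DifferentiableAt ℂ Y z) :
    HasFDerivAt (fun x => L (Y x)) ((LinearMap.toContinuousLinearMap L).comp (fderiv ℂ Y z)) z :=
  let L' : (ι → ι → ℂ) →L[ℂ] F := LinearMap.toContinuousLinearMap L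
  (L'.hasFDerivAt (x := Y z)).comp z hY.hasFDerivAt

theorem fderiv_linearMap_comp {F : Type*} [NormedAddCommGroup F] [NormedSpace ℂ F]
    (L : Matrix ι ι ℂ →ₗ[ℂ] F) (hY : DifferentiableAt ℂ Y z) (v : E) :
    fderiv ℂ (fun x => L (Y x)) z v = L (fderiv ℂ Y z v) := by
  rw [(hasFDerivAt_linearMap_comp L hY).fderiv]
  rfl

theorem differentiableAt_linearMap_comp {κ : Type*} [Fintype κ]
    (L : Matrix ι ι ℂ →ₗ[ℂ] Matrix κ κ ℂ) (hY : DifferentiableAt ℂ Y z) :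
    DifferentiableAt ℂ (fun x => L (Y x)) z :=
  (hasFDerivAt_linearMap_comp (F := κ → κ → ℂ) L hY).differentiableAt

theorem fderiv_linearMap_comp_matrix {κ : Type*} [Fintype κ]
    (L : Matrix ι ι ℂ →ₗ[ℂ] Matrix κ κ ℂ) (hY : DifferentiableAt ℂ Y z) (v : E) :
    fderiv ℂ (fun x => L (Y x)) z v = L (fderiv ℂ Y z v) :=
  fderiv_linearMap_comp (F := κ → κ → ℂ) L hY v

theorem differentiableAt_matrix_sub (hY : DifferentiableAt ℂ Y z) (hZ : DifferentiableAt ℂ Z z) :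
    DifferentiableAt ℂ (fun x => Y x - Z x) z :=
  DifferentiableAt.sub (F := ι → ι → ℂ) hY hZ

theorem fderiv_matrix_sub (hY : DifferentiableAt ℂ Y z) (hZ : DifferentiableAt ℂ Z z) (v : E) :
    fderiv ℂ (fun x => Y x - Z x) z v = fderiv ℂ Y z v - fderiv ℂ Z z v := by
  have h := HasFDerivAt.fun_sub (F := ι → ι → ℂ) hY.hasFDerivAt hZ.hasFDerivAt
  have h2 : fderiv ℂ (fun x => Y x - Z x) z = _ := h.fderiv
  rw [h2]
  rfl

theorem fderiv_matrix_sub_const (M : Matrix ι ι ℂ) (v : E) :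
    fderiv ℂ (fun x => Y x - M) z v = fderiv ℂ Y z v := by
  have h2 : fderiv ℂ (fun x => Y x - M) z = fderiv ℂ Y z :=
    fderiv_sub_const (F := ι → ι → ℂ) (f := Y) M
  rw [h2]

theorem differentiableAt_matrix_sub_const (M : Matrix ι ι ℂ) (hY : DifferentiableAt ℂ Y z) :
    DifferentiableAt ℂ (fun x => Y x - M) z :=
  DifferentiableAt.sub_const (F := ι → ι → ℂ) hY M

variable {deg : ι → ℕ} {d : ℕ}

theorem fderiv_mem_lowerSub (hY : DifferentiableAt ℂ Y z) (h : ∀ᶠ x in 𝓝 z, Y x ∈ lowerSub deg d)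
    (v : E) : fderiv ℂ Y z v ∈ lowerSub deg d := by
  intro s t hst
  rw [← fderiv_matrix_apply hY]
  have : (fun x => Y x s t) =ᶠ[𝓝 z] fun _ => 0 := by
    filter_upwards [h] with x hx using hx s t hst
  rw [this.fderiv_eq]
  simp

/-- A matrix-valued function vanishes if its initial value does and if its derivative is of higher
degree than the function itself. -/
theorem eq_zero_of_fderiv_mem_succ {w : ℕ} (hdeg : ∀ s, deg s ≤ w) {r : ℝ} {M : E → Matrix ι ι ℂ}
    (hM : ∀ x ∈ Metric.ball (0 : E) r, DifferentiableAt ℂ M x) (hM0 : M 0 = 0)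
    (hlow : ∀ x ∈ Metric.ball (0 : E) r, M x ∈ lowerSub deg 0)
    (hstep : ∀ n, (∀ x ∈ Metric.ball (0 : E) r, M x ∈ lowerSub deg n) →
      ∀ x ∈ Metric.ball (0 : E) r, ∀ v, fderiv ℂ M x v ∈ lowerSub deg (n + 1)) :
    ∀ x ∈ Metric.ball (0 : E) r, M x = 0 := by
  have key : ∀ n, ∀ x ∈ Metric.ball (0 : E) r, M x ∈ lowerSub deg n := by
    intro n
    induction n with
    | zero => exact hlow
    | succ n ih =>
      intro x hx s t hst
      have h0 : (0 : E) ∈ Metric.ball (0 : E) r :=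
        Metric.mem_ball_self (dist_nonneg.trans_lt (Metric.mem_ball.1 hx))
      -- If `M` has degree at least `n` on the ball, its derivative starts in degree `n + 1`. The
      -- entries of degree `n` are then constant on the connected ball, and they vanish at `0`.
      have hconst := Metric.isOpen_ball.is_const_of_fderiv_eq_zero (𝕜 := ℂ)
        (f := fun x => M x s t) (convex_ball (0 : E) r).isPreconnected
        (fun y hy => (differentiableAt_matrix.1 (hM y hy) s t).differentiableWithinAt)
        (fun y hy => by
          ext v
          rw [fderiv_matrix_apply (hM y hy)]
          exact hstep n ih y hy v s t hst) hx h0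
      rw [hconst, hM0]
      rfl
  exact fun x hx => eq_zero_of_mem_lowerSub hdeg (key _ x hx)

end MatrixCalculus

/-! ### Lifting solutions of the contact system -/

/-- A closed holomorphic 1-form on a convex open set has a primitive. -/
theorem exists_primitive {E : Type*} [NormedAddCommGroup E] [NormedSpace ℂ E] {s : Set E}
    (hs : Convex ℝ s) (hso : IsOpen s) {ω : E → E →L[ℂ] ℂ} (hω : DifferentiableOn ℂ ω s)
    (hsymm : ∀ a ∈ s, ∀ u v, fderiv ℂ ω a u v = fderiv ℂ ω a v u) :
    ∃ f : E → ℂ, ∀ a ∈ s, HasFDerivAt f (ω a) a := by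
  obtain ⟨f, hf⟩ := hs.exists_forall_hasFDerivWithinAt_of_hasFDerivWithinAt_symmetric (𝕜 := ℂ)
    (ω := ω) (dω := fun a => (fderiv ℂ ω a).restrictScalars ℝ)
    (fun a ha => ((hω.differentiableAt (hso.mem_nhds ha)).hasFDerivAt.restrictScalars
      ℝ).hasFDerivWithinAt)
    (fun a ha u _ v _ => hsymm a ha u v)
  exact ⟨f, fun a ha => (hf a ha).hasFDerivAt (hso.mem_nhds ha)⟩

section ContactDeriv

variable {ι : Type*} [Fintype ι] {deg : ι → ℕ} {E : Type*} [NormedAddCommGroup E] [NormedSpace ℂ E]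

/-- The lift is determined by the degree one part of its derivative and its value at `0`. -/
theorem eventuallyEq_of_fderiv_eq {Y Z : E → Matrix ι ι ℂ} {w : ℕ}
    (hdeg : ∀ s, deg s ≤ w)
    (h0 : Y 0 = Z 0)
    (hY : ∀ᶠ z in 𝓝 (0 : E), DifferentiableAt ℂ Y z ∧ DifferentiableAt ℂ Z z ∧
      Y z ∈ lowerSub deg 0 ∧ Z z ∈ lowerSub deg 0 ∧ ∀ v, ∃ ω ∈ lowerSub deg 1,
        fderiv ℂ Y z v = Y z * ω ∧ fderiv ℂ Z z v = Z z * ω) :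
    Y =ᶠ[𝓝 0] Z := by
  obtain ⟨r, hr, hball⟩ := Metric.eventually_nhds_iff_ball.1 hY
  refine Filter.eventually_of_mem (Metric.ball_mem_nhds 0 hr) fun z hz => sub_eq_zero.1 ?_
  -- The difference satisfies `dM = M ω` with `ω` of positive degree, so differentiation raises its
  -- lowest degree.
  refine eq_zero_of_fderiv_mem_succ (M := fun z => Y z - Z z) hdeg ?_ (sub_eq_zero.2 h0) ?_ ?_ z hz
  · exact fun z hz => differentiableAt_matrix_sub (hball z hz).1 (hball z hz).2.1
  · exact fun z hz => sub_mem (hball z hz).2.2.1 (hball z hz).2.2.2.1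
  · intro n hn z hz v
    obtain ⟨ω, hω, h1, h2⟩ := (hball z hz).2.2.2.2 v
    rw [fderiv_matrix_sub (hball z hz).1 (hball z hz).2.1, h1, h2, ← sub_mul]
    exact mul_mem_lowerSub (hn z hz) hω

/-- The derivative of degree one of a solution of the contact system, as a matrix of 1-forms. -/
def contactDeriv (deg : ι → ℕ) (T : E → Matrix ι ι ℂ) (s t : ι) (z : E) : E →L[ℂ] ℂ :=
  if deg s = deg t + 1 then fderiv ℂ (fun x => T x s t) z else 0

variable {T : E → Matrix ι ι ℂ} {U : Set E}

theorem contactDeriv_apply {z : E} (hT : DifferentiableAt ℂ T z) (s t : ι) (v : E) :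
    contactDeriv deg T s t z v = gradedPart deg 1 (fderiv ℂ T z v) s t := by
  rw [gradedPart_apply, contactDeriv]
  split_ifs
  · exact fderiv_matrix_apply hT v s t
  · rfl

variable [FiniteDimensional ℂ E]

theorem differentiableAt_contactDeriv (hU : IsOpen U)
    (hT : ∀ z ∈ U, DifferentiableAt ℂ T z) (s t : ι) {z : E} (hz : z ∈ U) :
    DifferentiableAt ℂ (contactDeriv deg T s t) z := by
  unfold contactDeriv
  split_ifs
  · have hd : DifferentiableOn ℂ (fun x => T x s t) U :=
      fun y hy => (differentiableAt_matrix.1 (hT y hy) s t).differentiableWithinAt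
    exact (differentiableOn_fderiv hU hd).differentiableAt (hU.mem_nhds hz)
  · exact differentiableAt_const _

theorem fderiv_fderiv_symm {f : E → ℂ} (hU : IsOpen U) (hf : ∀ z ∈ U, DifferentiableAt ℂ f z)
    {z : E} (hz : z ∈ U) (u v : E) :
    fderiv ℂ (fderiv ℂ f) z u v = fderiv ℂ (fderiv ℂ f) z v u := by
  have hd : DifferentiableOn ℂ f U := fun y hy => (hf y hy).differentiableWithinAt
  refine second_derivative_symmetric_of_eventually (𝕜 := ℂ) (f := f) ?_
    ((differentiableOn_fderiv hU hd).differentiableAt (hU.mem_nhds hz)).hasFDerivAt u v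
  filter_upwards [hU.mem_nhds hz] with y hy using (hf y hy).hasFDerivAt

theorem fderiv_contactDeriv_symm (hU : IsOpen U)
    (hT : ∀ z ∈ U, DifferentiableAt ℂ T z) (s t : ι) {z : E} (hz : z ∈ U) (u v : E) :
    fderiv ℂ (contactDeriv deg T s t) z u v = fderiv ℂ (contactDeriv deg T s t) z v u := by
  unfold contactDeriv
  split_ifs
  · exact fderiv_fderiv_symm hU (fun y hy => differentiableAt_matrix.1 (hT y hy) s t) hz u v
  · simp

/-- Leibniz rule for `Y ω`. The term with `dω` is symmetric in its two arguments, so the term with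
`dY` alone decides whether `Y ω` is closed. -/
theorem fderiv_sum_smul_contactDeriv (hU : IsOpen U) (hT : ∀ z ∈ U, DifferentiableAt ℂ T z)
    {Y : E → Matrix ι ι ℂ} {z : E} (hz : z ∈ U) (hY : DifferentiableAt ℂ Y z) (s t : ι) :
    HasFDerivAt (fun x => ∑ r, Y x s r • contactDeriv deg T r t x)
      (∑ r, (Y z s r • fderiv ℂ (contactDeriv deg T r t) z +
        (fderiv ℂ (fun x => Y x s r) z).smulRight (contactDeriv deg T r t z))) z := by
  refine HasFDerivAt.fun_sum fun r _ => ?_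
  exact (differentiableAt_matrix.1 hY s r).hasFDerivAt.smul
    (differentiableAt_contactDeriv hU hT r t hz).hasFDerivAt

/-- The matrix of 1-forms `Y ω`, `ω` being the degree one part of `dT`, is closed in the degrees
where `dY = Y ω` holds in the preceding degree. -/
theorem fderiv_sum_smul_contactDeriv_symm (hU : IsOpen U) (hT : ∀ z ∈ U, DifferentiableAt ℂ T z)
    (hcomm : ∀ z ∈ U, ∀ u v, gradedPart deg 1 (fderiv ℂ T z u) * gradedPart deg 1 (fderiv ℂ T z v) =
      gradedPart deg 1 (fderiv ℂ T z v) * gradedPart deg 1 (fderiv ℂ T z u))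
    {Y : E → Matrix ι ι ℂ} {z : E} (hz : z ∈ U) (hY : DifferentiableAt ℂ Y z) {s t : ι}
    (hYT : ∀ v r, deg r = deg t + 1 →
      fderiv ℂ Y z v s r = (Y z * gradedPart deg 1 (fderiv ℂ T z v)) s r) (u v : E) :
    fderiv ℂ (fun x => ∑ r, Y x s r • contactDeriv deg T r t x) z u v =
      fderiv ℂ (fun x => ∑ r, Y x s r • contactDeriv deg T r t x) z v u := by
  rw [(fderiv_sum_smul_contactDeriv hU hT hz hY s t).fderiv]
  -- Only indices `r` one degree above `t` contribute, which is where `dY = Y ω` is assumed. The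
  -- term becomes `Y ω(u) ω(v)`, symmetric because the values of `ω` commute.
  have key : ∀ u v : E, (∑ r, fderiv ℂ (fun x => Y x s r) z u * contactDeriv deg T r t z v) =
      (Y z * (gradedPart deg 1 (fderiv ℂ T z u) * gradedPart deg 1 (fderiv ℂ T z v))) s t := by
    intro u v
    rw [← mul_assoc, Matrix.mul_apply]
    refine Finset.sum_congr rfl fun r _ => ?_
    rw [contactDeriv_apply (hT z hz)]
    by_cases hr : deg r = deg t + 1
    · rw [fderiv_matrix_apply hY, hYT u r hr]
    · rw [gradedPart_apply, if_neg hr, mul_zero, mul_zero]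
  have h2 : ∀ u v : E, (∑ r, (Y z s r • fderiv ℂ (contactDeriv deg T r t) z +
        (fderiv ℂ (fun x => Y x s r) z).smulRight (contactDeriv deg T r t z))) u v =
      ∑ r, Y z s r * fderiv ℂ (contactDeriv deg T r t) z u v +
        ∑ r, fderiv ℂ (fun x => Y x s r) z u * contactDeriv deg T r t z v := by
    intro u v
    simp [Finset.sum_add_distrib]
  rw [h2, h2, key, key, hcomm z hz]
  congr 1
  exact Finset.sum_congr rfl fun r _ => by rw [fderiv_contactDeriv_symm hU hT r t hz]

/-- The values of the degree one part of the derivative of a solution of the contact system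
commute. -/
theorem gradedPart_fderiv_comm (hU : IsOpen U) (hT : ∀ z ∈ U, DifferentiableAt ℂ T z)
    (hcontact : ∀ z ∈ U, ∀ v, gradedPart deg 2 (fderiv ℂ T z v) =
      gradedPart deg 2 (T z * gradedPart deg 1 (fderiv ℂ T z v))) {z : E} (hz : z ∈ U) (u v : E) :
    gradedPart deg 1 (fderiv ℂ T z u) * gradedPart deg 1 (fderiv ℂ T z v) =
      gradedPart deg 1 (fderiv ℂ T z v) * gradedPart deg 1 (fderiv ℂ T z u) := by
  rw [← gradedPart_mul_gradedPart, ← gradedPart_mul_gradedPart (X := fderiv ℂ T z v)]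
  ext s t
  rw [gradedPart_apply, gradedPart_apply]
  split_ifs with hst
  swap
  · rfl
  have heq : fderiv ℂ (fun x => T x s t) =ᶠ[𝓝 z]
      fun x => ∑ r, T x s r • contactDeriv deg T r t x := by
    filter_upwards [hU.mem_nhds hz] with x hx
    ext v
    have h := congrFun (congrFun (hcontact x hx v) s) t
    rw [gradedPart_apply, gradedPart_apply, if_pos hst, if_pos hst, Matrix.mul_apply] at h
    rw [fderiv_matrix_apply (hT x hx), h]
    simp [contactDeriv_apply (hT x hx)]
  have hfd : fderiv ℂ (fderiv ℂ (fun x => T x s t)) z =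
      fderiv ℂ (fun x => ∑ r, T x s r • contactDeriv deg T r t x) z := heq.fderiv_eq
  -- Differentiating the contact equation for an entry of degree two expresses its second derivative
  -- as a symmetric term plus `ω(u) ω(v)`. The symmetry of second derivatives then forces the
  -- commutation.
  have key : ∀ u v : E, fderiv ℂ (fderiv ℂ (fun x => T x s t)) z u v =
      ∑ r, T z s r * fderiv ℂ (contactDeriv deg T r t) z u v +
        (gradedPart deg 1 (fderiv ℂ T z u) * gradedPart deg 1 (fderiv ℂ T z v)) s t := by
    intro u v
    rw [hfd, (fderiv_sum_smul_contactDeriv hU hT hz (hT z hz) s t).fderiv, Matrix.mul_apply,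
      ← Finset.sum_add_distrib]
    simp only [FunLike.coe_sum, Finset.sum_apply]
    refine Finset.sum_congr rfl fun r _ => ?_
    simp only [_root_.add_apply, _root_.smul_apply, smul_eq_mul,
      ContinuousLinearMap.smulRight_apply]
    congr 1
    rw [contactDeriv_apply (hT z hz)]
    by_cases hr : deg r = deg t + 1
    · rw [fderiv_matrix_apply (hT z hz), gradedPart_apply (s := s), if_pos (by omega)]
    · rw [gradedPart_apply (s := r), if_neg hr, mul_zero, mul_zero]
  have hsymm := fderiv_fderiv_symm (f := fun x => T x s t) hU
    (fun y hy => differentiableAt_matrix.1 (hT y hy) s t) hz u v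
  rw [key u v, key v u] at hsymm
  have h3 : ∑ r, T z s r * fderiv ℂ (contactDeriv deg T r t) z u v =
      ∑ r, T z s r * fderiv ℂ (contactDeriv deg T r t) z v u :=
    Finset.sum_congr rfl fun r _ => by rw [fderiv_contactDeriv_symm hU hT r t hz]
  rw [h3] at hsymm
  exact add_left_cancel hsymm

/-- Solving `dY = Y ω` one degree further. -/
theorem exists_lift_succ {d : ℕ} (hd : 3 ≤ d) (Y₀ : Matrix ι ι ℂ) {r : ℝ}
    (hT : ∀ z ∈ Metric.ball (0 : E) r, DifferentiableAt ℂ T z)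
    (hcomm : ∀ z ∈ Metric.ball (0 : E) r, ∀ u v,
      gradedPart deg 1 (fderiv ℂ T z u) * gradedPart deg 1 (fderiv ℂ T z v) =
      gradedPart deg 1 (fderiv ℂ T z v) * gradedPart deg 1 (fderiv ℂ T z u))
    {Y : E → Matrix ι ι ℂ} (hY0 : Y 0 = Y₀)
    (hY : ∀ z ∈ Metric.ball (0 : E) r, DifferentiableAt ℂ Y z)
    (hYd : ∀ z ∈ Metric.ball (0 : E) r, ∀ v,
      fderiv ℂ Y z v - Y z * gradedPart deg 1 (fderiv ℂ T z v) ∈ lowerSub deg d) :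
    ∃ Z : E → Matrix ι ι ℂ, Z 0 = Y₀ ∧ (∀ z ∈ Metric.ball (0 : E) r, DifferentiableAt ℂ Z z ∧
      Z z - Y z ∈ lowerSub deg 3 ∧ ∀ v,
      fderiv ℂ Z z v - Z z * gradedPart deg 1 (fderiv ℂ T z v) ∈ lowerSub deg (d + 1)) := by
  have hYd' : ∀ z ∈ Metric.ball (0 : E) r, ∀ v s t, deg s < deg t + d →
      fderiv ℂ Y z v s t = (Y z * gradedPart deg 1 (fderiv ℂ T z v)) s t :=
    fun z hz v s t hst => sub_eq_zero.1 (hYd z hz v s t hst)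
  have hprim : ∀ s t, ∃ f : E → ℂ, deg s = deg t + d → ∀ z ∈ Metric.ball (0 : E) r,
      HasFDerivAt f (∑ q, Y z s q • contactDeriv deg T q t z) z := by
    intro s t
    by_cases hst : deg s = deg t + d
    · obtain ⟨f, hf⟩ := exists_primitive (convex_ball (0 : E) r) Metric.isOpen_ball
        (ω := fun x => ∑ q, Y x s q • contactDeriv deg T q t x)
        (fun z hz => (fderiv_sum_smul_contactDeriv Metric.isOpen_ball hT hz (hY z hz) s
          t).differentiableAt.differentiableWithinAt)
        (fun z hz => fderiv_sum_smul_contactDeriv_symm Metric.isOpen_ball hT hcomm hz (hY z hz)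
          fun v q hq => hYd' z hz v s q (by omega))
      exact ⟨f, fun _ => hf⟩
    · exact ⟨fun _ => 0, fun h => absurd h hst⟩
  choose f hf using hprim
  -- Only the blocks of degree `d` change: they become primitives of `Y ω`, normalized to take the
  -- value `Y₀` at `0`.
  let Z : E → Matrix ι ι ℂ := fun z => Matrix.of fun s t =>
    if deg s = deg t + d then f s t z - f s t 0 + Y₀ s t else Y z s t
  have hZapp : ∀ z s t, Z z s t =
    if deg s = deg t + d then f s t z - f s t 0 + Y₀ s t else Y z s t := fun z s t => rfl
  have hZfun : ∀ s t, deg s = deg t + d →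
      (fun z => Z z s t) = fun z => f s t z - f s t 0 + Y₀ s t := by
    intro s t hst; funext z; rw [hZapp, if_pos hst]
  have hZfun' : ∀ s t, ¬ deg s = deg t + d → (fun z => Z z s t) = fun z => Y z s t := by
    intro s t hst; funext z; rw [hZapp, if_neg hst]
  have hZd : ∀ s t, deg s = deg t + d → ∀ z ∈ Metric.ball (0 : E) r,
      HasFDerivAt (fun z => Z z s t) (∑ q, Y z s q • contactDeriv deg T q t z) z := by
    intro s t hst z hz
    rw [hZfun s t hst]
    exact ((hf s t hst z hz).sub_const _).add_const _
  have hZdiff : ∀ z ∈ Metric.ball (0 : E) r, DifferentiableAt ℂ Z z := by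
    intro z hz
    rw [differentiableAt_matrix]
    intro s t
    by_cases hst : deg s = deg t + d
    · exact (hZd s t hst z hz).differentiableAt
    · rw [hZfun' s t hst]
      exact differentiableAt_matrix.1 (hY z hz) s t
  -- Multiplication by `ω` raises the degree by one, so through degree `d` the product still sees
  -- only unchanged blocks.
  have hmul : ∀ z v s t, deg s < deg t + d + 1 →
      (Z z * gradedPart deg 1 (fderiv ℂ T z v)) s t =
        (Y z * gradedPart deg 1 (fderiv ℂ T z v)) s t := by
    intro z v s t hst
    rw [Matrix.mul_apply, Matrix.mul_apply]
    refine Finset.sum_congr rfl fun q _ => ?_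
    by_cases hq : deg q = deg t + 1
    · rw [hZapp, if_neg (by omega)]
    · rw [gradedPart_apply, if_neg hq, mul_zero, mul_zero]
  refine ⟨Z, ?_, fun z hz => ⟨hZdiff z hz, ?_, ?_⟩⟩
  · ext s t
    rw [hZapp, hY0]
    split_ifs <;> simp
  · intro s t hst
    rw [Matrix.sub_apply, hZapp, if_neg (by omega), sub_self]
  · intro v s t hst
    rw [Matrix.sub_apply, hmul z v s t (by omega), ← fderiv_matrix_apply (hZdiff z hz)]
    by_cases hst' : deg s = deg t + d
    · rw [(hZd s t hst' z hz).fderiv, Matrix.mul_apply]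
      simp [contactDeriv_apply (hT z hz)]
    · rw [hZfun' s t hst', fderiv_matrix_apply (hY z hz), hYd' z hz v s t (by omega), sub_self]

end ContactDeriv

/-! ### Lifts of contact solutions that preserve the form -/

section Lift

variable {ι : Type*} [Fintype ι] [DecidableEq ι] {deg : ι → ℕ} {w : ℕ} {S : Matrix ι ι ℂ}
  {E : Type*} [NormedAddCommGroup E] [NormedSpace ℂ E] {T : E → Matrix ι ι ℂ}

/-- Since `V` and `adj S V` are unipotent, the degree one part of the linearized relation is `A₁ +
adj S A₁ = 0`. Only relations of degree at most two enter, so this serves both `G⁻` and `W`. -/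
theorem adj_gradedPart_of_adj_mul_mem (hS : IsGradedForm deg w S) {V A : Matrix ι ι ℂ}
    (hV : V - 1 ∈ lowerSub deg 1) (hA : A ∈ lowerSub deg 1)
    (h : adj S V * A + adj S A * V ∈ lowerSub deg 3) :
    adj S (gradedPart deg 1 A) = -gradedPart deg 1 A := by
  have h1 := gradedPart_eq_zero h (by omega : 1 < 3)
  have h2 : adj S A * V = adj S A + adj S A * (V - 1) := by noncomm_ring
  have hA' := hS.adj_mem_lowerSub hA
  rw [map_add, gradedPart_mul_left (hS.adj_sub_one_mem hV) hA, h2, map_add,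
    gradedPart_eq_zero (mul_mem_lowerSub hA' hV) (by omega), add_zero] at h1
  rw [hS.adj_gradedPart]
  exact eq_neg_of_add_eq_zero_right h1

theorem fderiv_adj_mul_self {Y : E → Matrix ι ι ℂ} {z : E} (hY : DifferentiableAt ℂ Y z) (v : E) :
    fderiv ℂ (fun x => adj S (Y x) * Y x - 1) z v =
      adj S (Y z) * fderiv ℂ Y z v + adj S (fderiv ℂ Y z v) * Y z := by
  rw [fderiv_matrix_sub_const, fderiv_matrix_mul (differentiableAt_linearMap_comp _ hY) hY,
    fderiv_linearMap_comp_matrix _ hY]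

theorem fderiv_mem_lowerSub_one {Y : E → Matrix ι ι ℂ} {z : E} (hY : DifferentiableAt ℂ Y z)
    (h : ∀ᶠ x in 𝓝 z, Y x - 1 ∈ lowerSub deg 1) (v : E) : fderiv ℂ Y z v ∈ lowerSub deg 1 := by
  rw [← fderiv_matrix_sub_const 1]
  exact fderiv_mem_lowerSub (differentiableAt_matrix_sub_const 1 hY) h v

theorem adj_gradedPart_fderiv (hS : IsGradedForm deg w S) {z : E}
    (hT : DifferentiableAt ℂ T z)
    (h : ∀ᶠ x in 𝓝 z, T x - 1 ∈ lowerSub deg 1 ∧ adj S (T x) * T x - 1 ∈ lowerSub deg 3) (v : E) :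
    adj S (gradedPart deg 1 (fderiv ℂ T z v)) = -gradedPart deg 1 (fderiv ℂ T z v) := by
  refine adj_gradedPart_of_adj_mul_mem hS h.self_of_nhds.1
    (fderiv_mem_lowerSub_one hT (h.mono fun x hx => hx.1) v) ?_
  rw [← fderiv_adj_mul_self hT]
  refine fderiv_mem_lowerSub ?_ (h.mono fun x hx => hx.2) v
  exact differentiableAt_matrix_sub_const 1
    (differentiableAt_matrix_mul (differentiableAt_linearMap_comp _ hT) hT)

/-- Every solution of the contact system lifts to the group. -/
theorem exists_lift [FiniteDimensional ℂ E] (hS : IsGradedForm deg w S) {Y₀ : Matrix ι ι ℂ} (hY₀ : Y₀ ∈ gradedGroup deg S)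
    (hT0 : T 0 - Y₀ ∈ lowerSub deg 3)
    (hT : ∀ᶠ z in 𝓝 (0 : E), DifferentiableAt ℂ T z ∧ T z - 1 ∈ lowerSub deg 1 ∧
      adj S (T z) * T z - 1 ∈ lowerSub deg 3 ∧ ∀ v, gradedPart deg 2 (fderiv ℂ T z v) =
        gradedPart deg 2 (T z * gradedPart deg 1 (fderiv ℂ T z v))) :
    ∃ Y : E → Matrix ι ι ℂ, Y 0 = Y₀ ∧ ∀ᶠ z in 𝓝 (0 : E), DifferentiableAt ℂ Y z ∧
      Y z ∈ gradedGroup deg S ∧ Y z - T z ∈ lowerSub deg 3 ∧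
      ∀ v, fderiv ℂ Y z v = Y z * gradedPart deg 1 (fderiv ℂ T z v) := by
  obtain ⟨r, hr, hball⟩ := Metric.eventually_nhds_iff_ball.1 hT
  have hTd := fun z hz => (hball z hz).1
  have hT1 := fun z hz => (hball z hz).2.1
  have hTS := fun z hz => (hball z hz).2.2.1
  have hTc := fun z hz => (hball z hz).2.2.2
  have hcomm := fun z hz u v => gradedPart_fderiv_comm (deg := deg) Metric.isOpen_ball hTd hTc
    (z := z) hz u v
  have hdT := fun z (hz : z ∈ Metric.ball (0 : E) r) v => fderiv_mem_lowerSub_one (hTd z hz)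
    (Filter.eventually_of_mem (Metric.isOpen_ball.mem_nhds hz) hT1) v
  have key : ∀ n, ∃ Y : E → Matrix ι ι ℂ, Y 0 = Y₀ ∧ ∀ z ∈ Metric.ball (0 : E) r,
      DifferentiableAt ℂ Y z ∧ Y z - T z ∈ lowerSub deg 3 ∧ ∀ v,
      fderiv ℂ Y z v - Y z * gradedPart deg 1 (fderiv ℂ T z v) ∈ lowerSub deg (n + 3) := by
    intro n
    induction n with
    | zero =>
      -- The constant correction has degree at least three and gives the value `Y₀` at `0`. The
      -- equation `dY = Y ω` then holds below degree three: trivially in degree one, by the contact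
      -- system in degree two.
      refine ⟨fun z => T z - (T 0 - Y₀), sub_sub_cancel _ _, fun z hz =>
        ⟨differentiableAt_matrix_sub_const _ (hTd z hz), ?_, fun v => ?_⟩⟩
      · rw [sub_sub_cancel_left]
        exact neg_mem hT0
      · have h0 : fderiv ℂ T z v - (T z - (T 0 - Y₀)) * gradedPart deg 1 (fderiv ℂ T z v) =
            (T 0 - Y₀) * gradedPart deg 1 (fderiv ℂ T z v) +
              (fderiv ℂ T z v - T z * gradedPart deg 1 (fderiv ℂ T z v)) := by noncomm_ring
        rw [fderiv_matrix_sub_const, h0]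
        have h1 : fderiv ℂ T z v - T z * gradedPart deg 1 (fderiv ℂ T z v) ∈ lowerSub deg 1 := by
          refine sub_mem (hdT z hz v) ?_
          simpa using mul_mem_lowerSub (mem_lowerSub_zero (hT1 z hz))
            (gradedPart_mem (d := 1) (fderiv ℂ T z v))
        refine add_mem ?_ ?_
        · exact lowerSub_anti (by omega : 3 ≤ 3 + 1) (mul_mem_lowerSub hT0 (gradedPart_mem _))
        · refine mem_lowerSub_succ (mem_lowerSub_succ h1 ?_) ?_
          · rw [map_sub, gradedPart_mul_left (hT1 z hz) (gradedPart_mem _), gradedPart_gradedPart,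
              sub_self]
          · rw [map_sub, hTc z hz, sub_self]
    | succ n ih =>
      obtain ⟨Y, hY0, hY⟩ := ih
      obtain ⟨Z, hZ0, hZ⟩ := exists_lift_succ (by omega) Y₀ hTd hcomm hY0
        (fun z hz => (hY z hz).1) (fun z hz => (hY z hz).2.2)
      refine ⟨Z, hZ0, fun z hz => ⟨(hZ z hz).1, ?_, fun v => ?_⟩⟩
      · simpa using add_mem (hZ z hz).2.1 (hY z hz).2.1
      · simpa [add_right_comm] using (hZ z hz).2.2 v
  obtain ⟨Y, hY0, hY⟩ := key w
  have hYd : ∀ z ∈ Metric.ball (0 : E) r, ∀ v,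
      fderiv ℂ Y z v = Y z * gradedPart deg 1 (fderiv ℂ T z v) := fun z hz v =>
    sub_eq_zero.1 (eq_zero_of_mem_lowerSub hS.le (lowerSub_anti (by omega) ((hY z hz).2.2 v)))
  have hY1 : ∀ z ∈ Metric.ball (0 : E) r, Y z - 1 ∈ lowerSub deg 1 := fun z hz => by
    simpa using add_mem (lowerSub_anti (by omega : 1 ≤ 3) (hY z hz).2.1) (hT1 z hz)
  -- From `dY = Y ω` and `adj S ω = -ω`, the defect `N` satisfies `dN = N ω - ω N`, and it vanishes
  -- at `0` because `Y₀` lies in the group.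
  have hYS : ∀ z ∈ Metric.ball (0 : E) r, adj S (Y z) * Y z - 1 = 0 := by
    refine eq_zero_of_fderiv_mem_succ (deg := deg) hS.le (M := fun z => adj S (Y z) * Y z - 1)
      ?_ ?_ ?_ ?_
    · intro z hz
      have := (hY z hz).1
      exact differentiableAt_matrix_sub_const 1
        (differentiableAt_matrix_mul (differentiableAt_linearMap_comp _ this) this)
    · simp only [hY0, hY₀.2, sub_self]
    · intro z hz
      exact lowerSub_anti (Nat.zero_le 1)
        (mul_sub_one_mem (hS.adj_sub_one_mem (hY1 z hz)) (hY1 z hz))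
    · intro n hn z hz v
      rw [fderiv_adj_mul_self (hY z hz).1, hYd z hz, hS.adj_mul, adj_gradedPart_fderiv hS (hTd z hz)
        (Filter.eventually_of_mem (Metric.isOpen_ball.mem_nhds hz)
          fun x hx => ⟨hT1 x hx, hTS x hx⟩)]
      set ω := gradedPart deg 1 (fderiv ℂ T z v) with hω
      have hω1 : ω ∈ lowerSub deg 1 := gradedPart_mem _
      have h1 : adj S (Y z) * (Y z * ω) + -ω * adj S (Y z) * Y z =
          (adj S (Y z) * Y z - 1) * ω - ω * (adj S (Y z) * Y z - 1) := by noncomm_ring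
      rw [h1]
      refine sub_mem (mul_mem_lowerSub (hn z hz) hω1) ?_
      rw [add_comm]
      exact mul_mem_lowerSub hω1 (hn z hz)
  refine ⟨Y, hY0, Filter.eventually_of_mem (Metric.ball_mem_nhds 0 hr) fun z hz =>
    ⟨(hY z hz).1, ⟨hY1 z hz, sub_eq_zero.1 (hYS z hz)⟩, (hY z hz).2.1, hYd z hz⟩⟩

end Lift

/-! ### Block matrices as graded matrices -/

section Blocks

variable {m w : ℕ} {h : Fin (w + 1) → ℕ} {Q : Matrix (Fin m) (Fin m) ℝ} {H : Filtration m}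
  {b : Basis (BlockIndex h) ℂ (Fin m → ℂ)} {Y : BlockMatrix h}

/-- The degree of an index of a Hodge frame. -/
def blockDeg (h : Fin (w + 1) → ℕ) (s : BlockIndex h) : ℕ := s.1

theorem blockDeg_le (s : BlockIndex h) : blockDeg h s ≤ w := Nat.lt_succ_iff.1 s.1.2

theorem prW_apply (X : BlockMatrix h) (s t : BlockIndex h) :
    prW h X s t = if blockDeg h s ≤ blockDeg h t + 2 then X s t else 0 := rfl

theorem prW_sub_mem (X : BlockMatrix h) : prW h X - X ∈ lowerSub (blockDeg h) 3 := by
  intro s t hst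
  rw [Matrix.sub_apply, prW_apply, if_pos (by omega), sub_self]

theorem prW_eq_zero_iff {X : BlockMatrix h} : prW h X = 0 ↔ X ∈ lowerSub (blockDeg h) 3 := by
  constructor
  · intro hX s t hst
    have := congrFun (congrFun hX s) t
    rwa [prW_apply, if_pos (by omega)] at this
  · intro hX
    ext s t
    rw [prW_apply]
    split_ifs
    · exact hX s t (by omega)
    · rfl

theorem prW_eq_self {X : BlockMatrix h}
    (hX : ∀ s t, blockDeg h t + 2 < blockDeg h s → X s t = 0) : prW h X = X := by
  ext s t
  rw [prW_apply]
  split_ifs with hst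
  · rfl
  · exact (hX s t (by omega)).symm

theorem gradedPart_prW {d : ℕ} (hd : d < 3) (X : BlockMatrix h) :
    gradedPart (blockDeg h) d (prW h X) = gradedPart (blockDeg h) d X := by
  rw [← sub_eq_zero, ← map_sub]
  exact gradedPart_eq_zero (prW_sub_mem X) hd

theorem isBlockUnipotent_iff : IsBlockUnipotent Y ↔ Y - 1 ∈ lowerSub (blockDeg h) 1 := by
  constructor
  · rintro ⟨h1, h2⟩ ⟨i, a⟩ ⟨j, c⟩ hst
    have hst' : (i : ℕ) < j + 1 := hst
    rw [Matrix.sub_apply]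
    rcases (Fin.le_def.2 (Nat.lt_succ_iff.1 hst')).lt_or_eq with hij | hij
    · have := congrFun (congrFun (h2 i j hij) a) c
      rw [show Y ⟨i, a⟩ ⟨j, c⟩ = 0 from this, Matrix.one_apply_ne, sub_zero]
      intro heq
      exact hij.ne (congrArg Sigma.fst heq)
    · subst hij
      have := congrFun (congrFun (h1 i) a) c
      rw [show Y ⟨i, a⟩ ⟨i, c⟩ = _ from this, Matrix.one_apply, Matrix.one_apply]
      simp
  · intro hY
    refine ⟨fun i => ?_, fun i j hij => ?_⟩
    · ext a c
      have := sub_eq_zero.1 (hY ⟨i, a⟩ ⟨i, c⟩ (Nat.lt_succ_self _))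
      rw [blk, this, Matrix.one_apply, Matrix.one_apply]
      simp
    · ext a c
      have := sub_eq_zero.1 (hY ⟨i, a⟩ ⟨j, c⟩ (Nat.lt_succ_of_lt (Fin.lt_def.1 hij)))
      rw [blk, this, Matrix.one_apply_ne, Matrix.zero_apply]
      intro heq
      exact hij.ne (congrArg Sigma.fst heq)

theorem unipotentGroup_eq (hS : IsGradedForm (blockDeg h) w (gram Q b)) :
    unipotentGroup Q b = gradedGroup (blockDeg h) (gram Q b) := by
  ext Y
  exact and_congr isBlockUnipotent_iff hS.adj_mul_eq_one_iff.symm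

/-- Multiplication by `S` exchanges rows of degrees `i` and `w - i`. The block `(l,j)` of `Yᵀ * S *
Y - S` thus corresponds to degree `w - l - j` of `adj S Y * Y - 1`, and `w ≤ l + j + 2` says that
this degree is at most two. -/
theorem adj_mul_sub_one_mem_iff {S : BlockMatrix h} (hS : IsGradedForm (blockDeg h) w S) :
    adj S Y * Y - 1 ∈ lowerSub (blockDeg h) 3 ↔ ∀ l j : Fin (w + 1), w ≤ (l : ℕ) + (j : ℕ) + 2 →
      blk l j (Yᵀ * S * Y) = blk l j S := by
  have h1 : S * (adj S Y * Y - 1) = Yᵀ * S * Y - S := by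
    rw [adj_apply, mul_sub, mul_one, ← mul_assoc, ← mul_assoc, ← mul_assoc, hS.mul_inv, one_mul]
  have h2 : adj S Y * Y - 1 = S⁻¹ * (Yᵀ * S * Y - S) := by
    rw [← h1, ← mul_assoc, hS.inv_mul, one_mul]
  constructor
  · intro hY l j hlj
    ext a c
    refine sub_eq_zero.1 ?_
    change (Yᵀ * S * Y - S) ⟨l, a⟩ ⟨j, c⟩ = 0
    rw [← h1, Matrix.mul_apply]
    refine Finset.sum_eq_zero fun r _ => ?_
    by_cases hr : blockDeg h ⟨l, a⟩ + blockDeg h r = w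
    · rw [hY r ⟨j, c⟩, mul_zero]
      simp only [blockDeg] at *
      omega
    · rw [hS.apply_eq_zero _ _ hr, zero_mul]
  · intro hY s t hst
    rw [h2, Matrix.mul_apply]
    refine Finset.sum_eq_zero fun r _ => ?_
    by_cases hr : blockDeg h s + blockDeg h r = w
    · have : (Yᵀ * S * Y - S) r t = 0 :=
        sub_eq_zero.2 (congrFun (congrFun (hY r.1 t.1 (by simp only [blockDeg] at *; omega)) r.2)
          t.2)
      rw [this, mul_zero]
    · rw [hS.inv_apply_eq_zero _ _ hr, zero_mul]

theorem mem_contactManifold_iff (hS : IsGradedForm (blockDeg h) w (gram Q b)) :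
    Y ∈ contactManifold Q b ↔ Y - 1 ∈ lowerSub (blockDeg h) 1 ∧
      (∀ s t, blockDeg h t + 2 < blockDeg h s → Y s t = 0) ∧
      adj (gram Q b) Y * Y - 1 ∈ lowerSub (blockDeg h) 3 := by
  refine and_congr isBlockUnipotent_iff (and_congr ?_ (adj_mul_sub_one_mem_iff hS).symm)
  constructor
  · intro hY s t hst
    exact congrFun (congrFun (hY s.1 t.1 hst) s.2) t.2
  · intro hY i j hij
    ext a c
    exact hY ⟨i, a⟩ ⟨j, c⟩ hij

theorem prW_mem_contactManifold (hS : IsGradedForm (blockDeg h) w (gram Q b))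
    (hY : Y ∈ unipotentGroup Q b) : prW h Y ∈ contactManifold Q b := by
  rw [unipotentGroup_eq hS] at hY
  have hsub := prW_sub_mem Y
  have h1 : prW h Y - 1 ∈ lowerSub (blockDeg h) 1 := by
    simpa using add_mem (lowerSub_anti (by omega : 1 ≤ 3) hsub) hY.1
  refine (mem_contactManifold_iff hS).2 ⟨h1, fun s t hst => ?_, ?_⟩
  · rw [prW_apply, if_neg (by omega)]
  · have := hS.adj_mul_sub_mem (mem_lowerSub_zero h1) (mem_lowerSub_zero hY.1) hsub
    rwa [hY.2] at this

theorem prW_image_unipotentGroup (hS : IsGradedForm (blockDeg h) w (gram Q b)) :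
    prW h '' unipotentGroup Q b = contactManifold Q b := by
  refine Set.Subset.antisymm ?_ fun V hV => ?_
  · rintro _ ⟨Y, hY, rfl⟩
    exact prW_mem_contactManifold hS hY
  · obtain ⟨h1, h2, h3⟩ := (mem_contactManifold_iff hS).1 hV
    obtain ⟨Z, hZ, hZV⟩ := hS.exists_mem_gradedGroup h1 h3
    refine ⟨Z, by rwa [unipotentGroup_eq hS], ?_⟩
    have := prW_eq_zero_iff.2 hZV
    rw [map_sub, prW_eq_self h2] at this
    exact sub_eq_zero.1 this

end Blocks

/-! ### The Hodge filtration in a Hodge frame -/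

section Pairing

variable {m : ℕ} {Q : Matrix (Fin m) (Fin m) ℝ}

/-- The complex bilinear extension of `Q`, as a bilinear map. -/
def pairingBilin (Q : Matrix (Fin m) (Fin m) ℝ) :
    (Fin m → ℂ) →ₗ[ℂ] (Fin m → ℂ) →ₗ[ℂ] ℂ :=
  Matrix.toLinearMap₂' ℂ (Q.map ((↑) : ℝ → ℂ))

theorem pairingBilin_apply (x y : Fin m → ℂ) : pairingBilin Q x y = pairing Q x y := by
  rw [pairingBilin, Matrix.toLinearMap₂'_apply', pairing]

theorem pairing_star (x y : Fin m → ℂ) : pairing Q (star x) (star y) = star (pairing Q x y) := by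
  simp only [pairing, dotProduct, Matrix.mulVec, Matrix.map_apply, Pi.star_apply, star_sum,
    star_mul']
  simp

theorem pairing_comm {w : ℕ} (hQ : Qᵀ = (-1 : ℝ) ^ w • Q) (x y : Fin m → ℂ) :
    pairing Q y x = (-1) ^ w * pairing Q x y := by
  have h1 : (Q.map ((↑) : ℝ → ℂ))ᵀ = (-1 : ℂ) ^ w • Q.map ((↑) : ℝ → ℂ) := by
    ext i j
    have := congrFun (congrFun hQ i) j
    simp only [Matrix.transpose_apply, Matrix.smul_apply, smul_eq_mul, Matrix.map_apply] at *
    rw [this]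
    push_cast
    rfl
  rw [pairing, pairing, Matrix.dotProduct_mulVec, ← Matrix.mulVec_transpose, h1, dotProduct_comm,
    Matrix.smul_mulVec, dotProduct_smul, smul_eq_mul]

theorem mem_conjSubmodule {S : Submodule ℂ (Fin m → ℂ)} {x : Fin m → ℂ} :
    x ∈ conjSubmodule S ↔ star x ∈ S := Iff.rfl

end Pairing

section Frame

variable {m w : ℕ} {h : Fin (w + 1) → ℕ} {Q : Matrix (Fin m) (Fin m) ℝ} {H : Filtration m}
  {b : Basis (BlockIndex h) ℂ (Fin m → ℂ)}

theorem IsHodgeFrame.apply_mem (hb : IsHodgeFrame Q H b) (s : BlockIndex h) :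
    b s ∈ H (w - blockDeg h s) := (hb.mem s.1 s.2).1

theorem IsHodgeFrame.star_apply_mem (hb : IsHodgeFrame Q H b) (s : BlockIndex h) :
    star (b s) ∈ H (blockDeg h s) := by
  have h1 : star (b s) ∈ H (w - (w - (s.1 : ℕ))) := (hb.mem s.1 s.2).2
  have h2 := blockDeg_le s
  unfold blockDeg at *
  rwa [Nat.sub_sub_self h2] at h1

theorem IsHodgeFrame.isGradedForm_gram (hb : IsHodgeFrame Q H b)
    (hH : IsPolarizedHodgeFiltration w h Q H) (hQdet : Q.det ≠ 0)
    (hQsymm : Qᵀ = (-1 : ℝ) ^ w • Q) : IsGradedForm (blockDeg h) w (gram Q b) where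
  le := blockDeg_le
  isUnit := by
    rw [← Matrix.isUnit_iff_isUnit_det, ← Matrix.mulVec_injective_iff_isUnit]
    refine (injective_iff_map_eq_zero (Matrix.mulVecLin (gram Q b))).2 fun x hx => ?_
    have h1 : ∀ s, pairing Q (b s) (∑ t, x t • b t) = 0 := by
      intro s
      have := congrFun hx s
      rw [← pairingBilin_apply, map_sum]
      simp only [map_smul, pairingBilin_apply, smul_eq_mul]
      simpa [Matrix.mulVec, dotProduct, gram, mul_comm] using this
    have h2 : (pairingBilin Q).flip (∑ t, x t • b t) = 0 :=
      b.ext fun s => by rw [LinearMap.flip_apply, pairingBilin_apply, h1]; rfl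
    have h3 : Q.map ((↑) : ℝ → ℂ) *ᵥ (∑ t, x t • b t) = 0 := by
      ext i
      have := LinearMap.congr_fun h2 (Pi.single i 1)
      rw [LinearMap.flip_apply, pairingBilin_apply, pairing, single_one_dotProduct] at this
      simpa using this
    have h4 : IsUnit (Q.map ((↑) : ℝ → ℂ)).det := by
      have : (Q.map ((↑) : ℝ → ℂ)).det = ((Q.det : ℝ) : ℂ) :=
        (RingHom.map_det Complex.ofRealHom Q).symm
      rw [this]
      exact isUnit_iff_ne_zero.2 (by exact_mod_cast hQdet)
    have h5 : ∑ t, x t • b t = 0 :=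
      Matrix.mulVec_injective_iff_isUnit.2 ((Matrix.isUnit_iff_isUnit_det _).2 h4)
        (by rw [h3, Matrix.mulVec_zero])
    funext t
    exact Fintype.linearIndependent_iff.1 b.linearIndependent x h5 t
  apply_eq_zero s t hst := by
    have hs := blockDeg_le s
    have ht := blockDeg_le t
    -- For `deg s + deg t < w` the isotropy relations apply to the frame vectors themselves. For
    -- `deg s + deg t > w` they apply to the conjugate vectors, as `Q` is real.
    rcases lt_or_gt_of_ne hst with hlt | hgt
    · exact hH.isotropic (w - blockDeg h s) (by omega) _ (hb.apply_mem s) _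
        (hH.anti (by omega) (hb.apply_mem t))
    · have := hH.isotropic (blockDeg h s) (by omega) _ (hb.star_apply_mem s) _
        (hH.anti (by omega) (hb.star_apply_mem t))
      rwa [pairing_star, star_eq_zero] at this
  symm := by
    ext s t
    exact pairing_comm hQsymm _ _

/-- The Hodge filtration in terms of coordinates in a Hodge frame. -/
theorem IsHodgeFrame.mem_iff (hb : IsHodgeFrame Q H b) (hH : IsPolarizedHodgeFiltration w h Q H)
    {p : ℕ} {x : Fin m → ℂ} :
    x ∈ H p ↔ ∀ s, w < p + blockDeg h s → b.repr x s = 0 := by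
  have hlow : ∀ c : BlockIndex h → ℂ, (∀ s, w < p + blockDeg h s → c s = 0) →
      ∑ s, c s • b s ∈ H p := by
    intro c hc
    refine Submodule.sum_mem _ fun s _ => ?_
    by_cases hs : w < p + blockDeg h s
    · rw [hc s hs, zero_smul]
      exact zero_mem _
    · exact Submodule.smul_mem _ _ (hH.anti (by omega) (hb.apply_mem s))
  constructor
  · intro hx
    by_cases hp : p ≤ w + 1
    swap
    · have : x ∈ H (w + 1) := hH.anti (by omega) hx
      rw [hH.last, Submodule.mem_bot] at this
      simp [this]
    have hx₁ := hlow (fun s => if w < p + blockDeg h s then 0 else b.repr x s)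
      (fun s hs => by simp [hs])
    have hsum : ∑ s, (if w < p + blockDeg h s then 0 else b.repr x s) • b s +
        ∑ s, (if w < p + blockDeg h s then b.repr x s else 0) • b s = x := by
      rw [← Finset.sum_add_distrib]
      conv_rhs => rw [← b.sum_repr x]
      refine Finset.sum_congr rfl fun s _ => ?_
      split_ifs <;> simp
    -- The components that should vanish form a vector lying both in `H p` and in the conjugate of
    -- `H (w + 1 - p)`, which are transverse.
    set x₂ := ∑ s, (if w < p + blockDeg h s then b.repr x s else 0) • b s with hx₂
    have h1 : x₂ ∈ H p := (Submodule.add_mem_iff_right _ hx₁).1 (hsum.symm ▸ hx)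
    have h2 : x₂ ∈ conjSubmodule (H (w + 1 - p)) := by
      refine Submodule.sum_mem _ fun s _ => ?_
      split_ifs with hs
      · refine Submodule.smul_mem _ _ (mem_conjSubmodule.2 ?_)
        exact hH.anti (by omega) (hb.star_apply_mem s)
      · rw [zero_smul]
        exact zero_mem _
    have h3 : x₂ = 0 := Submodule.disjoint_def.1 (hH.compl p hp).disjoint x₂ h1 h2
    intro s hs
    have := Fintype.linearIndependent_iff.1 b.linearIndependent _ (hx₂ ▸ h3) s
    simpa [hs] using this
  · intro hx
    rw [← b.sum_repr x]
    exact hlow _ hx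

theorem repr_toLin (X : BlockMatrix h) (x : Fin m → ℂ) :
    b.repr (Matrix.toLin b b X x) = X *ᵥ b.repr x := by
  conv_rhs => rw [← LinearMap.toMatrix_toLin b b X]
  exact (LinearMap.toMatrix_mulVec_repr b b _ x).symm

/-- A matrix lowers the Hodge filtration by at most `e` if and only if it has no components of
degree greater than `e`. -/
theorem IsHodgeFrame.forall_toLin_mem_iff (hb : IsHodgeFrame Q H b)
    (hH : IsPolarizedHodgeFiltration w h Q H) {e : ℕ} {X : BlockMatrix h} :
    (∀ p, ∀ x ∈ H (p + e), Matrix.toLin b b X x ∈ H p) ↔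
      ∀ s t, blockDeg h t + e < blockDeg h s → X s t = 0 := by
  constructor
  · intro hX s t hst
    have hs := blockDeg_le s
    -- The truncated subtraction is exact here, because `deg t + e < deg s ≤ w`.
    have h1 : b t ∈ H (w - blockDeg h t - e + e) := by
      rw [Nat.sub_add_cancel (by omega)]
      exact hb.apply_mem t
    have h2 := (hb.mem_iff hH).1 (hX _ _ h1) s (by omega)
    rwa [repr_toLin, b.repr_self, Finsupp.single_eq_pi_single, Matrix.mulVec_single_one] at h2
  · intro hX p x hx
    refine (hb.mem_iff hH).2 fun s hs => ?_
    rw [repr_toLin, Matrix.mulVec, dotProduct]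
    refine Finset.sum_eq_zero fun t _ => ?_
    by_cases hst : blockDeg h t + e < blockDeg h s
    · rw [hX s t hst, zero_mul]
    · rw [(hb.mem_iff hH).1 hx t (by omega), mul_zero]

end Frame

/-! ### Germs in the group and germs of the contact system -/

/-- The holomorphic inverse function theorem, for a derivative equal to the identity. -/
theorem exists_holomorphic_inverse {E : Type*} [NormedAddCommGroup E] [NormedSpace ℂ E]
    [FiniteDimensional ℂ E] {g : E → E} {a : E} (hg : ∀ᶠ z in 𝓝 a, DifferentiableAt ℂ g z)
    (hg' : HasFDerivAt g (ContinuousLinearMap.id ℂ E) a) :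
    ∃ ψ : E → E, (∀ᶠ z in 𝓝 a, ψ (g z) = z) ∧ (∀ᶠ y in 𝓝 (g a), g (ψ y) = y) ∧
      ∀ᶠ y in 𝓝 (g a), DifferentiableAt ℂ ψ y := by
  have : CompleteSpace E := FiniteDimensional.complete ℂ E
  have hc : ContDiffAt ℂ 1 g a := contDiffAt_one_of_eventually_differentiableAt hg
  have hg'' : HasFDerivAt g ((ContinuousLinearEquiv.refl ℂ E : E ≃L[ℂ] E) : E →L[ℂ] E) a := hg'
  have hs := hc.hasStrictFDerivAt' hg'' one_ne_zero
  refine ⟨hc.localInverse hg'' one_ne_zero, hs.eventually_left_inverse,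
    hs.eventually_right_inverse, ?_⟩
  have h1 := (hc.to_localInverse hg'' one_ne_zero).eventually (by simp)
  exact h1.mono fun y hy => hy.differentiableAt one_ne_zero

/-! ### The contact forms as graded matrix identities -/

section ContactForms

variable {w : ℕ} {h : Fin (w + 1) → ℕ}

/-- In column `j` the degree one part of `A` is supported in row `j + 1`, so the block product is an
entry of a full matrix product. The contact system becomes the degree two part of `A = Y * A₁`. -/
theorem contactForm_apply {i l j : Fin (w + 1)} (hl : (l : ℕ) = j + 1) (a : Fin (h i))
    (c : Fin (h j)) (Y A : BlockMatrix h) :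
    contactForm i l j a c Y A =
      A ⟨i, a⟩ ⟨j, c⟩ - (Y * gradedPart (blockDeg h) 1 A) ⟨i, a⟩ ⟨j, c⟩ := by
  change (blk i j A - blk i l Y * blk l j A) a c = _
  rw [Matrix.sub_apply, Matrix.mul_apply, Matrix.mul_apply, Fintype.sum_sigma,
    Finset.sum_eq_single l]
  · congr 1
    refine Finset.sum_congr rfl fun r _ => ?_
    rw [gradedPart_apply, if_pos (show blockDeg h ⟨l, r⟩ = blockDeg h ⟨j, c⟩ + 1 from hl)]
    rfl
  · intro l' _ hl'
    refine Finset.sum_eq_zero fun r _ => ?_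
    rw [gradedPart_apply, if_neg, mul_zero]
    intro h'
    exact hl' (Fin.ext ((show (l' : ℕ) = j + 1 from h').trans hl.symm))
  · simp

theorem forall_contactForms_iff {P : OneForm h → Prop} {R : BlockIndex h → BlockIndex h → Prop}
    (hPR : ∀ (i l j : Fin (w + 1)) (a : Fin (h i)) (c : Fin (h j)), (l : ℕ) = j + 1 →
      (i : ℕ) = j + 2 → (P (contactForm i l j a c) ↔ R ⟨i, a⟩ ⟨j, c⟩)) :
    (∀ θ ∈ contactForms h, P θ) ↔ ∀ s t, blockDeg h s = blockDeg h t + 2 → R s t := by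
  constructor
  · rintro hP ⟨i, a⟩ ⟨j, c⟩ hst
    have hst' : (i : ℕ) = j + 2 := hst
    have hi := i.2
    exact (hPR i ⟨j + 1, by omega⟩ j a c rfl hst).1 (hP _ ⟨i, ⟨j + 1, by omega⟩, j, a, c, rfl, hst, rfl⟩)
  · rintro hR _ ⟨i, l, j, a, c, hl, hi, rfl⟩
    exact (hPR i l j a c hl hi).2 (hR _ _ hi)

theorem contactForms_eq_zero_iff {Y A : BlockMatrix h} :
    (∀ θ ∈ contactForms h, θ Y A = 0) ↔
      gradedPart (blockDeg h) 2 A = gradedPart (blockDeg h) 2 (Y * gradedPart (blockDeg h) 1 A) := by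
  rw [forall_contactForms_iff (R := fun s t => A s t = (Y * gradedPart (blockDeg h) 1 A) s t)]
  · constructor
    · intro hA
      ext s t
      rw [gradedPart_apply, gradedPart_apply]
      split_ifs with hst
      · exact hA s t hst
      · rfl
    · intro hA s t hst
      have := congrFun (congrFun hA s) t
      rwa [gradedPart_apply, gradedPart_apply, if_pos hst, if_pos hst] at this
  · intro i l j a c hl hi
    rw [contactForm_apply hl, sub_eq_zero]

/-- On a fixed vector the form is a constant minus a linear function of the base point. -/
theorem extD_contactForm {i l j : Fin (w + 1)} (hl : (l : ℕ) = j + 1) (a : Fin (h i))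
    (c : Fin (h j)) (Y A B : BlockMatrix h) :
    extD (contactForm i l j a c) Y A B = (B * gradedPart (blockDeg h) 1 A) ⟨i, a⟩ ⟨j, c⟩ -
      (A * gradedPart (blockDeg h) 1 B) ⟨i, a⟩ ⟨j, c⟩ := by
  have key : ∀ A B : BlockMatrix h, fderiv ℂ (fun Z => contactForm i l j a c Z B) Y A =
      -(A * gradedPart (blockDeg h) 1 B) ⟨i, a⟩ ⟨j, c⟩ := by
    intro A B
    have h1 : (fun Z => contactForm i l j a c Z B) = fun Z : BlockMatrix h =>
        B ⟨i, a⟩ ⟨j, c⟩ - (Z * gradedPart (blockDeg h) 1 B) ⟨i, a⟩ ⟨j, c⟩ := by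
      funext Z
      exact contactForm_apply hl a c Z B
    let L : BlockMatrix h →ₗ[ℂ] ℂ :=
      { toFun := fun Z => (Z * gradedPart (blockDeg h) 1 B) ⟨i, a⟩ ⟨j, c⟩
        map_add' := fun X Z => by rw [add_mul]; rfl
        map_smul' := fun r X => by rw [Matrix.smul_mul]; rfl }
    let L' : (BlockIndex h → BlockIndex h → ℂ) →L[ℂ] ℂ := LinearMap.toContinuousLinearMap L
    have h2 : HasFDerivAt (fun Z => B ⟨i, a⟩ ⟨j, c⟩ - L' Z) (-L') Y := L'.hasFDerivAt.const_sub _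
    rw [h1]
    exact congrArg (fun f => f A) h2.fderiv
  rw [extD, key, key]
  ring

/-- In degree two, a product with a degree one matrix only sees the degree one part of the other
factor, so the exterior derivatives are entries of a commutator. -/
theorem extD_contactForms_eq_zero_iff {Y A B : BlockMatrix h} (hA : A ∈ lowerSub (blockDeg h) 1)
    (hB : B ∈ lowerSub (blockDeg h) 1) :
    (∀ θ ∈ contactForms h, extD θ Y A B = 0) ↔
      gradedPart (blockDeg h) 1 A * gradedPart (blockDeg h) 1 B =
        gradedPart (blockDeg h) 1 B * gradedPart (blockDeg h) 1 A := by
  have key : ∀ {A B : BlockMatrix h}, A ∈ lowerSub (blockDeg h) 1 → ∀ s t,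
      blockDeg h s = blockDeg h t + 2 → (A * gradedPart (blockDeg h) 1 B) s t =
        (gradedPart (blockDeg h) 1 A * gradedPart (blockDeg h) 1 B) s t := by
    intro A B hA s t hst
    refine sub_eq_zero.1 ?_
    rw [← Matrix.sub_apply, ← sub_mul]
    exact mul_mem_lowerSub (sub_gradedPart_mem hA) (gradedPart_mem (d := 1) B) s t (by omega)
  rw [forall_contactForms_iff (R := fun s t =>
    (gradedPart (blockDeg h) 1 A * gradedPart (blockDeg h) 1 B) s t =
      (gradedPart (blockDeg h) 1 B * gradedPart (blockDeg h) 1 A) s t)]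
  · constructor
    · intro hAB
      rw [← gradedPart_mul_gradedPart, ← gradedPart_mul_gradedPart (X := B)]
      ext s t
      rw [gradedPart_apply, gradedPart_apply]
      split_ifs with hst
      · exact hAB s t hst
      · rfl
    · intro hAB s t _
      rw [hAB]
  · intro i l j a c hl hi
    rw [extD_contactForm hl, key hA _ _ (show blockDeg h ⟨i, a⟩ = blockDeg h ⟨j, c⟩ + 2 from hi),
      key hB _ _ (show blockDeg h ⟨i, a⟩ = blockDeg h ⟨j, c⟩ + 2 from hi), sub_eq_zero]
    exact eq_comm

end ContactForms

/-! ### Bijection between germs in the group and germs in `W` -/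

section Germs

variable {w : ℕ} {h : Fin (w + 1) → ℕ}

/-- `Y` is a holomorphic immersion of a neighbourhood of `0` in `ℂ^k` into the group, sending `0`
to `Y₀`, such that `Y⁻¹ dY` is of degree `1`. -/
structure IsGroupImmersion {k : ℕ} (S Y₀ : BlockMatrix h) (Y : (Fin k → ℂ) → BlockMatrix h) :
    Prop where
  zero : Y 0 = Y₀
  diff : ∀ᶠ z in 𝓝 0, DifferentiableAt ℂ Y z
  mem : ∀ᶠ z in 𝓝 0, Y z ∈ gradedGroup (blockDeg h) S
  fderiv_eq : ∀ᶠ z in 𝓝 0, ∀ v,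
    fderiv ℂ Y z v = Y z * gradedPart (blockDeg h) 1 (fderiv ℂ Y z v)
  immersion : ∀ᶠ z in 𝓝 0, Function.Injective (fderiv ℂ Y z)

/-- Germs of integral manifolds of the horizontal system, in Lie group coordinates. -/
def IsGroupGerm (S Y₀ : BlockMatrix h) (k : ℕ) (𝓩 : Filter (BlockMatrix h)) : Prop :=
  ∃ Y : (Fin k → ℂ) → BlockMatrix h, IsGroupImmersion S Y₀ Y ∧ 𝓩 = map Y (𝓝 0)

theorem IsGroupGerm.mem {S Y₀ : BlockMatrix h} {k : ℕ} {𝓩 : Filter (BlockMatrix h)}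
    (h𝓩 : IsGroupGerm S Y₀ k 𝓩) : gradedGroup (blockDeg h) S ∈ 𝓩 := by
  obtain ⟨Y, hY, rfl⟩ := h𝓩
  exact hY.mem

/-- `prW` keeps the degree one part of `dY`, and this part determines `dY`; hence projecting does
not lower the dimension. -/
theorem fderiv_prW_injective {E : Type*} [NormedAddCommGroup E] [NormedSpace ℂ E]
    {Y : E → BlockMatrix h} {z : E} (hY : DifferentiableAt ℂ Y z)
    (hd : ∀ v, fderiv ℂ Y z v = Y z * gradedPart (blockDeg h) 1 (fderiv ℂ Y z v))
    (hinj : Function.Injective (fderiv ℂ Y z)) :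
    Function.Injective (fderiv ℂ (fun x => prW h (Y x)) z) := by
  refine (injective_iff_map_eq_zero _).2 fun v hv => ?_
  rw [fderiv_linearMap_comp_matrix _ hY] at hv
  refine (injective_iff_map_eq_zero _).1 hinj v ?_
  rw [hd, ← gradedPart_prW (by omega), hv, map_zero, mul_zero]

variable {m : ℕ} {Q : Matrix (Fin m) (Fin m) ℝ} {b : Basis (BlockIndex h) ℂ (Fin m → ℂ)}
  {Y₀ : BlockMatrix h} {k : ℕ}

theorem IsGroupGerm.isContactGerm (hS : IsGradedForm (blockDeg h) w (gram Q b))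
    {𝓩 : Filter (BlockMatrix h)} (h𝓩 : IsGroupGerm (gram Q b) Y₀ k 𝓩) :
    IsContactGerm Q b (prW h Y₀) k (map (prW h) 𝓩) := by
  obtain ⟨Y, hY, rfl⟩ := h𝓩
  refine ⟨fun z => prW h (Y z), congrArg _ hY.zero, ?_, Filter.map_map⟩
  filter_upwards [hY.diff, hY.mem, hY.fderiv_eq, hY.immersion] with z h1 h2 h3 h4
  refine ⟨differentiableAt_linearMap_comp _ h1,
    prW_mem_contactManifold hS (by rwa [unipotentGroup_eq hS]), ?_, fderiv_prW_injective h1 h3 h4⟩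
  have h5 : ∀ v, ∀ θ ∈ contactForms h,
      θ (prW h (Y z)) (fderiv ℂ (fun x => prW h (Y x)) z v) = 0 := by
    intro v
    rw [contactForms_eq_zero_iff, fderiv_linearMap_comp_matrix _ h1, gradedPart_prW (by omega),
      gradedPart_prW (by omega)]
    conv_lhs => rw [h3 v]
    rw [← sub_eq_zero, ← map_sub, ← sub_mul]
    refine gradedPart_eq_zero (d := 3 + 1) (mul_mem_lowerSub ?_ (gradedPart_mem _)) (by omega)
    rw [← neg_sub]
    exact neg_mem (prW_sub_mem _)
  exact fun θ hθ v => h5 v θ hθ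

theorem IsContactGerm.exists_isGroupGerm (hS : IsGradedForm (blockDeg h) w (gram Q b))
    (hY₀ : Y₀ ∈ unipotentGroup Q b) {𝓣 : Filter (BlockMatrix h)}
    (h𝓣 : IsContactGerm Q b (prW h Y₀) k 𝓣) :
    ∃ 𝓩, IsGroupGerm (gram Q b) Y₀ k 𝓩 ∧ map (prW h) 𝓩 = 𝓣 := by
  obtain ⟨T, hT0, hT, rfl⟩ := h𝓣
  rw [unipotentGroup_eq hS] at hY₀
  obtain ⟨Y, hY0, hY⟩ := exists_lift (T := T) hS hY₀ (by rw [hT0]; exact prW_sub_mem _) (by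
    filter_upwards [hT] with z ⟨h1, h2, h3, _⟩
    obtain ⟨h4, _, h5⟩ := (mem_contactManifold_iff hS).1 h2
    exact ⟨h1, h4, h5, fun v => contactForms_eq_zero_iff.1 fun θ hθ => h3 θ hθ v⟩)
  -- The lift differs from `T` only in degrees at least three, where `T` has no blocks.
  have hTY : T =ᶠ[𝓝 0] fun z => prW h (Y z) := by
    filter_upwards [hT, hY] with z h1 h2
    have h3 := prW_eq_zero_iff.2 h2.2.2.1
    rw [map_sub, prW_eq_self ((mem_contactManifold_iff hS).1 h1.2.1).2.1, sub_eq_zero] at h3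
    exact h3.symm
  refine ⟨map Y (𝓝 0), ⟨Y, ⟨hY0, hY.mono fun z hz => hz.1, hY.mono fun z hz => hz.2.1, ?_, ?_⟩, rfl⟩,
    ?_⟩
  · filter_upwards [hY] with z ⟨_, h2, _, h4⟩ v
    rw [h4 v, gradedPart_mul_left h2.1 (gradedPart_mem _), gradedPart_gradedPart]
  · filter_upwards [hY, hT, hTY.eventuallyEq_nhds] with z h1 h2 h3
    refine (injective_iff_map_eq_zero _).2 fun v hv => ?_
    refine (injective_iff_map_eq_zero _).1 h2.2.2.2 v ?_
    rw [h3.fderiv_eq, fderiv_linearMap_comp_matrix _ h1.1, hv, map_zero]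
  · rw [Filter.map_map]
    exact (Filter.map_congr hTY).symm

theorem fderiv_matrix_comp {ι E F : Type*} [Fintype ι] [NormedAddCommGroup E] [NormedSpace ℂ E]
    [NormedAddCommGroup F] [NormedSpace ℂ F] {Y : F → Matrix ι ι ℂ} {φ : E → F} {z : E}
    (hY : DifferentiableAt ℂ Y (φ z)) (hφ : DifferentiableAt ℂ φ z) :
    DifferentiableAt ℂ (fun x => Y (φ x)) z ∧
      ∀ v, fderiv ℂ (fun x => Y (φ x)) z v = fderiv ℂ Y (φ z) (fderiv ℂ φ z v) := by
  have h1 : HasFDerivAt (fun x => Y (φ x)) ((fderiv ℂ Y (φ z)).comp (fderiv ℂ φ z)) z :=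
    HasFDerivAt.comp (G := ι → ι → ℂ) z hY.hasFDerivAt hφ.hasFDerivAt
  refine ⟨h1.differentiableAt, fun v => ?_⟩
  rw [h1.fderiv]
  rfl

/-- An immersion into the space of block matrices whose image contains the germ of the image of
another map is a local reparametrization of the latter. -/
theorem exists_reparametrization {k' : ℕ} {T : (Fin k → ℂ) → BlockMatrix h}
    {T' : (Fin k' → ℂ) → BlockMatrix h} (hT : ∀ᶠ z in 𝓝 0, DifferentiableAt ℂ T z)
    (hinj : Function.Injective (fderiv ℂ T 0)) (hT' : ∀ᶠ z in 𝓝 0, DifferentiableAt ℂ T' z)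
    (h0 : T' 0 = T 0) (hTT' : map T' (𝓝 0) ≤ map T (𝓝 0)) :
    ∃ φ : (Fin k' → ℂ) → (Fin k → ℂ), φ 0 = 0 ∧ (∀ᶠ z in 𝓝 0, DifferentiableAt ℂ φ z) ∧
      ∀ᶠ z in 𝓝 0, T' z = T (φ z) := by
  -- A linear left inverse `π` of the derivative makes `π ∘ T` a local biholomorphism. Its inverse
  -- `ψ` reads off the parameter of a point in the image, so the reparametrization is `ψ ∘ π ∘ T'`.
  obtain ⟨π, hπ⟩ := LinearMap.exists_leftInverse_of_injective
    ((fderiv ℂ T 0 : (Fin k → ℂ) →L[ℂ] BlockMatrix h) : (Fin k → ℂ) →ₗ[ℂ] BlockMatrix h)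
    (LinearMap.ker_eq_bot.2 hinj)
  have hg : ∀ᶠ z in 𝓝 0, DifferentiableAt ℂ (fun z => π (T z)) z :=
    hT.mono fun z hz => (hasFDerivAt_linearMap_comp π hz).differentiableAt
  have hg' : HasFDerivAt (fun z => π (T z)) (ContinuousLinearMap.id ℂ (Fin k → ℂ)) 0 := by
    have := hasFDerivAt_linearMap_comp π hT.self_of_nhds
    refine this.congr_fderiv ?_
    ext1 v
    exact LinearMap.congr_fun hπ v
  obtain ⟨ψ, hψ1, -, hψ2⟩ := exists_holomorphic_inverse hg hg'
  have hπT' : ∀ᶠ z in 𝓝 0, DifferentiableAt ℂ (fun z => π (T' z)) z :=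
    hT'.mono fun z hz => (hasFDerivAt_linearMap_comp π hz).differentiableAt
  refine ⟨fun z => ψ (π (T' z)), ?_, ?_, ?_⟩
  · change ψ (π (T' 0)) = 0
    rw [h0]
    exact hψ1.self_of_nhds
  · have hcont : ContinuousAt (fun z => π (T' z)) 0 := hπT'.self_of_nhds.continuousAt
    have hψ2' : ∀ᶠ y in 𝓝 (π (T' 0)), DifferentiableAt ℂ ψ y := by rwa [h0]
    filter_upwards [hcont.tendsto.eventually hψ2', hπT'] with z h1 h2
    exact DifferentiableAt.comp z h1 h2
  -- The inclusion of filters places `T' z`, for `z` near `0`, among the points `T y` whose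
  -- parameter `y` is recovered by `ψ ∘ π`.
  · have h1 : T '' {z | ψ (π (T z)) = z} ∈ map T' (𝓝 0) := hTT' (image_mem_map hψ1)
    filter_upwards [h1] with z hz
    obtain ⟨y, hy, hyz⟩ := hz
    rw [← hyz, show ψ (π (T y)) = y from hy]

/-- The projections differ by a reparametrization `φ`. Then `Y'` and `Y ∘ φ` solve the same equation
`dY = Y ω` with the same initial value, hence coincide. -/
theorem map_le_map_of_map_prW_le {S : BlockMatrix h} {k' : ℕ}
    {Y : (Fin k → ℂ) → BlockMatrix h} {Y' : (Fin k' → ℂ) → BlockMatrix h}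
    (hY : IsGroupImmersion S Y₀ Y) (hY' : IsGroupImmersion S Y₀ Y')
    (hle : map (prW h) (map Y' (𝓝 0)) ≤ map (prW h) (map Y (𝓝 0))) :
    map Y' (𝓝 0) ≤ map Y (𝓝 0) := by
  obtain ⟨φ, hφ0, hφ, hφT⟩ := exists_reparametrization (T := fun z => prW h (Y z))
    (T' := fun z => prW h (Y' z)) (hY.diff.mono fun z hz => differentiableAt_linearMap_comp _ hz)
    (fderiv_prW_injective hY.diff.self_of_nhds hY.fderiv_eq.self_of_nhds hY.immersion.self_of_nhds)
    (hY'.diff.mono fun z hz => differentiableAt_linearMap_comp _ hz) (by rw [hY.zero, hY'.zero])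
    hle
  have hφlim : Tendsto φ (𝓝 0) (𝓝 0) := by
    have := hφ.self_of_nhds.continuousAt.tendsto
    rwa [hφ0] at this
  have heq : Y' =ᶠ[𝓝 0] fun z => Y (φ z) := by
    refine eventuallyEq_of_fderiv_eq (deg := blockDeg h) blockDeg_le (by rw [hφ0, hY.zero, hY'.zero])
      ?_
    filter_upwards [hφ, hφlim.eventually hY.diff, hφlim.eventually hY.mem,
      hφlim.eventually hY.fderiv_eq, hY'.diff, hY'.mem, hY'.fderiv_eq,
      Filter.EventuallyEq.eventuallyEq_nhds hφT] with z h1 h2 h3 h4 h5 h6 h7 h8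
    obtain ⟨h9, h10⟩ := fderiv_matrix_comp h2 h1
    refine ⟨h5, h9, mem_lowerSub_zero h6.1, mem_lowerSub_zero h3.1, fun v =>
      ⟨_, gradedPart_mem (fderiv ℂ Y' z v), h7 v, ?_⟩⟩
    have h11 : prW h (fderiv ℂ Y' z v) = prW h (fderiv ℂ (fun x => Y (φ x)) z v) := by
      rw [← fderiv_linearMap_comp_matrix _ h5, ← fderiv_linearMap_comp_matrix _ h9, h8.fderiv_eq]
    rw [← gradedPart_prW (by omega), h11, gradedPart_prW (by omega), h10]
    exact h4 _
  rw [Filter.map_congr heq, show (fun z => Y (φ z)) = Y ∘ φ from rfl, ← Filter.map_map]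
  exact Filter.map_mono hφlim

theorem IsGroupGerm.eq_of_map_prW_eq {S : BlockMatrix h} {k' : ℕ} {𝓩 𝓩' : Filter (BlockMatrix h)}
    (h𝓩 : IsGroupGerm S Y₀ k 𝓩) (h𝓩' : IsGroupGerm S Y₀ k' 𝓩')
    (heq : map (prW h) 𝓩 = map (prW h) 𝓩') : 𝓩 = 𝓩' := by
  obtain ⟨Y, hY, rfl⟩ := h𝓩
  obtain ⟨Y', hY', rfl⟩ := h𝓩'
  exact le_antisymm (map_le_map_of_map_prW_le hY' hY heq.le)
    (map_le_map_of_map_prW_le hY hY' heq.ge)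

end Germs

/-! ### The period domain is open in Lie group coordinates -/

section Conj

variable {m : ℕ}

/-- The conjugate of a linear endomorphism. -/
def conjEnd (f : (Fin m → ℂ) →ₗ[ℂ] (Fin m → ℂ)) : (Fin m → ℂ) →ₗ[ℂ] (Fin m → ℂ) where
  toFun x := star (f (star x))
  map_add' x y := by simp [star_add]
  map_smul' c x := by simp [star_smul]

theorem conjSubmodule_map (f : (Fin m → ℂ) →ₗ[ℂ] (Fin m → ℂ)) (S : Submodule ℂ (Fin m → ℂ)) :
    conjSubmodule (S.map f) = (conjSubmodule S).map (conjEnd f) := by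
  ext x
  rw [mem_conjSubmodule, Submodule.mem_map, Submodule.mem_map]
  constructor
  · rintro ⟨y, hy, hyx⟩
    refine ⟨star y, by rwa [mem_conjSubmodule, star_star], ?_⟩
    change star (f (star (star y))) = x
    rw [star_star, hyx, star_star]
  · rintro ⟨y, hy, rfl⟩
    exact ⟨star y, hy, (star_star _).symm⟩

theorem finrank_map_of_injective {V : Type*} [AddCommGroup V] [Module ℂ V] {f : V →ₗ[ℂ] V}
    (hf : Function.Injective f) (S : Submodule ℂ V) : finrank ℂ (S.map f) = finrank ℂ S :=
  (Submodule.equivMapOfInjective f hf S).finrank_eq.symm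

theorem finrank_conjSubmodule_map {f : (Fin m → ℂ) →ₗ[ℂ] (Fin m → ℂ)}
    (hf : Function.Injective f) (S : Submodule ℂ (Fin m → ℂ)) :
    finrank ℂ (conjSubmodule (S.map f)) = finrank ℂ (conjSubmodule S) := by
  rw [conjSubmodule_map]
  refine finrank_map_of_injective (fun x y hxy => ?_) _
  exact star_injective (hf (star_injective hxy))

/-- By the modular law `F p` is the direct sum of the Hodge piece and `F (p + 1)`. Hodge numbers are
thus determined by the dimensions of the filtration, which `Y` preserves. -/
theorem finrank_hodgePiece {w : ℕ} {F : Filtration m} (hF : Antitone F) {p : ℕ} (hp : p ≤ w)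
    (hc : ∀ p ≤ w + 1, IsCompl (F p) (conjSubmodule (F (w + 1 - p)))) :
    finrank ℂ (hodgePiece w F p) + finrank ℂ (F (p + 1)) = finrank ℂ (F p) := by
  have h1 := hc (p + 1) (by omega)
  rw [Nat.add_sub_add_right] at h1
  have h2 := Submodule.finrank_sup_add_finrank_inf_eq (hodgePiece w F p) (F (p + 1))
  have h3 : hodgePiece w F p ⊓ F (p + 1) = ⊥ := by
    refine le_bot_iff.1 (le_trans ?_ h1.inf_eq_bot.le)
    exact le_inf inf_le_right (inf_le_left.trans inf_le_right)
  have h4 : hodgePiece w F p ⊔ F (p + 1) = F p := by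
    rw [hodgePiece, inf_sup_assoc_of_le _ (hF (Nat.le_succ p)), sup_comm, h1.sup_eq_top, inf_top_eq]
  rw [h3, h4, finrank_bot, add_zero] at h2
  exact h2.symm

end Conj

section Coord

variable {m w : ℕ} {h : Fin (w + 1) → ℕ} {Q : Matrix (Fin m) (Fin m) ℝ} {H : Filtration m}
  {b : Basis (BlockIndex h) ℂ (Fin m → ℂ)} {X Y : BlockMatrix h}

theorem toLin_mul_apply' (x : Fin m → ℂ) :
    Matrix.toLin b b (X * Y) x = Matrix.toLin b b X (Matrix.toLin b b Y x) :=
  Matrix.toLin_mul_apply b b b X Y x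

theorem pairing_toLin (X : BlockMatrix h) (s t : BlockIndex h) :
    pairing Q (Matrix.toLin b b X (b s)) (Matrix.toLin b b X (b t)) = (Xᵀ * gram Q b * X) s t := by
  rw [Matrix.toLin_self, Matrix.toLin_self, ← pairingBilin_apply, map_sum, Matrix.mul_apply]
  refine Finset.sum_congr rfl fun r _ => ?_
  rw [map_smul, map_sum, LinearMap.sum_apply, Matrix.mul_apply, smul_eq_mul, mul_comm]
  congr 1
  refine Finset.sum_congr rfl fun q _ => ?_
  rw [map_smul, LinearMap.smul_apply, pairingBilin_apply]
  rfl

theorem forall_pairing_toLin_iff (hS : IsGradedForm (blockDeg h) w (gram Q b)) :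
    adj (gram Q b) X * X = 1 ↔
      ∀ x y, pairing Q (Matrix.toLin b b X x) (Matrix.toLin b b X y) = pairing Q x y := by
  rw [hS.adj_mul_eq_one_iff]
  constructor
  · intro hX
    have h1 : (pairingBilin Q).compl₁₂ (Matrix.toLin b b X) (Matrix.toLin b b X) =
        pairingBilin Q := by
      refine b.ext fun s => b.ext fun t => ?_
      rw [LinearMap.compl₁₂_apply, pairingBilin_apply, pairingBilin_apply, pairing_toLin, hX, gram]
    intro x y
    rw [← pairingBilin_apply, ← pairingBilin_apply]
    exact LinearMap.congr_fun₂ h1 x y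
  · intro hX
    ext s t
    rw [← pairing_toLin, hX, gram]

theorem mem_groupCoord_iff (hY : adj (gram Q b) Y * Y = 1) {p : ℕ} {x : Fin m → ℂ} :
    x ∈ groupCoord H b Y p ↔ Matrix.toLin b b (adj (gram Q b) Y) x ∈ H p := by
  constructor
  · rintro ⟨y, hy, rfl⟩
    rwa [← toLin_mul_apply', hY, Matrix.toLin_one]
  · intro hx
    refine ⟨_, hx, ?_⟩
    rw [← toLin_mul_apply', mul_eq_one_comm.1 hY, Matrix.toLin_one]
    rfl

theorem toLin_injective (hY : adj (gram Q b) Y * Y = 1) :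
    Function.Injective (Matrix.toLin b b Y) := by
  intro x y hxy
  have := congrArg (Matrix.toLin b b (adj (gram Q b) Y)) hxy
  rwa [← toLin_mul_apply', ← toLin_mul_apply', hY, Matrix.toLin_one] at this

theorem continuous_toLin_adj :
    Continuous fun z : BlockMatrix h × (Fin m → ℂ) =>
      Matrix.toLin b b (adj (gram Q b) z.1) z.2 := by
  have h1 : Continuous fun z : BlockMatrix h × (Fin m → ℂ) => b.equivFun z.2 :=
    (LinearMap.continuous_of_finiteDimensional
      (b.equivFun : (Fin m → ℂ) →ₗ[ℂ] (BlockIndex h → ℂ))).comp continuous_snd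
  have h2 : Continuous fun z : BlockMatrix h × (Fin m → ℂ) => adj (gram Q b) z.1 := by
    have : Continuous fun X : BlockMatrix h => (gram Q b)⁻¹ * Xᵀ * gram Q b :=
      (continuous_const.matrix_mul continuous_id.matrix_transpose).matrix_mul continuous_const
    exact this.comp continuous_fst
  have h3 := h2.matrix_mulVec h1
  have h4 : Continuous (b.equivFun.symm : (BlockIndex h → ℂ) → (Fin m → ℂ)) :=
    LinearMap.continuous_of_finiteDimensional
      (b.equivFun.symm : (BlockIndex h → ℂ) →ₗ[ℂ] (Fin m → ℂ))
  refine (h4.comp h3).congr fun z => ?_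
  rw [Function.comp_apply, LinearEquiv.symm_apply_eq]
  exact (repr_toLin (b := b) _ _).symm

theorem isClosed_toLin_adj_mem (S : Submodule ℂ (Fin m → ℂ)) :
    IsClosed {z : BlockMatrix h × (Fin m → ℂ) | Matrix.toLin b b (adj (gram Q b) z.1) z.2 ∈ S} :=
  S.closed_of_finiteDimensional.preimage continuous_toLin_adj

theorem isClosed_toLin_adj_star_mem (S : Submodule ℂ (Fin m → ℂ)) :
    IsClosed {z : BlockMatrix h × (Fin m → ℂ) |
      Matrix.toLin b b (adj (gram Q b) z.1) (star z.2) ∈ S} := by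
  have h1 : Continuous fun z : BlockMatrix h × (Fin m → ℂ) => (z.1, star z.2) :=
    continuous_fst.prodMk continuous_snd.star
  exact (isClosed_toLin_adj_mem (Q := Q) (b := b) S).preimage h1

theorem continuous_hodgeForm (p : ℕ) :
    Continuous fun x : Fin m → ℂ => (hodgeForm w Q p x x).re := by
  unfold hodgeForm pairing
  refine Complex.continuous_re.comp (continuous_const.mul ?_)
  exact Continuous.dotProduct continuous_id (continuous_const.matrix_mulVec continuous_id.star)

theorem hodgeForm_smul (p : ℕ) (r : ℝ) (x : Fin m → ℂ) :
    (hodgeForm w Q p ((r : ℂ) • x) ((r : ℂ) • x)).re = r * r * (hodgeForm w Q p x x).re := by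
  have h1 : hodgeForm w Q p ((r : ℂ) • x) ((r : ℂ) • x) =
      ((r * r : ℝ) : ℂ) * hodgeForm w Q p x x := by
    unfold hodgeForm pairing
    rw [star_smul, Matrix.mulVec_smul, smul_dotProduct, dotProduct_smul, smul_eq_mul, smul_eq_mul]
    simp only [Complex.star_def, Complex.conj_ofReal]
    push_cast
    ring
  rw [h1, Complex.re_ofReal_mul]

theorem exists_smul_mem_sphere {x : Fin m → ℂ} (hx : x ≠ 0) :
    ∃ r : ℝ, 0 < r ∧ (r : ℂ) • x ∈ Metric.sphere (0 : Fin m → ℂ) 1 := by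
  have h0 : 0 < ‖x‖ := norm_pos_iff.2 hx
  refine ⟨‖x‖⁻¹, inv_pos.2 h0, ?_⟩
  rw [mem_sphere_zero_iff_norm, norm_smul, Complex.norm_real, norm_inv, norm_norm,
    inv_mul_cancel₀ h0.ne']

/-- Elements of the group near a given one have transverse filtrations if this one does. -/
theorem eventually_disjoint {Y₀ : BlockMatrix h}
    (hY₀ : adj (gram Q b) Y₀ * Y₀ = 1) {p q : ℕ}
    (hd : Disjoint (groupCoord H b Y₀ p) (conjSubmodule (groupCoord H b Y₀ q))) :
    ∀ᶠ Y in 𝓝 Y₀, adj (gram Q b) Y * Y = 1 →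
      Disjoint (groupCoord H b Y p) (conjSubmodule (groupCoord H b Y q)) := by
  -- A common vector can be normalized to lie on the compact unit sphere, and being common is a
  -- closed condition on the pair of `Y` and `x`.
  have key : ∀ᶠ Y in 𝓝 Y₀, ∀ x ∈ Metric.sphere (0 : Fin m → ℂ) 1,
      ¬ (Matrix.toLin b b (adj (gram Q b) Y) x ∈ H p ∧
        Matrix.toLin b b (adj (gram Q b) Y) (star x) ∈ H q) := by
    refine (isCompact_sphere (0 : Fin m → ℂ) 1).eventually_forall_of_forall_eventually
      fun x hx => ?_
    refine ((isClosed_toLin_adj_mem (H p)).inter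
      (isClosed_toLin_adj_star_mem (H q))).isOpen_compl.mem_nhds ?_
    rintro ⟨h1, h2⟩
    have h3 : x ∈ groupCoord H b Y₀ p := (mem_groupCoord_iff hY₀).2 h1
    have h4 : star x ∈ groupCoord H b Y₀ q := (mem_groupCoord_iff hY₀).2 h2
    rw [Submodule.disjoint_def.1 hd x h3 h4] at hx
    simp at hx
  filter_upwards [key] with Y hY hYS
  refine Submodule.disjoint_def.2 fun x hx1 hx2 => ?_
  by_contra hx
  obtain ⟨r, hr, hrx⟩ := exists_smul_mem_sphere hx
  refine hY _ hrx ⟨(mem_groupCoord_iff hYS).1 (Submodule.smul_mem _ _ hx1),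
    (mem_groupCoord_iff hYS).1 ?_⟩
  exact Submodule.smul_mem (conjSubmodule _) _ hx2

/-- Compactness again: on the unit sphere, lying in the Hodge piece with nonpositive form is a
closed condition, and the form is homogeneous under positive scaling. -/
theorem eventually_hodgeForm_pos {Y₀ : BlockMatrix h} (hY₀ : adj (gram Q b) Y₀ * Y₀ = 1) {p : ℕ}
    (hpos : ∀ x ∈ hodgePiece w (groupCoord H b Y₀) p, x ≠ 0 → 0 < (hodgeForm w Q p x x).re) :
    ∀ᶠ Y in 𝓝 Y₀, adj (gram Q b) Y * Y = 1 →
      ∀ x ∈ hodgePiece w (groupCoord H b Y) p, x ≠ 0 → 0 < (hodgeForm w Q p x x).re := by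
  have key : ∀ᶠ Y in 𝓝 Y₀, ∀ x ∈ Metric.sphere (0 : Fin m → ℂ) 1,
      ¬ ((Matrix.toLin b b (adj (gram Q b) Y) x ∈ H p ∧
        Matrix.toLin b b (adj (gram Q b) Y) (star x) ∈ H (w - p)) ∧
          (hodgeForm w Q p x x).re ≤ 0) := by
    refine (isCompact_sphere (0 : Fin m → ℂ) 1).eventually_forall_of_forall_eventually
      fun x hx => ?_
    refine (((isClosed_toLin_adj_mem (H p)).inter (isClosed_toLin_adj_star_mem (H (w - p)))).inter
      (isClosed_le ((continuous_hodgeForm (w := w) (Q := Q) p).comp continuous_snd)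
        continuous_const)).isOpen_compl.mem_nhds ?_
    rintro ⟨⟨h1, h2⟩, h5⟩
    have h3 : x ∈ groupCoord H b Y₀ p := (mem_groupCoord_iff hY₀).2 h1
    have h4 : star x ∈ groupCoord H b Y₀ (w - p) := (mem_groupCoord_iff hY₀).2 h2
    refine (hpos x ⟨h3, h4⟩ ?_).not_ge h5
    rintro rfl
    simp at hx
  filter_upwards [key] with Y hY hYS x hx hx0
  obtain ⟨r, hr, hrx⟩ := exists_smul_mem_sphere hx0
  by_contra hle
  refine hY _ hrx ⟨⟨(mem_groupCoord_iff hYS).1 (Submodule.smul_mem _ _ hx.1),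
    (mem_groupCoord_iff hYS).1 ?_⟩, ?_⟩
  · exact Submodule.smul_mem (conjSubmodule _) _ hx.2
  · rw [hodgeForm_smul]
    exact mul_nonpos_of_nonneg_of_nonpos (mul_self_nonneg r) (not_lt.1 hle)

/-- Isotropy, the extreme terms and dimensions are carried over by the orthogonal automorphism `Y`.
Transversality and positivity involve conjugation and hold only near `Y₀`. -/
theorem eventually_groupCoord_mem (hS : IsGradedForm (blockDeg h) w (gram Q b))
    (hH : H ∈ periodDomain w h Q) {Y₀ : BlockMatrix h} (hY₀ : adj (gram Q b) Y₀ * Y₀ = 1)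
    (hD : groupCoord H b Y₀ ∈ periodDomain w h Q) :
    ∀ᶠ Y in 𝓝 Y₀, adj (gram Q b) Y * Y = 1 → groupCoord H b Y ∈ periodDomain w h Q := by
  have h1 := (Filter.eventually_all_finset (Finset.range (w + 2))).2 fun p hp =>
    eventually_disjoint hY₀ (hD.compl p (Nat.lt_succ_iff.1 (Finset.mem_range.1 hp))).disjoint
  have h2 := (Filter.eventually_all_finset (Finset.range (w + 1))).2 fun p hp =>
    eventually_hodgeForm_pos hY₀ (hD.pos p (Nat.lt_succ_iff.1 (Finset.mem_range.1 hp)))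
  filter_upwards [h1, h2] with Y h3 h4 hY
  have hinj := toLin_injective (b := b) hY
  have hanti : Antitone (groupCoord H b Y) := fun p q hpq => Submodule.map_mono (hH.anti hpq)
  have hcompl : ∀ p ≤ w + 1,
      IsCompl (groupCoord H b Y p) (conjSubmodule (groupCoord H b Y (w + 1 - p))) := by
    intro p hp
    refine (Submodule.isCompl_iff_disjoint _ _ ?_).2
      (h3 p (Finset.mem_range.2 (Nat.lt_succ_of_le hp)) hY)
    rw [groupCoord, groupCoord, finrank_map_of_injective hinj, finrank_conjSubmodule_map hinj,
      Submodule.finrank_add_eq_of_isCompl (hH.compl p hp)]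
  refine ⟨hanti, ?_, ?_, hcompl, ?_, ?_, ?_⟩
  · rw [groupCoord, hH.zero, Submodule.map_top, LinearMap.range_eq_top]
    exact LinearMap.surjective_of_injective hinj
  · rw [groupCoord, hH.last, Submodule.map_bot]
  · intro i
    have h5 := finrank_hodgePiece hanti (Nat.sub_le w i) hcompl
    have h6 := finrank_hodgePiece hH.anti (Nat.sub_le w i) hH.compl
    rw [groupCoord, groupCoord, finrank_map_of_injective hinj, finrank_map_of_injective hinj] at h5
    rw [← hH.dim i]
    omega
  · rintro p hp _ ⟨x, hx, rfl⟩ _ ⟨y, hy, rfl⟩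
    rw [(forall_pairing_toLin_iff hS).1 hY]
    exact hH.isotropic p hp x hx y hy
  · intro p hp
    exact h4 p (Finset.mem_range.2 (Nat.lt_succ_of_le hp)) hY

end Coord

/-! ### Factorization near the identity -/

section Factorization

variable {ι : Type*} {deg : ι → ℕ} {w : ℕ} {S X Y : Matrix ι ι ℂ}

/-- The strictly lower triangular part of a matrix. -/
def strictLower (deg : ι → ℕ) : Matrix ι ι ℂ →ₗ[ℂ] Matrix ι ι ℂ where
  toFun X := Matrix.of fun s t => if deg t < deg s then X s t else 0
  map_add' X Y := by ext s t; by_cases h : deg t < deg s <;> simp [h]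
  map_smul' c X := by ext s t; by_cases h : deg t < deg s <;> simp [h]

theorem strictLower_apply (X : Matrix ι ι ℂ) (s t : ι) :
    strictLower deg X s t = if deg t < deg s then X s t else 0 := rfl

theorem strictLower_mem (X : Matrix ι ι ℂ) : strictLower deg X ∈ lowerSub deg 1 := by
  intro s t hst
  rw [strictLower_apply, if_neg (by omega)]

theorem blockTriangular_sub_strictLower (X : Matrix ι ι ℂ) :
    (X - strictLower deg X).BlockTriangular deg := by
  intro s t hst
  rw [Matrix.sub_apply, strictLower_apply, if_pos hst, sub_self]

theorem differentiableAt_matrix_const {E : Type*} [NormedAddCommGroup E] [NormedSpace ℂ E]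
    (M : Matrix ι ι ℂ) (z : E) : DifferentiableAt ℂ (fun _ : E => M) z :=
  differentiableAt_const (F := ι → ι → ℂ) M

section Fintype

variable [Fintype ι]

theorem continuousAt_matrix {E : Type*} [NormedAddCommGroup E] [NormedSpace ℂ E]
    {Y : E → Matrix ι ι ℂ} {z : E} (hY : DifferentiableAt ℂ Y z) : ContinuousAt Y z :=
  continuousAt_pi.2 fun s => continuousAt_pi.2 fun t => (differentiableAt_matrix.1 hY s t).continuousAt

theorem differentiableAt_matrix_comp {E : Type*} [NormedAddCommGroup E] [NormedSpace ℂ E]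
    {ψ : Matrix ι ι ℂ → Matrix ι ι ℂ} {N : E → Matrix ι ι ℂ} {z : E}
    (hψ : DifferentiableAt ℂ ψ (N z)) (hN : DifferentiableAt ℂ N z) :
    DifferentiableAt ℂ (fun x => ψ (N x)) z :=
  (fderiv_matrix_comp (F := ι → ι → ℂ) hψ hN).1

end Fintype

variable [DecidableEq ι]

theorem eq_one_of_blockTriangular (hX : X - 1 ∈ lowerSub deg 1) (hX' : X.BlockTriangular deg) :
    X = 1 := by
  ext s t
  by_cases hst : deg t < deg s
  · rw [hX' hst, Matrix.one_apply_ne]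
    rintro rfl
    exact lt_irrefl _ hst
  · exact sub_eq_zero.1 (hX s t (by omega))

theorem strictLower_one : strictLower deg (1 : Matrix ι ι ℂ) = 0 := by
  ext s t
  rw [strictLower_apply]
  split_ifs with hst
  · refine Matrix.one_apply_ne ?_
    rintro rfl
    exact lt_irrefl _ hst
  · rfl

variable [Fintype ι]

theorem IsGradedForm.blockTriangular_adj (hS : IsGradedForm deg w S) (hX : X.BlockTriangular deg) :
    (adj S X).BlockTriangular deg := by
  intro s t hst
  rw [adj_apply, Matrix.mul_apply]
  refine Finset.sum_eq_zero fun c _ => ?_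
  by_cases hc : deg c + deg t = w
  · rw [Matrix.mul_apply, Finset.sum_eq_zero, zero_mul]
    intro a _
    by_cases ha : deg s + deg a = w
    · rw [Matrix.transpose_apply, hX (by omega), mul_zero]
    · rw [hS.inv_apply_eq_zero s a ha, zero_mul]
  · rw [hS.apply_eq_zero c t hc, mul_zero]

theorem blockTriangular_of_mul_eq_one (hX : X.BlockTriangular deg) (hXY : X * Y = 1) :
    Y.BlockTriangular deg := by
  have : Invertible X := ⟨Y, mul_eq_one_comm.1 hXY, hXY⟩
  rw [← Matrix.inv_eq_right_inv hXY]
  exact Matrix.blockTriangular_inv_of_blockTriangular hX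

/-- The unipotent factor of an element of the orthogonal group preserves the form. -/
theorem IsGradedForm.adj_mul_eq_one_of_factor (hS : IsGradedForm deg w S)
    (hX : X - 1 ∈ lowerSub deg 1) (hY : Y.BlockTriangular deg)
    (hXY : adj S (X * Y) * (X * Y) = 1) : adj S X * X = 1 := by
  have h1 : adj S Y * (adj S X * X * Y) = 1 := by
    rw [hS.adj_mul] at hXY
    rw [← hXY]
    simp only [mul_assoc]
  have h2 := blockTriangular_of_mul_eq_one (hS.blockTriangular_adj hY) h1
  have h3 : Y * adj S Y * (adj S X * X) = 1 := by
    have h4 : adj S X * X * Y * adj S Y = 1 := mul_eq_one_comm.1 h1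
    rw [mul_assoc _ Y] at h4
    exact mul_eq_one_comm.1 h4
  -- `adj S X * X` is lower unipotent, but it is also the inverse of the block triangular matrix `Y
  -- * adj S Y`; so it is `1`.
  exact eq_one_of_blockTriangular (mul_sub_one_mem (hS.adj_sub_one_mem hX) hX)
    (blockTriangular_of_mul_eq_one (hY.mul (hS.blockTriangular_adj hY)) h3)

/-- Near the identity, matrices are holomorphically the product of a unipotent matrix and of a
block triangular one. -/
theorem exists_factorization (deg : ι → ℕ) : ∃ ψ : Matrix ι ι ℂ → Matrix ι ι ℂ,
    ψ 1 = 1 ∧ ∀ᶠ X in 𝓝 1, DifferentiableAt ℂ ψ X ∧ ψ X - 1 ∈ lowerSub deg 1 ∧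
      ∃ U : Matrix ι ι ℂ, U.BlockTriangular deg ∧ ψ X * U = X := by
  let I : (ι → ι → ℂ) → Matrix ι ι ℂ := fun Z => Z
  -- One matrix `Z` encodes both factors: its strictly lower part gives the unipotent one, the rest
  -- the triangular one. The derivative at `1` is the identity, since the lower part of `A` is
  -- removed from one factor and restored by the other.
  let g : (ι → ι → ℂ) → Matrix ι ι ℂ := fun Z =>
    (1 + strictLower deg (I Z)) * (I Z - strictLower deg (I Z))
  have hid : ∀ Z, DifferentiableAt ℂ I Z :=
    fun Z => differentiableAt_id (𝕜 := ℂ) (E := ι → ι → ℂ)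
  have hlow : ∀ Z, DifferentiableAt ℂ (fun Z => strictLower deg (I Z)) Z :=
    fun Z => differentiableAt_linearMap_comp _ (hid Z)
  have hone : ∀ Z, DifferentiableAt ℂ (fun Z => 1 + strictLower deg (I Z)) Z := fun Z =>
    DifferentiableAt.const_add (F := ι → ι → ℂ) (1 : Matrix ι ι ℂ) (hlow Z)
  have hup : ∀ Z, DifferentiableAt ℂ (fun Z => I Z - strictLower deg (I Z)) Z := fun Z =>
    differentiableAt_matrix_sub (hid Z) (hlow Z)
  have hg : ∀ Z, DifferentiableAt ℂ g Z := fun Z => differentiableAt_matrix_mul (hone Z) (hup Z)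
  obtain ⟨e, he⟩ : ∃ e, I e = 1 := ⟨(1 : Matrix ι ι ℂ), rfl⟩
  have hg1 : g e = 1 := by
    simp only [g, he]
    rw [strictLower_one, add_zero, sub_zero, one_mul]
  have hg' : HasFDerivAt g (ContinuousLinearMap.id ℂ (ι → ι → ℂ)) e := by
    refine (hg _).hasFDerivAt.congr_fderiv ?_
    ext1 A
    refine (fderiv_matrix_mul (hone _) (hup _) A).trans ?_
    have h1 : fderiv ℂ I e A = I A :=
      congrArg (fun f => f A) (fderiv_id (𝕜 := ℂ) (E := ι → ι → ℂ) (x := e))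
    have h2 : fderiv ℂ (fun Z => strictLower deg (I Z)) e A = strictLower deg (I A) := by
      rw [fderiv_linearMap_comp_matrix _ (hid _), h1]
    have h3 : fderiv ℂ (fun Z => 1 + strictLower deg (I Z)) e A = strictLower deg (I A) := by
      rw [← h2]
      exact congrArg (fun f => f A) (fderiv_const_add (𝕜 := ℂ) (F := ι → ι → ℂ)
        (f := fun Z => strictLower deg (I Z)) (x := e) (1 : Matrix ι ι ℂ))
    rw [fderiv_matrix_sub (hid _) (hlow _), h1, h2, h3, he, strictLower_one, add_zero, sub_zero,
      one_mul, mul_one]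
    exact sub_add_cancel _ _
  obtain ⟨ψ, h1, h2, h3⟩ : ∃ ψ : Matrix ι ι ℂ → Matrix ι ι ℂ, ψ (g e) = I e ∧
      (∀ᶠ X in 𝓝 (g e), (1 + strictLower deg (ψ X)) * (ψ X - strictLower deg (ψ X)) = X) ∧
      ∀ᶠ X in 𝓝 (g e), DifferentiableAt ℂ ψ X := by
    obtain ⟨ψ, h1, h2, h3⟩ := exists_holomorphic_inverse (Filter.Eventually.of_forall hg) hg'
    exact ⟨ψ, h1.self_of_nhds, h2, h3⟩
  rw [hg1] at h1 h2 h3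
  refine ⟨fun Z => 1 + strictLower deg (ψ Z), ?_, ?_⟩
  · change 1 + strictLower deg (ψ 1) = 1
    rw [h1, he, strictLower_one, add_zero]
  · filter_upwards [h2, h3] with X hX hX'
    refine ⟨DifferentiableAt.const_add (F := ι → ι → ℂ) (1 : Matrix ι ι ℂ)
      (differentiableAt_linearMap_comp (E := ι → ι → ℂ) _ hX'), ?_,
      ψ X - strictLower deg (ψ X), blockTriangular_sub_strictLower _, hX⟩
    rw [add_sub_cancel_left]
    exact strictLower_mem _

end Factorization

/-! ### Horizontal germs and germs in the group -/

section Horizontal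

variable {m w : ℕ} {h : Fin (w + 1) → ℕ} {Q : Matrix (Fin m) (Fin m) ℝ} {H : Filtration m}
  {b : Basis (BlockIndex h) ℂ (Fin m → ℂ)} {X Y : BlockMatrix h}

/-- The matrix in a frame of an endomorphism of `ℂ^m`. -/
def inFrame (b : Basis (BlockIndex h) ℂ (Fin m → ℂ)) :
    Matrix (Fin m) (Fin m) ℂ ≃ₗ[ℂ] BlockMatrix h :=
  Matrix.toLin'.trans (LinearMap.toMatrix b b)

theorem toLin_inFrame (g : Matrix (Fin m) (Fin m) ℂ) (x : Fin m → ℂ) :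
    Matrix.toLin b b (inFrame b g) x = g *ᵥ x := by
  rw [inFrame, LinearEquiv.trans_apply, Matrix.toLin_toMatrix, Matrix.toLin'_apply]

theorem inFrame_one : inFrame b 1 = 1 := by
  rw [inFrame, LinearEquiv.trans_apply, Matrix.toLin'_one, LinearMap.toMatrix_id]

theorem mem_orthogonalSet_iff (hS : IsGradedForm (blockDeg h) w (gram Q b))
    {g : Matrix (Fin m) (Fin m) ℂ} :
    g ∈ orthogonalSet Q ↔ adj (gram Q b) (inFrame b g) * inFrame b g = 1 := by
  rw [forall_pairing_toLin_iff hS]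
  have h1 : ∀ x y, pairing Q (g *ᵥ x) (g *ᵥ y) = x ⬝ᵥ ((gᵀ * Q.map ((↑) : ℝ → ℂ) * g) *ᵥ y) := by
    intro x y
    rw [pairing, ← Matrix.mulVec_mulVec, ← Matrix.mulVec_mulVec, Matrix.dotProduct_mulVec x,
      Matrix.vecMul_transpose]
  simp only [toLin_inFrame, h1]
  constructor
  · intro hg x y
    rw [show gᵀ * Q.map ((↑) : ℝ → ℂ) * g = _ from hg, pairing]
  · intro hg
    change gᵀ * Q.map ((↑) : ℝ → ℂ) * g = Q.map ((↑) : ℝ → ℂ)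
    ext i j
    have := hg (Pi.single i 1) (Pi.single j 1)
    simpa [pairing] using this

variable (hb : IsHodgeFrame Q H b) (hH : IsPolarizedHodgeFiltration w h Q H)
  (hS : IsGradedForm (blockDeg h) w (gram Q b))

include hb hH in
theorem forall_toLin_mem_iff_blockTriangular :
    (∀ p, ∀ x ∈ H p, Matrix.toLin b b X x ∈ H p) ↔ X.BlockTriangular (blockDeg h) :=
  hb.forall_toLin_mem_iff hH (e := 0)

include hb hH hS in
theorem groupCoord_of_blockTriangular (hX : X.BlockTriangular (blockDeg h))
    (hX1 : adj (gram Q b) X * X = 1) : groupCoord H b X = H := by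
  funext p
  ext x
  rw [mem_groupCoord_iff hX1]
  constructor
  · intro hx
    have := (forall_toLin_mem_iff_blockTriangular hb hH).2 hX p _ hx
    rwa [← toLin_mul_apply', mul_eq_one_comm.1 hX1, Matrix.toLin_one] at this
  · exact (forall_toLin_mem_iff_blockTriangular hb hH).2 (hS.blockTriangular_adj hX) p x

theorem groupCoord_mul (X Y : BlockMatrix h) (p : ℕ) :
    groupCoord H b (X * Y) p = (groupCoord H b Y p).map (Matrix.toLin b b X) := by
  rw [groupCoord, groupCoord, Matrix.toLin_mul b b b, Submodule.map_comp]

include hb hH hS in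
/-- Lie group coordinates are injective. -/
theorem groupCoord_injOn : Set.InjOn (groupCoord H b) (gradedGroup (blockDeg h) (gram Q b)) := by
  intro X hX Y hY hXY
  have h1 : adj (gram Q b) Y * X = 1 := by
    refine eq_one_of_blockTriangular (mul_sub_one_mem (hS.adj_sub_one_mem hY.1) hX.1) ?_
    refine (forall_toLin_mem_iff_blockTriangular hb hH).1 fun p x hx => ?_
    rw [toLin_mul_apply', ← mem_groupCoord_iff hY.2, ← hXY]
    exact Submodule.mem_map_of_mem hx
  calc X = Y * (adj (gram Q b) Y * X) := by rw [← mul_assoc, mul_eq_one_comm.1 hY.2, one_mul]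
    _ = Y := by rw [h1, mul_one]

include hb hH hS in
/-- Holomorphic maps to the period domain lift locally to the group. -/
theorem exists_group_lift {E : Type*} [NormedAddCommGroup E] [NormedSpace ℂ E] {Y₀ : BlockMatrix h}
    (hY₀ : Y₀ ∈ gradedGroup (blockDeg h) (gram Q b)) {f : E → Filtration m}
    (hf0 : f 0 = groupCoord H b Y₀) {g : E → Matrix (Fin m) (Fin m) ℂ} (hg0 : g 0 = 1)
    (hg : ∀ᶠ z in 𝓝 0, DifferentiableAt ℂ g z ∧ g z ∈ orthogonalSet Q ∧
      ∀ p, f z p = (f 0 p).map (g z).mulVecLin) :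
    ∃ Y : E → BlockMatrix h, Y 0 = Y₀ ∧ ∀ᶠ z in 𝓝 0, DifferentiableAt ℂ Y z ∧
      Y z ∈ gradedGroup (blockDeg h) (gram Q b) ∧ f z = groupCoord H b (Y z) := by
  obtain ⟨ψ, hψ1, hψ⟩ := exists_factorization (blockDeg h)
  -- This moves the base point to `1`: in the frame, `g Y₀ = Y₀ N`. Factoring `N = ψ(N) U` with `U`
  -- stabilizing `H` yields `g Y₀ H = Y₀ ψ(N) H`.
  let N : E → BlockMatrix h := fun z => adj (gram Q b) Y₀ * inFrame b (g z) * Y₀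
  have hN0 : N 0 = 1 := by
    change adj (gram Q b) Y₀ * inFrame b (g 0) * Y₀ = 1
    rw [hg0, inFrame_one, mul_one, hY₀.2]
  have hNd : ∀ z, DifferentiableAt ℂ g z → DifferentiableAt ℂ N z := by
    intro z hz
    exact differentiableAt_matrix_mul (differentiableAt_matrix_mul
      (differentiableAt_matrix_const _ z)
      (differentiableAt_linearMap_comp (inFrame b).toLinearMap hz))
      (differentiableAt_matrix_const _ z)
  have hNlim : Tendsto N (𝓝 0) (𝓝 1) := by
    have : ContinuousAt N 0 := continuousAt_matrix (hNd 0 hg.self_of_nhds.1)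
    rw [← hN0]
    exact this
  refine ⟨fun z => Y₀ * ψ (N z), ?_, ?_⟩
  · change Y₀ * ψ (N 0) = Y₀
    rw [hN0, hψ1, mul_one]
  · filter_upwards [hg, hNlim.eventually hψ] with z ⟨h1, h2, h3⟩ ⟨h4, h5, U, h6, h7⟩
    have hgS := (mem_orthogonalSet_iff hS).1 h2
    have hN : adj (gram Q b) (N z) * N z = 1 := by
      have h8 := mul_eq_one_comm.1 hY₀.2
      simp only [N, hS.adj_mul, hS.adj_adj]
      calc adj (gram Q b) Y₀ * (adj (gram Q b) (inFrame b (g z)) * Y₀) *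
            (adj (gram Q b) Y₀ * inFrame b (g z) * Y₀)
          = adj (gram Q b) Y₀ * (adj (gram Q b) (inFrame b (g z)) * ((Y₀ * adj (gram Q b) Y₀) *
            (inFrame b (g z) * Y₀))) := by simp only [mul_assoc]
        _ = adj (gram Q b) Y₀ * ((adj (gram Q b) (inFrame b (g z)) * inFrame b (g z)) * Y₀) := by
            rw [h8, one_mul, mul_assoc]
        _ = 1 := by rw [hgS, one_mul, hY₀.2]
    have hψS : adj (gram Q b) (ψ (N z)) * ψ (N z) = 1 :=
      hS.adj_mul_eq_one_of_factor h5 h6 (by rw [h7, hN])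
    have hψG : ψ (N z) ∈ gradedGroup (blockDeg h) (gram Q b) := ⟨h5, hψS⟩
    have hUS : adj (gram Q b) U * U = 1 := by
      rw [← hN, ← h7, hS.adj_mul, mul_assoc, ← mul_assoc (adj _ (ψ _)), hψS, one_mul]
    refine ⟨?_, hS.mul_mem hY₀ hψG, ?_⟩
    · exact differentiableAt_matrix_mul (differentiableAt_matrix_const _ z)
        (differentiableAt_matrix_comp h4 (hNd z h1))
    · have h8 : inFrame b (g z) * Y₀ = Y₀ * ψ (N z) * U := by
        rw [mul_assoc, h7, ← mul_assoc, ← mul_assoc, mul_eq_one_comm.1 hY₀.2, one_mul]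
      have h9 : Matrix.toLin b b (inFrame b (g z)) = (g z).mulVecLin :=
        LinearMap.ext fun x => toLin_inFrame (g z) x
      funext p
      rw [h3, hf0, ← h9, ← groupCoord_mul, h8, groupCoord_mul,
        groupCoord_of_blockTriangular hb hH hS h6 hUS]
      rfl

include hb hH in
/-- The derivative of a lift of a map to the period domain, in terms of the derivative of its Lie
group coordinates. -/
theorem exists_fderiv_lift_eq {k : ℕ} {f : (Fin k → ℂ) → Filtration m} {z : Fin k → ℂ}
    {Y : (Fin k → ℂ) → BlockMatrix h}
    (hY : ∀ᶠ x in 𝓝 z, DifferentiableAt ℂ Y x ∧ Y x ∈ gradedGroup (blockDeg h) (gram Q b) ∧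
      f x = groupCoord H b (Y x))
    {g : (Fin k → ℂ) → Matrix (Fin m) (Fin m) ℂ} (hg : IsLiftAt Q f z g) (v : Fin k → ℂ) :
    ∃ P : BlockMatrix h, P.BlockTriangular (blockDeg h) ∧
      inFrame b (fderiv ℂ g z v) * Y z = Y z * P + fderiv ℂ Y z v := by
  obtain ⟨hg1, hg⟩ := hg
  have hYz := hY.self_of_nhds
  have hc := fun M : BlockMatrix h => differentiableAt_matrix_const M z
  have hcd : ∀ M : BlockMatrix h, fderiv ℂ (fun _ : Fin k → ℂ => M) z v = 0 := by
    intro M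
    have : fderiv ℂ (fun _ : Fin k → ℂ => M) z = 0 :=
      fderiv_const_apply (F := BlockIndex h → BlockIndex h → ℂ) M
    rw [this]
    rfl
  have hgd := hg.self_of_nhds.1
  have hgf : DifferentiableAt ℂ (fun x => inFrame b (g x)) z :=
    differentiableAt_linearMap_comp (inFrame b).toLinearMap hgd
  have hgf' : fderiv ℂ (fun x => inFrame b (g x)) z v = inFrame b (fderiv ℂ g z v) :=
    fderiv_linearMap_comp_matrix (inFrame b).toLinearMap hgd v
  have hL : DifferentiableAt ℂ (fun x => inFrame b (g x) * Y z) z :=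
    differentiableAt_matrix_mul hgf (hc _)
  -- Both `g(x) Y(z)` and `Y(x)` carry `H` to `f x`, so their quotient `R` stabilizes `H` and is
  -- block triangular. The claim is the derivative of `g Y(z) = Y R` at `z`, where `R = 1`.
  let R : (Fin k → ℂ) → BlockMatrix h := fun x =>
    adj (gram Q b) (Y x) * (inFrame b (g x) * Y z)
  have hRd : DifferentiableAt ℂ R z :=
    differentiableAt_matrix_mul (differentiableAt_linearMap_comp _ hYz.1) hL
  have hRz : R z = 1 := by
    change adj (gram Q b) (Y z) * (inFrame b (g z) * Y z) = 1
    rw [hg1, inFrame_one, one_mul, hYz.2.1.2]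
  have hR : ∀ᶠ x in 𝓝 z, (R x).BlockTriangular (blockDeg h) := by
    filter_upwards [hY, hg] with x ⟨_, h2, h3⟩ ⟨_, _, h6⟩
    refine (forall_toLin_mem_iff_blockTriangular hb hH).1 fun p y hy => ?_
    rw [toLin_mul_apply', ← mem_groupCoord_iff h2.2, ← h3, h6, toLin_mul_apply', toLin_inFrame]
    refine Submodule.mem_map_of_mem (f := (g x).mulVecLin) ?_
    rw [hYz.2.2]
    exact Submodule.mem_map_of_mem hy
  have heq : (fun x => inFrame b (g x) * Y z) =ᶠ[𝓝 z] fun x => Y x * R x := by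
    filter_upwards [hY] with x ⟨_, h2, _⟩
    rw [← mul_assoc, mul_eq_one_comm.1 h2.2, one_mul]
  have h1 := fderiv_matrix_mul hYz.1 hRd v
  rw [← heq.fderiv_eq, fderiv_matrix_mul hgf (hc _), hcd, mul_zero, zero_add, hgf', hRz,
    mul_one] at h1
  refine ⟨fderiv ℂ R z v, fun s t hst => ?_, h1⟩
  rw [← fderiv_matrix_apply hRd]
  have h2 : (fun x => R x s t) =ᶠ[𝓝 z] fun _ => 0 := by
    filter_upwards [hR] with x hx using hx hst
  rw [h2.fderiv_eq]
  simp

-- Here `Y⁻¹ D Y = P + Y⁻¹ A` and `P` preserves `H`. The case `e = 1` expresses horizontality, and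
-- `e = 0` expresses triviality of the tangent vector.
include hb hH in
theorem forall_mulVec_mem_groupCoord_iff (hY : Y ∈ gradedGroup (blockDeg h) (gram Q b))
    {D : Matrix (Fin m) (Fin m) ℂ} {P A : BlockMatrix h} (hP : P.BlockTriangular (blockDeg h))
    (hD : inFrame b D * Y = Y * P + A) (e : ℕ) :
    (∀ p, ∀ x ∈ groupCoord H b Y (p + e), D *ᵥ x ∈ groupCoord H b Y p) ↔
      ∀ s t, blockDeg h t + e < blockDeg h s → (adj (gram Q b) Y * A) s t = 0 := by
  have h1 : ∀ X : BlockMatrix h, (∀ s t, blockDeg h t + e < blockDeg h s → (P + X) s t = 0) ↔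
      ∀ s t, blockDeg h t + e < blockDeg h s → X s t = 0 := by
    intro X
    refine forall_congr' fun s => forall_congr' fun t => forall_congr' fun hst => ?_
    rw [Matrix.add_apply, hP (show blockDeg h t < blockDeg h s by omega), zero_add]
  rw [← h1, ← hb.forall_toLin_mem_iff hH]
  have h2 : P + adj (gram Q b) Y * A = adj (gram Q b) Y * (inFrame b D * Y) := by
    rw [hD, mul_add, ← mul_assoc, hY.2, one_mul]
  rw [h2]
  refine forall_congr' fun p => ?_
  constructor
  · intro hp x hx
    rw [toLin_mul_apply', ← mem_groupCoord_iff hY.2, toLin_mul_apply', toLin_inFrame]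
    exact hp _ (Submodule.mem_map_of_mem hx)
  · rintro hp _ ⟨x, hx, rfl⟩
    have := hp x hx
    rwa [toLin_mul_apply', ← mem_groupCoord_iff hY.2, toLin_mul_apply', toLin_inFrame] at this

-- `Y⁻¹ A` starts in degree one; without higher components it equals its degree one part, which is
-- that of `A`.
include hS in
theorem eq_mul_gradedPart_iff {A : BlockMatrix h} (hY : Y ∈ gradedGroup (blockDeg h) (gram Q b))
    (hA : A ∈ lowerSub (blockDeg h) 1) :
    (∀ s t, blockDeg h t + 1 < blockDeg h s → (adj (gram Q b) Y * A) s t = 0) ↔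
      A = Y * gradedPart (blockDeg h) 1 A := by
  have hA' : adj (gram Q b) Y * A ∈ lowerSub (blockDeg h) 1 := by
    simpa using mul_mem_lowerSub (mem_lowerSub_zero (hS.adj_sub_one_mem hY.1)) hA
  have hYA : A = Y * (adj (gram Q b) Y * A) := by rw [← mul_assoc, mul_eq_one_comm.1 hY.2, one_mul]
  constructor
  · intro h1
    have h2 : adj (gram Q b) Y * A = gradedPart (blockDeg h) 1 (adj (gram Q b) Y * A) := by
      ext s t
      rw [gradedPart_apply]
      split_ifs with hst
      · rfl
      · rcases lt_or_gt_of_ne hst with h3 | h3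
        · exact hA' s t h3
        · exact h1 s t h3
    rw [gradedPart_mul_left (hS.adj_sub_one_mem hY.1) hA] at h2
    rw [← h2]
    exact hYA
  · intro h1 s t hst
    have h2 : adj (gram Q b) Y * A = gradedPart (blockDeg h) 1 A := by
      conv_lhs => rw [h1, ← mul_assoc, hY.2, one_mul]
    rw [h2, gradedPart_apply, if_neg (by omega)]

include hb hH hS in
/-- Horizontal immersions in Lie group coordinates. -/
theorem isHorizontalImmersionAt_iff {k : ℕ} {f : (Fin k → ℂ) → Filtration m} {z : Fin k → ℂ}
    {Y : (Fin k → ℂ) → BlockMatrix h}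
    (hY : ∀ᶠ x in 𝓝 z, DifferentiableAt ℂ Y x ∧ Y x ∈ gradedGroup (blockDeg h) (gram Q b) ∧
      f x = groupCoord H b (Y x)) :
    IsHorizontalImmersionAt Q f z ↔
      (∀ v, fderiv ℂ Y z v = Y z * gradedPart (blockDeg h) 1 (fderiv ℂ Y z v)) ∧
        Function.Injective (fderiv ℂ Y z) := by
  obtain ⟨hYd, hYG, hYf⟩ := hY.self_of_nhds
  have hA : ∀ v, fderiv ℂ Y z v ∈ lowerSub (blockDeg h) 1 :=
    fderiv_mem_lowerSub_one hYd (hY.mono fun x hx => hx.2.1.1)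
  have key : ∀ g, IsLiftAt Q f z g →
      (((∀ v p, ∀ x ∈ f z (p + 1), (fderiv ℂ g z v) *ᵥ x ∈ f z p) ↔
        ∀ v, fderiv ℂ Y z v = Y z * gradedPart (blockDeg h) 1 (fderiv ℂ Y z v)) ∧
      ((∀ v, (∀ p, ∀ x ∈ f z p, (fderiv ℂ g z v) *ᵥ x ∈ f z p) → v = 0) ↔
        Function.Injective (fderiv ℂ Y z))) := by
    intro g hg
    rw [hYf]
    refine ⟨forall_congr' fun v => ?_, ?_⟩
    · obtain ⟨P, hP, hD⟩ := exists_fderiv_lift_eq hb hH hY hg v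
      rw [forall_mulVec_mem_groupCoord_iff hb hH hYG hP hD, eq_mul_gradedPart_iff hS hYG (hA v)]
    · rw [injective_iff_map_eq_zero]
      refine forall_congr' fun v => ?_
      obtain ⟨P, hP, hD⟩ := exists_fderiv_lift_eq hb hH hY hg v
      have h1 := forall_mulVec_mem_groupCoord_iff hb hH hYG hP hD 0
      simp only [add_zero] at h1
      rw [h1]
      refine imp_congr_left ?_
      have hA' : adj (gram Q b) (Y z) * fderiv ℂ Y z v ∈ lowerSub (blockDeg h) 1 := by
        simpa using mul_mem_lowerSub (mem_lowerSub_zero (hS.adj_sub_one_mem hYG.1)) (hA v)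
      constructor
      · intro h2
        have h3 : adj (gram Q b) (Y z) * fderiv ℂ Y z v = 0 := by
          ext s t
          by_cases hst : blockDeg h t < blockDeg h s
          · exact h2 s t hst
          · exact hA' s t (by omega)
        calc fderiv ℂ Y z v = Y z * (adj (gram Q b) (Y z) * fderiv ℂ Y z v) := by
              rw [← mul_assoc, mul_eq_one_comm.1 hYG.2, one_mul]
          _ = 0 := by rw [h3, mul_zero]
      · intro h2 s t _
        rw [h2, mul_zero]
        rfl
  constructor
  · rintro ⟨g, hg, h1, h2⟩
    exact ⟨(key g hg).1.1 h1, (key g hg).2.1 h2⟩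
  · rintro ⟨h1, h2⟩
    -- The group coordinates themselves provide a lift normalized at `z`, namely `Y(x) Y(z)⁻¹`.
    suffices hg : IsLiftAt Q f z fun x => (inFrame b).symm (Y x * adj (gram Q b) (Y z)) from
      ⟨_, hg, (key _ hg).1.2 h1, (key _ hg).2.2 h2⟩
    refine ⟨?_, ?_⟩
    · rw [LinearEquiv.symm_apply_eq, inFrame_one, mul_eq_one_comm.1 hYG.2]
    · filter_upwards [hY] with x ⟨h3, h4, h5⟩
      refine ⟨differentiableAt_linearMap_comp (inFrame b).symm.toLinearMap
        (differentiableAt_matrix_mul h3 (differentiableAt_matrix_const _ x)), ?_, fun p => ?_⟩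
      · rw [mem_orthogonalSet_iff hS, LinearEquiv.apply_symm_apply]
        exact (hS.mul_mem h4 (hS.adj_mem hYG)).2
      · have h9 : Matrix.toLin b b (Y x * adj (gram Q b) (Y z)) =
            ((inFrame b).symm (Y x * adj (gram Q b) (Y z))).mulVecLin := by
          refine LinearMap.ext fun y => ?_
          rw [Matrix.mulVecLin_apply, ← toLin_inFrame (b := b), LinearEquiv.apply_symm_apply]
        rw [← h9, hYf, ← groupCoord_mul, mul_assoc, hYG.2, mul_one, h5]

include hb hH hS in
theorem IsGroupGerm.isHorizontalGerm {Y₀ : BlockMatrix h}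
    (hY₀ : Y₀ ∈ gradedGroup (blockDeg h) (gram Q b)) (hD : groupCoord H b Y₀ ∈ periodDomain w h Q)
    {k : ℕ} {𝓩 : Filter (BlockMatrix h)} (h𝓩 : IsGroupGerm (gram Q b) Y₀ k 𝓩) :
    IsHorizontalGerm w h Q (groupCoord H b Y₀) k (map (groupCoord H b) 𝓩) := by
  obtain ⟨Y, hY, rfl⟩ := h𝓩
  refine ⟨fun z => groupCoord H b (Y z), congrArg _ hY.zero, ?_, Filter.map_map⟩
  have hlim : Tendsto Y (𝓝 0) (𝓝 Y₀) := by
    have : ContinuousAt Y 0 := continuousAt_matrix hY.diff.self_of_nhds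
    rw [← hY.zero]
    exact this
  filter_upwards [hlim.eventually (eventually_groupCoord_mem hS hH hY₀.2 hD), hY.mem,
    (hY.diff.and hY.mem).eventually_nhds, hY.fderiv_eq, hY.immersion] with z h1 h2 h3 h4 h5
  exact ⟨h1 h2.2, (isHorizontalImmersionAt_iff hb hH hS
    (h3.mono fun x hx => ⟨hx.1, hx.2, rfl⟩)).2 ⟨h4, h5⟩⟩

include hb hH hS in
theorem IsHorizontalGerm.exists_isGroupGerm {Y₀ : BlockMatrix h}
    (hY₀ : Y₀ ∈ gradedGroup (blockDeg h) (gram Q b)) {k : ℕ} {𝓖 : Filter (Filtration m)}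
    (h𝓖 : IsHorizontalGerm w h Q (groupCoord H b Y₀) k 𝓖) :
    ∃ 𝓩, IsGroupGerm (gram Q b) Y₀ k 𝓩 ∧ map (groupCoord H b) 𝓩 = 𝓖 := by
  obtain ⟨f, hf0, hf, rfl⟩ := h𝓖
  obtain ⟨g, ⟨hg1, hg⟩, -⟩ := hf.self_of_nhds.2
  obtain ⟨Y, hY0, hY⟩ := exists_group_lift hb hH hS hY₀ hf0 hg1 hg
  have h1 : ∀ᶠ z in 𝓝 0,
      (∀ v, fderiv ℂ Y z v = Y z * gradedPart (blockDeg h) 1 (fderiv ℂ Y z v)) ∧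
        Function.Injective (fderiv ℂ Y z) := by
    filter_upwards [hf, hY.eventually_nhds] with z hz hYz
    exact (isHorizontalImmersionAt_iff hb hH hS hYz).1 hz.2
  refine ⟨map Y (𝓝 0), ⟨Y, ⟨hY0, hY.mono fun z hz => hz.1, hY.mono fun z hz => hz.2.1,
    h1.mono fun z hz => hz.1, h1.mono fun z hz => hz.2⟩, rfl⟩, ?_⟩
  rw [Filter.map_map]
  exact Filter.map_congr (hY.mono fun z hz => hz.2.2.symm)

end Horizontal

/-! ### Curves in the group -/

section Curves

variable {ι : Type*} [Fintype ι] [DecidableEq ι] {deg : ι → ℕ} {w : ℕ} {S : Matrix ι ι ℂ}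

theorem hasDerivAt_quadratic (X Z : Matrix ι ι ℂ) (t : ℂ) :
    HasDerivAt (fun t : ℂ => 1 + t • X + (t ^ 2 / 2) • Z) (X + t • Z) t := by
  let X' : ι → ι → ℂ := X
  let Z' : ι → ι → ℂ := Z
  let e : ι → ι → ℂ := (1 : Matrix ι ι ℂ)
  have h1 : HasDerivAt (fun t : ℂ => e + t • X' + (t ^ 2 / 2) • Z') (X' + t • Z') t := by
    have h2 : HasDerivAt (fun t : ℂ => e + t • X' + (t ^ 2 / 2) • Z') _ t :=
      (((hasDerivAt_id' t).smul_const X').const_add e).fun_add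
        (((hasDerivAt_pow 2 t).div_const 2).smul_const Z')
    exact h2.congr_deriv (by simp)
  exact h1

/-- The group contains curves through its identity in the direction of every matrix of degree one
in its Lie algebra. -/
theorem exists_curve_one (hS : IsGradedForm deg w S) {X : Matrix ι ι ℂ}
    (hX : gradedPart deg 1 X = X) (hXadj : adj S X = -X) :
    ∃ γ : ℂ → Matrix ι ι ℂ, γ 0 = 1 ∧
      (∀ᶠ t in 𝓝 0, DifferentiableAt ℂ γ t ∧ γ t ∈ gradedGroup deg S) ∧ deriv γ 0 = X := by
  have hX1 : X ∈ lowerSub deg 1 := hX ▸ gradedPart_mem X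
  have hX2 : X * X ∈ lowerSub deg 2 := mul_mem_lowerSub hX1 hX1
  have hX3 : X * X * X ∈ lowerSub deg 3 := mul_mem_lowerSub hX2 hX1
  -- This is the part of degree at most two of `exp (t X)`. It solves the contact system with `ω = X
  -- dt`, and its defect `(t ^ 4 / 4) X⁴` has degree at least four, so it lifts to the group.
  let T : ℂ → Matrix ι ι ℂ := fun t => 1 + t • X + (t ^ 2 / 2) • (X * X)
  have hT : ∀ t, HasDerivAt T (X + t • (X * X)) t := hasDerivAt_quadratic X (X * X)
  have hT1 : ∀ t, T t - 1 ∈ lowerSub deg 1 := by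
    intro t
    have : T t - 1 = t • X + (t ^ 2 / 2) • (X * X) := by simp only [T]; abel
    rw [this]
    exact add_mem (Submodule.smul_mem _ _ hX1)
      (Submodule.smul_mem _ _ (lowerSub_anti (by omega) hX2))
  have hdT : ∀ t v, fderiv ℂ T t v = v • (X + t • (X * X)) := by
    intro t v
    rw [(hT t).hasFDerivAt.fderiv]
    rfl
  have hgr : ∀ t v, gradedPart deg 1 (fderiv ℂ T t v) = v • X := by
    intro t v
    rw [hdT, map_smul, map_add, map_smul, hX, gradedPart_eq_zero hX2 (by omega), smul_zero,
      add_zero]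
  obtain ⟨Y, hY0, hY⟩ := exists_lift (T := T) hS hS.one_mem (by simp [T]) (by
    refine Filter.Eventually.of_forall fun t => ⟨(hT t).hasFDerivAt.differentiableAt, hT1 t, ?_, fun v => ?_⟩
    · have h1 : adj S (T t) = 1 - t • X + (t ^ 2 / 2) • (X * X) := by
        simp only [T, map_add, map_smul, hS.adj_one, hS.adj_mul, hXadj]
        rw [neg_mul_neg, smul_neg, sub_eq_add_neg]
      have h2 : adj S (T t) * T t - 1 = (t ^ 4 / 4) • (X * X * X * X) := by
        rw [h1]
        simp only [T, mul_add, add_mul, sub_mul, mul_one, one_mul, Matrix.smul_mul,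
          Matrix.mul_smul, ← mul_assoc]
        module
      rw [h2]
      exact Submodule.smul_mem _ _ (lowerSub_anti (by omega) (mul_mem_lowerSub hX3 hX1))
    · rw [hgr, hdT]
      have h3 : T t * (v • X) = v • (X + t • (X * X)) + (v * (t ^ 2 / 2)) • (X * X * X) := by
        simp only [T, add_mul, one_mul, Matrix.smul_mul, Matrix.mul_smul]
        module
      rw [h3, map_add, map_smul _ (v * _), gradedPart_eq_zero hX3 (by omega), smul_zero, add_zero])
  refine ⟨Y, hY0, hY.mono fun t ht => ⟨ht.1, ht.2.1⟩, ?_⟩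
  change fderiv ℂ Y 0 1 = X
  rw [hY.self_of_nhds.2.2.2, hgr, hY0, one_mul, one_smul]

theorem exists_curve (hS : IsGradedForm deg w S) {Y X : Matrix ι ι ℂ} (hY : Y ∈ gradedGroup deg S)
    (hX : gradedPart deg 1 X = X) (hXadj : adj S X = -X) :
    ∃ γ : ℂ → Matrix ι ι ℂ, γ 0 = Y ∧
      (∀ᶠ t in 𝓝 0, DifferentiableAt ℂ γ t ∧ γ t ∈ gradedGroup deg S) ∧ deriv γ 0 = Y * X := by
  obtain ⟨γ, h0, hγ, hd⟩ := exists_curve_one hS hX hXadj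
  have hc := fun t : ℂ => differentiableAt_matrix_const Y t
  refine ⟨fun t => Y * γ t, by simp only [h0, mul_one], ?_, ?_⟩
  · filter_upwards [hγ] with t ht
    exact ⟨differentiableAt_matrix_mul (hc t) ht.1, hS.mul_mem hY ht.2⟩
  · change fderiv ℂ (fun t => Y * γ t) 0 1 = Y * X
    rw [fderiv_matrix_mul (hc 0) hγ.self_of_nhds.1, show fderiv ℂ γ 0 1 = X from hd]
    have : fderiv ℂ (fun _ : ℂ => Y) 0 = 0 := fderiv_const_apply (F := ι → ι → ℂ) Y
    rw [this, _root_.zero_apply, zero_mul, add_zero]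

end Curves

/-! ### Integral elements -/

section IntegralElements

variable {m w : ℕ} {h : Fin (w + 1) → ℕ} {Q : Matrix (Fin m) (Fin m) ℝ} {H : Filtration m}
  {b : Basis (BlockIndex h) ℂ (Fin m → ℂ)} {Y Y₀ A B X : BlockMatrix h}

theorem sum_single_smul (θ : BlockMatrix h →ₗ[ℂ] ℂ) (A : BlockMatrix h) :
    θ A = ∑ s, ∑ t, A s t * θ (Matrix.single s t 1) := by
  conv_lhs => rw [Matrix.matrix_eq_sum_single A]
  simp only [map_sum]
  refine Finset.sum_congr rfl fun s _ => Finset.sum_congr rfl fun t _ => ?_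
  rw [← smul_eq_mul, ← map_smul, Matrix.smul_single, smul_eq_mul, mul_one]

/-- The derivative of a 1-form along a curve, evaluated on a varying vector. -/
theorem hasDerivAt_oneForm {θ : OneForm h} {γ δ : ℂ → BlockMatrix h}
    (hθ : ∀ A, DifferentiableAt ℂ (fun Z => θ Z A) (γ 0)) (hγ : DifferentiableAt ℂ γ 0)
    (hδ : DifferentiableAt ℂ δ 0) :
    HasDerivAt (fun t => θ (γ t) (δ t))
      (fderiv ℂ (fun Z => θ Z (δ 0)) (γ 0) (deriv γ 0) + θ (γ 0) (deriv δ 0)) 0 := by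
  have h1 : ∀ A, HasDerivAt (fun t => θ (γ t) A)
      (fderiv ℂ (fun Z => θ Z A) (γ 0) (deriv γ 0)) 0 := fun A =>
    HasFDerivAt.comp_hasDerivAt (F := BlockIndex h → BlockIndex h → ℂ) 0 (hθ A).hasFDerivAt
      hγ.hasDerivAt
  have h2 : ∀ s t, HasDerivAt (fun x => δ x s t) (deriv δ 0 s t) 0 := fun s t =>
    (hasFDerivAt_matrix_apply hδ s t).hasDerivAt
  -- A form is assumed differentiable only on each fixed vector. Expanding in matrix units reduces a
  -- varying vector to the product rule for scalar functions.
  have h3 : fderiv ℂ (fun Z => θ Z (δ 0)) (γ 0) (deriv γ 0) =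
      ∑ s, ∑ t, δ 0 s t * fderiv ℂ (fun Z => θ Z (Matrix.single s t 1)) (γ 0) (deriv γ 0) := by
    refine (h1 (δ 0)).unique ?_
    simp only [fun x => sum_single_smul (θ (γ x)) (δ 0)]
    exact HasDerivAt.fun_sum fun s _ => HasDerivAt.fun_sum fun t _ => (h1 _).const_mul _
  rw [h3, sum_single_smul _ (deriv δ 0), ← Finset.sum_add_distrib]
  simp only [fun x => sum_single_smul (θ (γ x)) (δ x), ← Finset.sum_add_distrib]
  refine HasDerivAt.fun_sum fun s _ => HasDerivAt.fun_sum fun t _ => ?_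
  exact ((h2 s t).mul (h1 _)).congr_deriv (add_comm _ _)

variable (hb : IsHodgeFrame Q H b) (hH : IsPolarizedHodgeFiltration w h Q H)
  (hS : IsGradedForm (blockDeg h) w (gram Q b))

include hS

theorem mem_tangentVectors (hY : Y ∈ unipotentGroup Q b)
    (hX : gradedPart (blockDeg h) 1 X = X) (hXadj : adj (gram Q b) X = -X) :
    Y * X ∈ tangentVectors (unipotentGroup Q b) Y := by
  rw [unipotentGroup_eq hS] at *
  exact exists_curve hS hY hX hXadj

theorem mem_lowerSub_of_mem_tangentVectors (hA : A ∈ tangentVectors (unipotentGroup Q b) Y) :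
    A ∈ lowerSub (blockDeg h) 1 ∧ adj (gram Q b) (gradedPart (blockDeg h) 1 A) =
      -gradedPart (blockDeg h) 1 A := by
  obtain ⟨γ, -, hγ, rfl⟩ := hA
  rw [unipotentGroup_eq hS] at hγ
  have hd := hγ.self_of_nhds.1
  refine ⟨fderiv_mem_lowerSub_one hd (hγ.mono fun t ht => ht.2.1) 1,
    adj_gradedPart_fderiv hS hd (hγ.mono fun t ht => ⟨ht.2.1, ?_⟩) 1⟩
  rw [ht.2.2, sub_self]
  exact zero_mem _

omit hS in
/-- The entry `(s,t)` of the Maurer-Cartan form `Y⁻¹ dY` of the group. -/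
def maurerCartan (S : BlockMatrix h) (s t : BlockIndex h) : OneForm h := fun Y =>
  { toFun := fun A => (adj S Y * A) s t
    map_add' := fun A B => by rw [mul_add]; rfl
    map_smul' := fun r A => by rw [Matrix.mul_smul]; rfl }

omit hS in
theorem maurerCartan_apply (S : BlockMatrix h) (s t : BlockIndex h) (Y A : BlockMatrix h) :
    maurerCartan S s t Y A = (adj S Y * A) s t := rfl

omit hS in
theorem differentiableAt_maurerCartan (S : BlockMatrix h) (s t : BlockIndex h) (Y A : BlockMatrix h) :
    DifferentiableAt ℂ (fun Z => maurerCartan S s t Z A) Y ∧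
      ∀ B, fderiv ℂ (fun Z => maurerCartan S s t Z A) Y B = (adj S B * A) s t := by
  let L : BlockMatrix h →ₗ[ℂ] ℂ :=
    { toFun := fun Z => (adj S Z * A) s t
      map_add' := fun X Z => by rw [map_add, add_mul]; rfl
      map_smul' := fun r X => by rw [map_smul, Matrix.smul_mul]; rfl }
  let L' : (BlockIndex h → BlockIndex h → ℂ) →L[ℂ] ℂ := LinearMap.toContinuousLinearMap L
  have h1 : HasFDerivAt (E := BlockIndex h → BlockIndex h → ℂ)
      (fun Z => maurerCartan S s t Z A) L' Y := L'.hasFDerivAt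
  refine ⟨h1.differentiableAt, fun B => ?_⟩
  exact congrArg (fun f : (BlockIndex h → BlockIndex h → ℂ) →L[ℂ] ℂ => f B) h1.fderiv

include hb hH

omit hS in
theorem isHorizontalVector_iff (hY : Y ∈ gradedGroup (blockDeg h) (gram Q b)) :
    IsHorizontalVector H b Y A ↔
      ∀ s t, blockDeg h t + 1 < blockDeg h s → (adj (gram Q b) Y * A) s t = 0 := by
  rw [← hb.forall_toLin_mem_iff hH]
  refine forall_congr' fun p => forall_congr' fun x => forall_congr' fun _ => ?_
  rw [mem_groupCoord_iff hY.2, toLin_mul_apply']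

/-- Components of degree at most zero vanish on every tangent vector of the group, those of degree
at least two on horizontal ones. These are the test forms that detect integral elements. -/
theorem maurerCartan_mem_horizontalForms {s t : BlockIndex h}
    (hst : blockDeg h s ≠ blockDeg h t + 1) :
    maurerCartan (gram Q b) s t ∈ horizontalForms Q H b Y₀ := by
  refine ⟨Filter.Eventually.of_forall fun Y A => (differentiableAt_maurerCartan _ s t Y A).1, ?_⟩
  filter_upwards [self_mem_nhdsWithin] with Y hY A hA hhor
  rw [maurerCartan_apply]
  have hA1 := (mem_lowerSub_of_mem_tangentVectors hS hA).1
  rw [unipotentGroup_eq hS] at hY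
  rcases lt_or_gt_of_ne hst with hlt | hgt
  · have : adj (gram Q b) Y * A ∈ lowerSub (blockDeg h) (0 + 1) :=
      mul_mem_lowerSub (mem_lowerSub_zero (hS.adj_sub_one_mem hY.1)) hA1
    exact this s t (by omega)
  · exact (isHorizontalVector_iff hb hH hY).1 hhor s t hgt

/-- Horizontal integral elements are the translates of the abelian subspaces of degree one of the
Lie algebra of the group. -/
theorem isIntegralElement_horizontalForms_iff (hY₀ : Y₀ ∈ unipotentGroup Q b)
    {E : Submodule ℂ (BlockMatrix h)} :
    IsIntegralElement (unipotentGroup Q b) (horizontalForms Q H b Y₀) Y₀ E ↔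
      (∀ A ∈ E, A = Y₀ * gradedPart (blockDeg h) 1 A ∧
        adj (gram Q b) (gradedPart (blockDeg h) 1 A) = -gradedPart (blockDeg h) 1 A) ∧
      ∀ A ∈ E, ∀ B ∈ E, gradedPart (blockDeg h) 1 A * gradedPart (blockDeg h) 1 B =
        gradedPart (blockDeg h) 1 B * gradedPart (blockDeg h) 1 A := by
  have hG := hY₀
  rw [unipotentGroup_eq hS] at hG
  constructor
  · rintro ⟨htan, hE⟩
    have h1 : ∀ A ∈ E, A = Y₀ * gradedPart (blockDeg h) 1 A ∧
        adj (gram Q b) (gradedPart (blockDeg h) 1 A) = -gradedPart (blockDeg h) 1 A := by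
      intro A hA
      obtain ⟨h2, h3⟩ := mem_lowerSub_of_mem_tangentVectors hS (htan A hA)
      refine ⟨(eq_mul_gradedPart_iff hS hG h2).1 fun s t hst => ?_, h3⟩
      exact (hE _ (maurerCartan_mem_horizontalForms hb hH hS (by omega))).1 A hA
    have h2 : ∀ A ∈ E, ∀ B ∈ E, adj (gram Q b) A * B =
        -(gradedPart (blockDeg h) 1 A * gradedPart (blockDeg h) 1 B) := by
      intro A hA B hB
      conv_lhs => rw [(h1 A hA).1, (h1 B hB).1, hS.adj_mul, (h1 A hA).2, mul_assoc,
        ← mul_assoc (adj _ Y₀), hG.2, one_mul, neg_mul]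
    refine ⟨h1, fun A hA B hB => ?_⟩
    rw [← gradedPart_mul_gradedPart, ← gradedPart_mul_gradedPart (X := B)]
    ext s t
    rw [gradedPart_apply, gradedPart_apply]
    split_ifs with hst
    swap
    · rfl
    -- In degree two, the exterior derivative of the Maurer-Cartan form is the commutator of the
    -- degree one parts.
    have h3 := (hE _ (maurerCartan_mem_horizontalForms hb hH hS (s := s) (t := t)
      (by omega))).2 A hA B hB
    rw [extD, (differentiableAt_maurerCartan _ s t Y₀ B).2, (differentiableAt_maurerCartan _ s t Y₀ A).2,
      h2 A hA B hB, h2 B hB A hA, Matrix.neg_apply, Matrix.neg_apply, sub_neg_eq_add,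
      neg_add_eq_zero] at h3
    exact h3
  · rintro ⟨h1, h2⟩
    refine ⟨fun A hA => ?_, fun θ hθ => ⟨fun A hA => ?_, fun A hA B hB => ?_⟩⟩
    · rw [(h1 A hA).1]
      exact mem_tangentVectors hS hY₀ (gradedPart_gradedPart A) (h1 A hA).2
    · refine hθ.2.self_of_nhdsWithin hY₀ A ?_ ?_
      · rw [(h1 A hA).1]
        exact mem_tangentVectors hS hY₀ (gradedPart_gradedPart A) (h1 A hA).2
      · rw [isHorizontalVector_iff hb hH hG, (h1 A hA).1, ← mul_assoc, hG.2, one_mul]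
        intro s t hst
        rw [gradedPart_apply, if_neg (by omega)]
    -- Extend `A` to the left-invariant field `γ(t) A₁` along a curve in the group with velocity
    -- `B`. As `θ` vanishes on this horizontal field, differentiation gives the formula;
    -- antisymmetrized, it is `θ` on a commutator, which is zero.
    · have key : ∀ A ∈ E, ∀ B ∈ E, fderiv ℂ (fun Z => θ Z A) Y₀ B =
          -θ Y₀ (Y₀ * (gradedPart (blockDeg h) 1 B * gradedPart (blockDeg h) 1 A)) := by
        intro A hA B hB
        obtain ⟨γ, hγ0, hγ, hγd⟩ := exists_curve hS hG (gradedPart_gradedPart B) (h1 B hB).2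
        rw [← (h1 B hB).1] at hγd
        have hγdiff := hγ.self_of_nhds.1
        have hc := differentiableAt_matrix_const (gradedPart (blockDeg h) 1 A) (0 : ℂ)
        let δ : ℂ → BlockMatrix h := fun t => γ t * gradedPart (blockDeg h) 1 A
        have hδ : DifferentiableAt ℂ δ 0 := differentiableAt_matrix_mul hγdiff hc
        have hδ0 : δ 0 = A := by
          change γ 0 * gradedPart (blockDeg h) 1 A = A
          rw [hγ0, ← (h1 A hA).1]
        have hδd : deriv δ 0 =
            Y₀ * (gradedPart (blockDeg h) 1 B * gradedPart (blockDeg h) 1 A) := by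
          change fderiv ℂ (fun t => γ t * gradedPart (blockDeg h) 1 A) 0 1 = _
          have h3 : fderiv ℂ (fun _ : ℂ => gradedPart (blockDeg h) 1 A) 0 = 0 :=
            fderiv_const_apply (F := BlockIndex h → BlockIndex h → ℂ) _
          rw [fderiv_matrix_mul hγdiff hc, show fderiv ℂ γ 0 1 = B from hγd, h3,
            _root_.zero_apply, mul_zero, zero_add, ← mul_assoc, ← (h1 B hB).1]
        have hlim : Tendsto γ (𝓝 0) (𝓝[unipotentGroup Q b] Y₀) := by
          refine tendsto_nhdsWithin_iff.2 ⟨?_, ?_⟩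
          · rw [← hγ0]
            exact continuousAt_matrix hγdiff
          · rw [unipotentGroup_eq hS]
            exact hγ.mono fun t ht => ht.2
        have hzero : (fun t => θ (γ t) (δ t)) =ᶠ[𝓝 0] fun _ => 0 := by
          filter_upwards [hlim.eventually hθ.2, hγ] with t h3 ht
          refine h3 _ (mem_tangentVectors hS (by rw [unipotentGroup_eq hS]; exact ht.2)
            (gradedPart_gradedPart A) (h1 A hA).2) ?_
          rw [isHorizontalVector_iff hb hH ht.2]
          intro s t hst
          rw [← mul_assoc, ht.2.2, one_mul, gradedPart_apply, if_neg (by omega)]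
        have h4 := hasDerivAt_oneForm (θ := θ) (γ := γ) (δ := δ)
          (fun A => by rw [hγ0]; exact hθ.1.self_of_nhds A) hγdiff hδ
        have h5 := h4.unique ((hasDerivAt_const (0 : ℂ) (0 : ℂ)).congr_of_eventuallyEq hzero)
        rw [hδ0, hγ0, hγd, hδd] at h5
        exact eq_neg_of_add_eq_zero_left h5
      rw [extD, key B hB A hA, key A hA B hB, h2 A hA B hB, sub_self]

omit hb hH

theorem isIntegralElement_contactForms_iff (hY₀ : Y₀ ∈ unipotentGroup Q b)
    {E : Submodule ℂ (BlockMatrix h)} :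
    IsIntegralElement (contactManifold Q b) (contactForms h) (prW h Y₀) E ↔
      (∀ A ∈ E, A = prW h (Y₀ * gradedPart (blockDeg h) 1 A) ∧
        adj (gram Q b) (gradedPart (blockDeg h) 1 A) = -gradedPart (blockDeg h) 1 A) ∧
      ∀ A ∈ E, ∀ B ∈ E, gradedPart (blockDeg h) 1 A * gradedPart (blockDeg h) 1 B =
        gradedPart (blockDeg h) 1 B * gradedPart (blockDeg h) 1 A := by
  have hG := hY₀
  rw [unipotentGroup_eq hS] at hG
  have hq : ∀ X, gradedPart (blockDeg h) 2 (prW h Y₀ * gradedPart (blockDeg h) 1 X) =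
      gradedPart (blockDeg h) 2 (Y₀ * gradedPart (blockDeg h) 1 X) := by
    intro X
    rw [← sub_eq_zero, ← map_sub, ← sub_mul]
    exact gradedPart_eq_zero (mul_mem_lowerSub (prW_sub_mem Y₀) (gradedPart_mem X)) (by omega)
  have hYX : ∀ X, Y₀ * gradedPart (blockDeg h) 1 X ∈ lowerSub (blockDeg h) 1 := by
    intro X
    simpa using mul_mem_lowerSub (mem_lowerSub_zero hG.1) (gradedPart_mem (d := 1) X)
  have hlow : ∀ X, prW h (Y₀ * gradedPart (blockDeg h) 1 X) ∈ lowerSub (blockDeg h) 1 := by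
    intro X
    simpa using add_mem (lowerSub_anti (by omega : 1 ≤ 3)
      (prW_sub_mem (Y₀ * gradedPart (blockDeg h) 1 X))) (hYX X)
  constructor
  · rintro ⟨htan, hE⟩
    have h1 : ∀ A ∈ E, A = prW h (Y₀ * gradedPart (blockDeg h) 1 A) ∧
        adj (gram Q b) (gradedPart (blockDeg h) 1 A) = -gradedPart (blockDeg h) 1 A := by
      intro A hA
      have hcont := contactForms_eq_zero_iff.1 fun θ hθ => (hE θ hθ).1 A hA
      rw [hq] at hcont
      obtain ⟨γ, -, hγ, hγA⟩ := htan A hA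
      have hγ' : ∀ᶠ t in 𝓝 0, γ t - 1 ∈ lowerSub (blockDeg h) 1 ∧
          (∀ s t', blockDeg h t' + 2 < blockDeg h s → γ t s t' = 0) ∧
          adj (gram Q b) (γ t) * γ t - 1 ∈ lowerSub (blockDeg h) 3 :=
        hγ.mono fun t ht => (mem_contactManifold_iff hS).1 ht.2
      have hd := hγ.self_of_nhds.1
      have hA1 : A ∈ lowerSub (blockDeg h) 1 := by
        rw [← hγA]
        exact fderiv_mem_lowerSub_one hd (hγ'.mono fun t ht => ht.1) 1
      have hprA : prW h A = A := by
        have h2 : (fun t => prW h (γ t)) =ᶠ[𝓝 0] γ := hγ'.mono fun t ht => prW_eq_self ht.2.1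
        have h3 := fderiv_linearMap_comp_matrix (prW h) hd 1
        rw [h2.fderiv_eq] at h3
        rw [← hγA]
        exact h3.symm
      refine ⟨?_, ?_⟩
      -- The two vectors agree in degree one trivially and in degree two by the contact forms; a
      -- tangent vector of `W` has no further blocks.
      · have h5 : prW h (A - Y₀ * gradedPart (blockDeg h) 1 A) = 0 := by
          rw [prW_eq_zero_iff]
          refine mem_lowerSub_succ (mem_lowerSub_succ (sub_mem hA1 (hYX A)) ?_) ?_
          · rw [map_sub, gradedPart_mul_left hG.1 (gradedPart_mem _), gradedPart_gradedPart,
              sub_self]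
          · rw [map_sub, hcont, sub_self]
        rw [map_sub, hprA] at h5
        exact sub_eq_zero.1 h5
      · rw [← hγA]
        exact adj_gradedPart_fderiv hS hd (hγ'.mono fun t ht => ⟨ht.1, ht.2.2⟩) 1
    refine ⟨h1, fun A hA B hB => ?_⟩
    refine (extD_contactForms_eq_zero_iff ?_ ?_).1 fun θ hθ => (hE θ hθ).2 A hA B hB
    · rw [(h1 A hA).1]
      exact hlow A
    · rw [(h1 B hB).1]
      exact hlow B
  · rintro ⟨h1, h2⟩
    have h3 : ∀ A ∈ E, ∀ θ ∈ contactForms h, θ (prW h Y₀) A = 0 := by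
      intro A hA
      rw [contactForms_eq_zero_iff, hq]
      conv_lhs => rw [(h1 A hA).1, gradedPart_prW (by omega)]
    have hlow' : ∀ A ∈ E, A ∈ lowerSub (blockDeg h) 1 := by
      intro A hA
      rw [(h1 A hA).1]
      exact hlow A
    refine ⟨fun A hA => ?_, fun θ hθ => ⟨fun A hA => h3 A hA θ hθ, fun A hA B hB =>
      (extD_contactForms_eq_zero_iff (hlow' A hA) (hlow' B hB)).2 (h2 A hA B hB) θ hθ⟩⟩
    -- Tangency to `W` is obtained by projecting a curve of the group.
    obtain ⟨γ, hγ0, hγ, hγd⟩ := exists_curve hS hG (gradedPart_gradedPart A) (h1 A hA).2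
    refine ⟨fun t => prW h (γ t), congrArg _ hγ0, ?_, ?_⟩
    · filter_upwards [hγ] with t ht
      exact ⟨differentiableAt_linearMap_comp _ ht.1,
        prW_mem_contactManifold hS (by rw [unipotentGroup_eq hS]; exact ht.2)⟩
    · rw [(h1 A hA).1, ← hγd]
      exact fderiv_linearMap_comp_matrix (prW h) hγ.self_of_nhds.1 1

include hb hH

/-- On a horizontal element, `A ↦ Y₀ A₁` undoes `prW`. This gives both injectivity and equality of
dimensions. -/
theorem map_prW_map_gradedPart (hY₀ : Y₀ ∈ unipotentGroup Q b) {E : Submodule ℂ (BlockMatrix h)}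
    (hE : IsIntegralElement (unipotentGroup Q b) (horizontalForms Q H b Y₀) Y₀ E) :
    (E.map (prW h)).map (LinearMap.mulLeft ℂ Y₀ ∘ₗ gradedPart (blockDeg h) 1) = E := by
  have h1 := ((isIntegralElement_horizontalForms_iff hb hH hS hY₀).1 hE).1
  have h2 : ∀ A ∈ E, (LinearMap.mulLeft ℂ Y₀ ∘ₗ gradedPart (blockDeg h) 1) (prW h A) = A := by
    intro A hA
    rw [LinearMap.comp_apply, gradedPart_prW (by omega), LinearMap.mulLeft_apply, ← (h1 A hA).1]
  ext A
  constructor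
  · rintro ⟨_, ⟨A', hA', rfl⟩, rfl⟩
    rwa [h2 A' hA']
  · intro hA
    exact ⟨_, ⟨A, hA, rfl⟩, h2 A hA⟩

theorem finrank_map_prW (hY₀ : Y₀ ∈ unipotentGroup Q b) {E : Submodule ℂ (BlockMatrix h)}
    (hE : IsIntegralElement (unipotentGroup Q b) (horizontalForms Q H b Y₀) Y₀ E) :
    finrank ℂ (E.map (prW h)) = finrank ℂ E := by
  refine le_antisymm (Submodule.finrank_map_le _ _) ?_
  conv_lhs => rw [← map_prW_map_gradedPart hb hH hS hY₀ hE]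
  exact Submodule.finrank_map_le _ _

theorem bijOn_map_prW (hY₀ : Y₀ ∈ unipotentGroup Q b) :
    Set.BijOn (fun E : Submodule ℂ (BlockMatrix h) => E.map (prW h))
      {E | IsIntegralElement (unipotentGroup Q b) (horizontalForms Q H b Y₀) Y₀ E}
      {E' | IsIntegralElement (contactManifold Q b) (contactForms h) (prW h Y₀) E'} := by
  have hG := hY₀
  rw [unipotentGroup_eq hS] at hG
  refine ⟨fun E hE => ?_, fun E hE E' hE' hEE' => ?_, fun E' hE' => ?_⟩
  · obtain ⟨h1, h2⟩ := (isIntegralElement_horizontalForms_iff hb hH hS hY₀).1 hE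
    refine (isIntegralElement_contactForms_iff hS hY₀).2 ⟨?_, ?_⟩
    · rintro _ ⟨A, hA, rfl⟩
      rw [gradedPart_prW (by omega), ← (h1 A hA).1]
      exact ⟨rfl, (h1 A hA).2⟩
    · rintro _ ⟨A, hA, rfl⟩ _ ⟨B, hB, rfl⟩
      rw [gradedPart_prW (by omega), gradedPart_prW (by omega)]
      exact h2 A hA B hB
  · rw [← map_prW_map_gradedPart hb hH hS hY₀ hE, ← map_prW_map_gradedPart hb hH hS hY₀ hE']
    exact congrArg _ hEE'
  · obtain ⟨h1, h2⟩ := (isIntegralElement_contactForms_iff hS hY₀).1 hE'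
    have h3 : ∀ A, gradedPart (blockDeg h) 1 (Y₀ * gradedPart (blockDeg h) 1 A) =
        gradedPart (blockDeg h) 1 A := fun A => by
      rw [gradedPart_mul_left hG.1 (gradedPart_mem _), gradedPart_gradedPart]
    refine ⟨E'.map (LinearMap.mulLeft ℂ Y₀ ∘ₗ gradedPart (blockDeg h) 1),
      (isIntegralElement_horizontalForms_iff hb hH hS hY₀).2 ⟨?_, ?_⟩, ?_⟩
    · rintro _ ⟨A, hA, rfl⟩
      rw [LinearMap.comp_apply, LinearMap.mulLeft_apply, h3]
      exact ⟨rfl, (h1 A hA).2⟩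
    · rintro _ ⟨A, hA, rfl⟩ _ ⟨B, hB, rfl⟩
      simp only [LinearMap.comp_apply, LinearMap.mulLeft_apply, h3]
      exact h2 A hA B hB
    · have h4 : ∀ A ∈ E', prW h ((LinearMap.mulLeft ℂ Y₀ ∘ₗ gradedPart (blockDeg h) 1) A) = A :=
        fun A hA => (h1 A hA).1.symm
      ext A
      constructor
      · rintro ⟨_, ⟨A', hA', rfl⟩, rfl⟩
        rwa [h4 A' hA']
      · intro hA
        exact ⟨_, ⟨A, hA, rfl⟩, h4 A hA⟩

end IntegralElements

/-! ### Assembling the correspondence of germs -/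

section Correspondence

variable {m w : ℕ} {h : Fin (w + 1) → ℕ} {Q : Matrix (Fin m) (Fin m) ℝ} {H : Filtration m}
  {b : Basis (BlockIndex h) ℂ (Fin m → ℂ)} {Y₀ : BlockMatrix h}

theorem IsGroupGerm.eq_of_map_groupCoord_eq (hb : IsHodgeFrame Q H b)
    (hH : IsPolarizedHodgeFiltration w h Q H) (hS : IsGradedForm (blockDeg h) w (gram Q b))
    {k k' : ℕ} {𝓩 𝓩' : Filter (BlockMatrix h)} (h𝓩 : IsGroupGerm (gram Q b) Y₀ k 𝓩)
    (h𝓩' : IsGroupGerm (gram Q b) Y₀ k' 𝓩')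
    (heq : map (groupCoord H b) 𝓩 = map (groupCoord H b) 𝓩') : 𝓩 = 𝓩' :=
  (Filter.map_eq_map_iff_of_injOn h𝓩.mem h𝓩'.mem (groupCoord_injOn hb hH hS)).1 heq

/-- The correspondence between the germs of integral manifolds of the two systems, by means of
the integral manifolds in the group. -/
theorem exists_germ_equiv (hb : IsHodgeFrame Q H b) (hH : IsPolarizedHodgeFiltration w h Q H)
    (hS : IsGradedForm (blockDeg h) w (gram Q b)) (hY₀ : Y₀ ∈ unipotentGroup Q b)
    (hD : groupCoord H b Y₀ ∈ periodDomain w h Q) :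
    ∃ e : {𝓖 : Filter (Filtration m) //
              ∃ k, IsHorizontalGerm w h Q (groupCoord H b Y₀) k 𝓖} ≃
           {𝓣 : Filter (BlockMatrix h) // ∃ k, IsContactGerm Q b (prW h Y₀) k 𝓣},
      (∀ 𝓖, ∃ 𝓩 : Filter (BlockMatrix h), unipotentGroup Q b ∈ 𝓩 ∧
        Filter.map (groupCoord H b) 𝓩 = 𝓖.1 ∧ Filter.map (prW h) 𝓩 = (e 𝓖).1) ∧
      (∀ 𝓖 k, IsHorizontalGerm w h Q (groupCoord H b Y₀) k 𝓖.1 ↔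
        IsContactGerm Q b (prW h Y₀) k (e 𝓖).1) := by
  have hG := hY₀
  rw [unipotentGroup_eq hS] at hG
  -- Germs in the group map bijectively to both sides, and the correspondence is the composite of
  -- one bijection with the inverse of the other.
  let C := {𝓩 : Filter (BlockMatrix h) // ∃ k, IsGroupGerm (gram Q b) Y₀ k 𝓩}
  let Φ : C → {𝓖 : Filter (Filtration m) //
      ∃ k, IsHorizontalGerm w h Q (groupCoord H b Y₀) k 𝓖} := fun 𝓩 =>
    ⟨map (groupCoord H b) 𝓩.1, 𝓩.2.imp fun _ h𝓩 => h𝓩.isHorizontalGerm hb hH hS hG hD⟩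
  let P : C → {𝓣 : Filter (BlockMatrix h) // ∃ k, IsContactGerm Q b (prW h Y₀) k 𝓣} := fun 𝓩 =>
    ⟨map (prW h) 𝓩.1, 𝓩.2.imp fun _ h𝓩 => h𝓩.isContactGerm hS⟩
  have hΦ : Function.Bijective Φ := by
    refine ⟨fun ⟨𝓩, k, h𝓩⟩ ⟨𝓩', k', h𝓩'⟩ heq => Subtype.ext ?_, fun ⟨𝓖, k, h𝓖⟩ => ?_⟩
    · exact h𝓩.eq_of_map_groupCoord_eq hb hH hS h𝓩' (congrArg Subtype.val heq)
    · obtain ⟨𝓩, h𝓩, heq⟩ := h𝓖.exists_isGroupGerm hb hH hS hG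
      exact ⟨⟨𝓩, k, h𝓩⟩, Subtype.ext heq⟩
  have hP : Function.Bijective P := by
    refine ⟨fun ⟨𝓩, k, h𝓩⟩ ⟨𝓩', k', h𝓩'⟩ heq => Subtype.ext ?_, fun ⟨𝓣, k, h𝓣⟩ => ?_⟩
    · exact h𝓩.eq_of_map_prW_eq h𝓩' (congrArg Subtype.val heq)
    · obtain ⟨𝓩, h𝓩, heq⟩ := h𝓣.exists_isGroupGerm hS hY₀
      exact ⟨⟨𝓩, k, h𝓩⟩, Subtype.ext heq⟩
  have he : ∀ 𝓩, ((Equiv.ofBijective Φ hΦ).symm.trans (Equiv.ofBijective P hP)) (Φ 𝓩) = P 𝓩 := by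
    intro 𝓩
    rw [Equiv.trans_apply, Equiv.ofBijective_symm_apply_apply, Equiv.ofBijective_apply]
  refine ⟨(Equiv.ofBijective Φ hΦ).symm.trans (Equiv.ofBijective P hP), fun 𝓖 => ?_,
    fun 𝓖 k => ?_⟩
  · obtain ⟨𝓩, rfl⟩ := hΦ.2 𝓖
    rw [he]
    refine ⟨𝓩.1, ?_, rfl, rfl⟩
    rw [unipotentGroup_eq hS]
    exact 𝓩.2.choose_spec.mem
  · obtain ⟨⟨𝓩, k₀, h𝓩⟩, rfl⟩ := hΦ.2 𝓖
    rw [he]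
    -- Injectivity holds across dimensions: a `k`-dimensional presentation of either image lifts to
    -- a `k`-dimensional germ in the group, which must be `𝓩` itself.
    constructor
    · intro h𝓖
      obtain ⟨𝓩', h𝓩', heq⟩ := h𝓖.exists_isGroupGerm hb hH hS hG
      obtain rfl := h𝓩'.eq_of_map_groupCoord_eq hb hH hS h𝓩 heq
      exact h𝓩'.isContactGerm hS
    · intro h𝓣
      obtain ⟨𝓩', h𝓩', heq⟩ := h𝓣.exists_isGroupGerm hS hY₀
      obtain rfl := h𝓩'.eq_of_map_prW_eq h𝓩 heq
      exact h𝓩'.isHorizontalGerm hb hH hS hG hD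

end Correspondence

end HodgeContact

end

open HodgeContact in
theorem theorem4p3 {w m : ℕ} (h : Fin (w + 1) → ℕ) (Q : Matrix (Fin m) (Fin m) ℝ)
    (hQdet : Q.det ≠ 0) (hQsymm : Qᵀ = (-1 : ℝ) ^ w • Q)
    (H : Filtration m) (hH : H ∈ periodDomain w h Q)
    (b : Module.Basis (BlockIndex h) ℂ (Fin m → ℂ)) (hb : IsHodgeFrame Q H b)
    (Y₀ : BlockMatrix h) (hY₀ : Y₀ ∈ unipotentGroup Q b)
    (hD : groupCoord H b Y₀ ∈ periodDomain w h Q) :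
    prW h '' unipotentGroup Q b = contactManifold Q b ∧
    (∃ e : {𝓖 : Filter (Filtration m) //
              ∃ k, IsHorizontalGerm w h Q (groupCoord H b Y₀) k 𝓖} ≃
           {𝓣 : Filter (BlockMatrix h) // ∃ k, IsContactGerm Q b (prW h Y₀) k 𝓣},
      (∀ 𝓖, ∃ 𝓩 : Filter (BlockMatrix h), unipotentGroup Q b ∈ 𝓩 ∧
        Filter.map (groupCoord H b) 𝓩 = 𝓖.1 ∧ Filter.map (prW h) 𝓩 = (e 𝓖).1) ∧
      (∀ 𝓖 k, IsHorizontalGerm w h Q (groupCoord H b Y₀) k 𝓖.1 ↔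
        IsContactGerm Q b (prW h Y₀) k (e 𝓖).1)) ∧
    Set.BijOn (fun E : Submodule ℂ (BlockMatrix h) => E.map (prW h))
      {E | IsIntegralElement (unipotentGroup Q b) (horizontalForms Q H b Y₀) Y₀ E}
      {E' | IsIntegralElement (contactManifold Q b) (contactForms h) (prW h Y₀) E'} ∧
    (∀ E : Submodule ℂ (BlockMatrix h),
      IsIntegralElement (unipotentGroup Q b) (horizontalForms Q H b Y₀) Y₀ E →
        Module.finrank ℂ (E.map (prW h)) = Module.finrank ℂ E) := by
  have hS := hb.isGradedForm_gram hH hQdet hQsymm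
  exact ⟨prW_image_unipotentGroup hS, exists_germ_equiv hb hH hS hY₀ hD,
    bijOn_map_prW hb hH hS hY₀, fun E hE => finrank_map_prW hb hH hS hY₀ hE⟩
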